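/- **Setting.** Let $a,b,s\in\mathbb R$ with $s\neq0$. Consider, for $t>0$, $x\in(0,1)$, the cascade $$\partial_t y=\partial_{xx}y+ay,\quad \partial_t z=\partial_{xx}z+bz,\quad \partial_xy(t,0)=s\,z(t,0),\quad y(t,1)=\partial_xz(t,1)=0,\quad \partial_xz(t,0)=u(t),$$ with control $u$ and with the measurement, for some $\xi_p\in[0,1]$, either $y_m(t)=y(t,\xi_p)$ (Dirichlet) or $y_m(t)=\partial_xy(t,\xi_p)$ (Neumann). For $n,m\in\mathbb N=\{0,1,\dots\}$ let $\lambda_{1,n}=a-(n+\frac12)^2\pi^2$, $\lambda_{2,m}=b-m^2\pi^2$, $\mu_0=1$ and $\mu_m=\sqrt2$ if $m\ge1$. Let $\Delta$ be the set of $(n,m)\in\mathbb N^2$ with $4(b-a)=(4m^2-(2n+1)^2)\pi^2$ (that is, $\lambda_{1,n}=\lambda_{2,m}$), let $\Delta_1,\Delta_2$ be its two projections, and let $\Theta$ be the set of $n\in\mathbb N$ such that $4(b-a)=((2k+1)^2-(2n+1)^2)\pi^2$ for some $k\in\mathbb N$. Let $r_m$ and $r_n^*$ be square roots in $\mathbb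 C$ of $\lambda_{2,m}-a$ and $\lambda_{1,n}-b$. Define the real functions on $[0,1]$ $$\phi_{1,n}(x)=\sqrt2\cos((n+\tfrac12)\pi x),\qquad \psi_{2,m}(x)=\mu_m\cos(m\pi x),$$ $$\phi_{2,m}(x)=\begin{cases}\frac{s\mu_m}{(k+1/2)\pi}(1-x)\sin((k+\frac12)\pi x)&\text{if }(k,m)\in\Delta,\\ s\mu_m(x-1)&\text{if }m\notin\Delta_2,\ b-a=m^2\pi^2,\\ -\frac{s\mu_m}{r_m\cosh r_m}\sinh(r_m(1-x))&\text{if }m\notin\Delta_2,\ b-a\ne m^2\pi^2,\end{cases}$$ $$\psi_{1,n}(x)=\begin{cases}-\sqrt2 s\big(\frac13+\frac1{(2n+1)^2\pi^2}\big)+\sqrt2sx-\frac{\sqrt2}2sx^2&\text{if }(n,0)\in\Delta,\\ \frac{\sqrt2s}{k\pi}(1-x)\sin(k\pi x)-\frac{2s}{\pi^2}\big(\frac1{(2n+1)^2}+\frac1{4k^2}\big)\sqrt2\cos(k\pi x)&\text{if }(n,k)\in\Delta,\ k\ge1,\\ -\frac{\sqrt2s}{r_n^*\sinh r_n^*}\cosh(r_n^*(1-x))&\text{if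 }n\notin\Delta_1.\end{cases}$$ With $\varphi(x)=x-x^2/2$, $\alpha=\varphi''+b\varphi$, $\beta=-\varphi$, put $\alpha_{i,k}=\int_0^1\alpha\,\psi_{i,k}\,dx$ and $\beta_{i,k}=\int_0^1\beta\,\psi_{i,k}\,dx$. Put $c_{i,k}=\phi_{i,k}(\xi_p)$ for the Dirichlet and $c_{i,k}=\phi_{i,k}'(\xi_p)$ for the Neumann measurement. Let $\delta>0$ and let $N_0,M_0\ge0$ be integers with $\lambda_{1,N_0+1}<-\delta$, $\lambda_{2,M_0+1}<-\delta$, $n\le N_0$ for all $n\in\Delta_1$ and $m\le M_0$ for all $m\in\Delta_2$. On $\mathbb R^{N_0+M_0+2}$, with coordinates indexed by the modes $(1,n)$, $0\le n\le N_0$, and $(2,m)$, $0\le m\le M_0$, let $A_1$ be the matrix with diagonal entries $\lambda_{1,n},\lambda_{2,m}$, with entry $-\sqrt2s\mu_m$ in row $(1,n)$ and column $(2,m)$ for $(n,m)\in\Delta$, and with zeros elsewhere; let $B_{1,u}=(\alpha_{i,k})$ and $B_{1,v}=(\beta_{i,k})$ (columns), $C_1=(c_{i,k})$ (row), and $$A_{1,a}=\begin{bmatrix}A_1&B_{1,u}\\0&0\end{bmatrix},\qquad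 B_{1,a}=\begin{bmatrix}B_{1,v}\\1\end{bmatrix}.$$ For gains $K=[K_x\ \ k_u]\in\mathbb R^{1\times(N_0+M_0+3)}$, $L\in\mathbb R^{N_0+M_0+2}$ and integers $N\ge N_0$, $M\ge M_0$, consider the controller $$\begin{aligned}\dot u&=v,\qquad v=-K_x\hat X_1-k_uu,\\ \dot{\hat X}_1&=A_1\hat X_1+B_{1,u}u+B_{1,v}v-L\Big\{C_1\hat X_1+\sum_{n=N_0+1}^Nc_{1,n}\hat x_{1,n}+\sum_{m=M_0+1}^Mc_{2,m}\hat x_{2,m}-y_m\Big\},\\ \dot{\hat x}_{1,n}&=\lambda_{1,n}\hat x_{1,n}+\alpha_{1,n}u+\beta_{1,n}v\quad(N_0<n\le N),\\ \dot{\hat x}_{2,m}&=\lambda_{2,m}\hat x_{2,m}+\alpha_{2,m}u+\beta_{2,m}v\quad(M_0<m\le M).\end{aligned}$$ **Theorem.** Assume that $\Theta\cap\{0,\dots,N_0\}=\emptyset$ (controllability) and that the following observability conditions hold. - Dirichlet measurement: $\cos((n+\frac12)\pi\xi_p)\ne0$ for all $0\le n\le N_0$; and for all $m\in\{0,\dots,M_0\}\setminus\Delta_2$,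 $\xi_p\neq1$ if $b-a=m^2\pi^2$, and $\sinh(r_m(1-\xi_p))\ne0$ if $b-a\ne m^2\pi^2$. - Neumann measurement: $\sin((n+\frac12)\pi\xi_p)\neq0$ for all $0\le n\le N_0$; and $\cosh(r_m(1-\xi_p))\ne0$ for all $m\in\{0,\dots,M_0\}\setminus\Delta_2$ with $b-a\ne m^2\pi^2$. Let $K$ and $L$ be such that all eigenvalues of $A_{1,a}-B_{1,a}K$ and of $A_1-LC_1$ have real part less than $-\delta$. Then, for all sufficiently large integers $N\ge N_0$ and $M\ge M_0$, there exists $C>0$ such that, for all initial conditions $y_0,z_0\in H^2(0,1)$, $u_0\in\mathbb R$, $\hat X_1(0)\in\mathbb R^{N_0+M_0+2}$, $\hat x_{1,n}(0),\hat x_{2,m}(0)\in\mathbb R$ with $y_0(1)=z_0'(1)=0$, $y_0'(0)=sz_0(0)$, $z_0'(0)=u_0$, the (classical) solutions of the closed-loop system satisfy $E(t)\le Ce^{-2\delta t}E(0)$ for every $t\ge0$, where $$E=\int_0^1\big((\partial_xy)^2+z^2+(\partial_xz)^2\big)dx+u^2+\|\hat X_1\|^2+\sum_{n=N_0+1}^N\hat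 x_{1,n}^2+\sum_{m=M_0+1}^M\hat x_{2,m}^2 .$$ -/

import Mathlib

open MeasureTheory

namespace HeatCascade

/-! ## Spectral data of the cascade -/

/-- `λ_{1,n} = a - (n + 1/2)² π²`. -/
noncomputable def lam1 (a : ℝ) (n : ℕ) : ℝ := a - ((n : ℝ) + 1 / 2) ^ 2 * Real.pi ^ 2

/-- `λ_{2,m} = b - m² π²`. -/
noncomputable def lam2 (b : ℝ) (m : ℕ) : ℝ := b - (m : ℝ) ^ 2 * Real.pi ^ 2

/-- The pairs `(n, m)` with `4 (b - a) = (4 m² - (2 n + 1)²) π²`, that is `λ_{1,n} = λ_{2,m}`. -/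
def Delta (a b : ℝ) : Set (ℕ × ℕ) :=
  {p | 4 * (b - a) = (4 * (p.2 : ℝ) ^ 2 - (2 * (p.1 : ℝ) + 1) ^ 2) * Real.pi ^ 2}

/-- First projection of `Δ(a,b)`. -/
def Delta1 (a b : ℝ) : Set ℕ := {n | ∃ m : ℕ, (n, m) ∈ Delta a b}

/-- Second projection of `Δ(a,b)`. -/
def Delta2 (a b : ℝ) : Set ℕ := {m | ∃ n : ℕ, (n, m) ∈ Delta a b}

/-- The set `Θ(a,b)` of the indices `n` of the uncontrollable modes `λ_{1,n}`. -/
def Theta (a b : ℝ) : Set ℕ :=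
  {n | ∃ k : ℕ, 4 * (b - a) = ((2 * (k : ℝ) + 1) ^ 2 - (2 * (n : ℝ) + 1) ^ 2) * Real.pi ^ 2}

/-- `μ_0 = 1` and `μ_m = √2` for `m ≥ 1`. -/
noncomputable def muCoef (m : ℕ) : ℝ := if m = 0 then 1 else √2

/-- One of the two complex square roots of a real number. -/
noncomputable def rootC (x : ℝ) : ℂ := (x : ℂ) ^ (1 / 2 : ℂ)

/-- `r_m`, a square root of `λ_{2,m} - a`. -/
noncomputable def r2 (a b : ℝ) (m : ℕ) : ℂ := rootC (lam2 b m - a)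

/-- `r_n^*`, a square root of `λ_{1,n} - b`. -/
noncomputable def r1 (a b : ℝ) (n : ℕ) : ℂ := rootC (lam1 a n - b)

/-- First component of `φ_{1,n}` (the second one is `0`). -/
noncomputable def phi1 (n : ℕ) (x : ℝ) : ℝ := √2 * Real.cos (((n : ℝ) + 1 / 2) * Real.pi * x)

open Classical in
/-- First component of `φ_{2,m}` (the second one is `μ_m cos (m π x)`). In the third case the
complex number is real. The integer `k` with `(k, m) ∈ Δ(a,b)` is unique. -/
noncomputable def phi2 (a b s : ℝ) (m : ℕ) (x : ℝ) : ℝ :=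
  if h : ∃ k : ℕ, (k, m) ∈ Delta a b then
    s * muCoef m / (((h.choose : ℝ) + 1 / 2) * Real.pi) * (1 - x) *
      Real.sin (((h.choose : ℝ) + 1 / 2) * Real.pi * x)
  else if b - a = (m : ℝ) ^ 2 * Real.pi ^ 2 then
    s * muCoef m * (-1 + x)
  else
    (-((s * muCoef m : ℝ) : ℂ) / (r2 a b m * Complex.cosh (r2 a b m)) *
      Complex.sinh (r2 a b m * (1 - (x : ℂ)))).re

/-- Second component of the dual element `ψ_{2,m}` (the first one is `0`). -/
noncomputable def psi2 (m : ℕ) (x : ℝ) : ℝ := muCoef m * Real.cos ((m : ℝ) * Real.pi * x)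

open Classical in
/-- Second component of the dual element `ψ_{1,n}` (the first one is `√2 cos ((n + 1/2) π x)`).
In the last case the complex number is real. The integer `k` with `(n, k) ∈ Δ(a,b)` is unique. -/
noncomputable def psi1 (a b s : ℝ) (n : ℕ) (x : ℝ) : ℝ :=
  if h : ∃ k : ℕ, (n, k) ∈ Delta a b then
    if h.choose = 0 then
      -s * √2 * (1 / 3 + 1 / ((2 * (n : ℝ) + 1) ^ 2 * Real.pi ^ 2)) + √2 * s * x
        - √2 / 2 * s * x ^ 2
    else
      √2 * s / ((h.choose : ℝ) * Real.pi) * (1 - x) * Real.sin ((h.choose : ℝ) * Real.pi * x)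
        + -(2 * s / Real.pi ^ 2) *
            (1 / (2 * (n : ℝ) + 1) ^ 2 + 1 / (4 * (h.choose : ℝ) ^ 2)) *
            √2 * Real.cos ((h.choose : ℝ) * Real.pi * x)
  else
    (-((√2 * s : ℝ) : ℂ) / (r1 a b n * Complex.sinh (r1 a b n)) *
      Complex.cosh (r1 a b n * (1 - (x : ℂ)))).re

/-! ## Coefficients of the control -/

/-- The lifting `φ(x) = x - x²/2`. -/
noncomputable def lift (x : ℝ) : ℝ := x - x ^ 2 / 2

/-- `α = φ'' + b φ`. -/
noncomputable def alpha (b x : ℝ) : ℝ := -1 + b * lift x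

/-- `β = - φ`. -/
noncomputable def beta (x : ℝ) : ℝ := -lift x

/-- `α_{1,n} = ⟨(0, α), ψ_{1,n}⟩`. -/
noncomputable def alpha1 (a b s : ℝ) (n : ℕ) : ℝ := ∫ x in (0 : ℝ)..1, alpha b x * psi1 a b s n x

/-- `α_{2,m} = ⟨(0, α), ψ_{2,m}⟩`. -/
noncomputable def alpha2 (b : ℝ) (m : ℕ) : ℝ := ∫ x in (0 : ℝ)..1, alpha b x * psi2 m x

/-- `β_{1,n} = ⟨(0, β), ψ_{1,n}⟩`. -/
noncomputable def beta1 (a b s : ℝ) (n : ℕ) : ℝ := ∫ x in (0 : ℝ)..1, beta x * psi1 a b s n x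

/-- `β_{2,m} = ⟨(0, β), ψ_{2,m}⟩`. -/
noncomputable def beta2 (m : ℕ) : ℝ := ∫ x in (0 : ℝ)..1, beta x * psi2 m x

/-! ## Pointwise measurements -/

/-- The two kinds of pointwise measurement: `y(t, ξ)` or `∂ₓ y(t, ξ)`. -/
inductive Measurement where
  | dirichlet
  | neumann

/-- `c_{1,n}`. -/
noncomputable def c1 (ms : Measurement) (ξ : ℝ) (n : ℕ) : ℝ :=
  match ms with
  | .dirichlet => phi1 n ξ
  | .neumann => deriv (phi1 n) ξ

/-- `c_{2,m}`. -/
noncomputable def c2 (ms : Measurement) (a b s ξ : ℝ) (m : ℕ) : ℝ :=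
  match ms with
  | .dirichlet => phi2 a b s m ξ
  | .neumann => deriv (phi2 a b s m) ξ

/-- The explicit observability conditions on the modes `n ≤ N₀`, `m ≤ M₀`. -/
def Observable (ms : Measurement) (a b ξ : ℝ) (N₀ M₀ : ℕ) : Prop :=
  match ms with
  | .dirichlet =>
      (∀ n ≤ N₀, Real.cos (((n : ℝ) + 1 / 2) * Real.pi * ξ) ≠ 0) ∧
      ∀ m ≤ M₀, m ∉ Delta2 a b →
        (b - a = (m : ℝ) ^ 2 * Real.pi ^ 2 → ξ - 1 ≠ 0) ∧
        (b - a ≠ (m : ℝ) ^ 2 * Real.pi ^ 2 → Complex.sinh (r2 a b m * (1 - (ξ : ℂ))) ≠ 0)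
  | .neumann =>
      (∀ n ≤ N₀, Real.sin (((n : ℝ) + 1 / 2) * Real.pi * ξ) ≠ 0) ∧
      ∀ m ≤ M₀, m ∉ Delta2 a b → b - a ≠ (m : ℝ) ^ 2 * Real.pi ^ 2 →
        Complex.cosh (r2 a b m * (1 - (ξ : ℂ))) ≠ 0

/-! ## The truncated model -/

/-- Indices of the modes kept in the truncated model: `inl n` for `λ_{1,n}`, `n ≤ N₀`, and
`inr m` for `λ_{2,m}`, `m ≤ M₀`. -/
abbrev Idx (N₀ M₀ : ℕ) : Type := Fin (N₀ + 1) ⊕ Fin (M₀ + 1)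

open Classical in
/-- `A₁`: diagonal, except for the `2 × 2` Jordan-type blocks of the pairs `(n, m) ∈ Δ(a,b)`. -/
noncomputable def A1 (a b s : ℝ) (N₀ M₀ : ℕ) : Matrix (Idx N₀ M₀) (Idx N₀ M₀) ℝ :=
  Matrix.fromBlocks
    (Matrix.diagonal fun n => lam1 a n)
    (Matrix.of fun n m =>
      if ((n : ℕ), (m : ℕ)) ∈ Delta a b then -(√2 * s * muCoef m) else 0)
    0
    (Matrix.diagonal fun m => lam2 b m)

/-- `B_{1,u}`. -/
noncomputable def B1u (a b s : ℝ) (N₀ M₀ : ℕ) : Idx N₀ M₀ → ℝ :=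
  Sum.elim (fun n => alpha1 a b s n) (fun m => alpha2 b m)

/-- `B_{1,v}`. -/
noncomputable def B1v (a b s : ℝ) (N₀ M₀ : ℕ) : Idx N₀ M₀ → ℝ :=
  Sum.elim (fun n => beta1 a b s n) (fun m => beta2 m)

/-- `C₁`. -/
noncomputable def C1 (ms : Measurement) (a b s ξ : ℝ) (N₀ M₀ : ℕ) : Idx N₀ M₀ → ℝ :=
  Sum.elim (fun n => c1 ms ξ n) (fun m => c2 ms a b s ξ m)

/-- `A_{1,a}`, the matrix of the truncated model augmented with the state `u`. -/
noncomputable def A1a (a b s : ℝ) (N₀ M₀ : ℕ) :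
    Matrix (Idx N₀ M₀ ⊕ Unit) (Idx N₀ M₀ ⊕ Unit) ℝ :=
  Matrix.fromBlocks (A1 a b s N₀ M₀) (Matrix.of fun i _ => B1u a b s N₀ M₀ i) 0 0

/-- `B_{1,a}`. -/
noncomputable def B1a (a b s : ℝ) (N₀ M₀ : ℕ) : Idx N₀ M₀ ⊕ Unit → ℝ :=
  Sum.elim (B1v a b s N₀ M₀) (fun _ => 1)

/-- All complex eigenvalues of the real matrix `A` have real part less than `-δ`. -/
def HurwitzWithRate {ι : Type} [Fintype ι] [DecidableEq ι] (A : Matrix ι ι ℝ) (δ : ℝ) : Prop :=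
  ∀ z ∈ spectrum ℂ (A.map (fun x : ℝ => (x : ℂ))), z.re < -δ

/-! ## The closed-loop system -/

/-- `f` is (the continuous representative of) an element of `H¹(0,1)` and `f'` is its derivative:
`f` is on `[0,1]` a primitive of the function `f'`, which is in `L²(0,1)`. -/
structure IsH1 (f f' : ℝ → ℝ) : Prop where
  memLp : MemLp f' 2 (volume.restrict (Set.Icc (0 : ℝ) 1))
  eq_integral : ∀ x ∈ Set.Icc (0 : ℝ) 1, f x = f 0 + ∫ r in (0 : ℝ)..x, f' r

/-- `t ↦ w t` is continuously differentiable from `[0, ∞)` to `L²(0,1)`, with derivative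
`t ↦ w' t`. -/
def IsC1L2 (w w' : ℝ → ℝ → ℝ) : Prop :=
  ∃ W W' : ℝ → Lp ℝ 2 (volume.restrict (Set.Icc (0 : ℝ) 1)),
    ContinuousOn W' (Set.Ici 0) ∧
    ∀ t : ℝ, 0 ≤ t →
      (W t : ℝ → ℝ) =ᵐ[volume.restrict (Set.Icc (0 : ℝ) 1)] w t ∧
      (W' t : ℝ → ℝ) =ᵐ[volume.restrict (Set.Icc (0 : ℝ) 1)] w' t ∧
      HasDerivWithinAt W (W' t) (Set.Ici 0) t

/-- State of the closed-loop system: the profiles `y` and `z` with their first two space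
derivatives, the control `u`, and the observer states `X̂₁`, `x̂_{1,n}`, `x̂_{2,m}` (the last two are
only used for `N₀ < n ≤ N` and `M₀ < m ≤ M`). -/
structure State (N₀ M₀ : ℕ) where
  y : ℝ → ℝ
  yx : ℝ → ℝ
  yxx : ℝ → ℝ
  z : ℝ → ℝ
  zx : ℝ → ℝ
  zxx : ℝ → ℝ
  u : ℝ
  X1 : Idx N₀ M₀ → ℝ
  x1 : ℕ → ℝ
  x2 : ℕ → ℝ

/-- `y, z ∈ H²(0,1)`, with the boundary conditions
`∂ₓ y(0) = s z(0)`, `y(1) = ∂ₓ z(1) = 0`, `∂ₓ z(0) = u`. -/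
structure State.Admissible {N₀ M₀ : ℕ} (s : ℝ) (S : State N₀ M₀) : Prop where
  y_h1 : IsH1 S.y S.yx
  y_h2 : IsH1 S.yx S.yxx
  z_h1 : IsH1 S.z S.zx
  z_h2 : IsH1 S.zx S.zxx
  y_bc_zero : S.yx 0 = s * S.z 0
  y_bc_one : S.y 1 = 0
  z_bc_zero : S.zx 0 = S.u
  z_bc_one : S.zx 1 = 0

/-- `‖(y, z)‖²` in `H¹_{(1)}(0,1) × H¹(0,1)`, plus `u² + ‖X̂₁‖² + ∑ x̂_{1,n}² + ∑ x̂_{2,m}²`. -/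
noncomputable def State.energy {N₀ M₀ : ℕ} (N M : ℕ) (S : State N₀ M₀) : ℝ :=
  (∫ x in (0 : ℝ)..1, (S.yx x ^ 2 + S.z x ^ 2 + S.zx x ^ 2)) + S.u ^ 2 + ∑ i, S.X1 i ^ 2
    + ∑ n ∈ Finset.Ioc N₀ N, S.x1 n ^ 2 + ∑ m ∈ Finset.Ioc M₀ M, S.x2 m ^ 2

/-- The measured output `y(ξ)` or `∂ₓ y(ξ)`. -/
def State.output {N₀ M₀ : ℕ} (ms : Measurement) (ξ : ℝ) (S : State N₀ M₀) : ℝ :=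
  match ms with
  | .dirichlet => S.y ξ
  | .neumann => S.yx ξ

/-- The feedback `v = - K_x X̂₁ - k_u u`. -/
def State.feedback {N₀ M₀ : ℕ} (Kx : Idx N₀ M₀ → ℝ) (ku : ℝ) (S : State N₀ M₀) : ℝ :=
  -(Kx ⬝ᵥ S.X1) - ku * S.u

/-- `S` is a classical solution on `[0, ∞)` of the heat-heat cascade in closed loop with the
output-feedback controller of gains `K = [K_x, k_u]` and `L` and of orders `N`, `M`. -/
structure IsSolution {N₀ M₀ : ℕ} (a b s : ℝ) (ms : Measurement) (ξ : ℝ)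
    (Kx : Idx N₀ M₀ → ℝ) (ku : ℝ) (L : Idx N₀ M₀ → ℝ) (N M : ℕ) (S : ℝ → State N₀ M₀) : Prop where
  admissible : ∀ t : ℝ, 0 ≤ t → (S t).Admissible s
  heat_y : IsC1L2 (fun t x => (S t).y x) (fun t x => (S t).yxx x + a * (S t).y x)
  heat_z : IsC1L2 (fun t x => (S t).z x) (fun t x => (S t).zxx x + b * (S t).z x)
  ode_u : ∀ t : ℝ, 0 ≤ t →
    HasDerivWithinAt (fun τ => (S τ).u) ((S t).feedback Kx ku) (Set.Ici 0) t
  ode_X1 : ∀ t : ℝ, 0 ≤ t →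
    HasDerivWithinAt (fun τ => (S τ).X1)
      ((A1 a b s N₀ M₀).mulVec (S t).X1 + (S t).u • B1u a b s N₀ M₀
        + (S t).feedback Kx ku • B1v a b s N₀ M₀
        - (C1 ms a b s ξ N₀ M₀ ⬝ᵥ (S t).X1
            + ∑ n ∈ Finset.Ioc N₀ N, c1 ms ξ n * (S t).x1 n
            + ∑ m ∈ Finset.Ioc M₀ M, c2 ms a b s ξ m * (S t).x2 m
            - (S t).output ms ξ) • L)
      (Set.Ici 0) t
  ode_x1 : ∀ t : ℝ, 0 ≤ t → ∀ n ∈ Finset.Ioc N₀ N,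
    HasDerivWithinAt (fun τ => (S τ).x1 n)
      (lam1 a n * (S t).x1 n + alpha1 a b s n * (S t).u
        + beta1 a b s n * (S t).feedback Kx ku)
      (Set.Ici 0) t
  ode_x2 : ∀ t : ℝ, 0 ≤ t → ∀ m ∈ Finset.Ioc M₀ M,
    HasDerivWithinAt (fun τ => (S τ).x2 m)
      (lam2 b m * (S t).x2 m + alpha2 b m * (S t).u
        + beta2 m * (S t).feedback Kx ku)
      (Set.Ici 0) t

end HeatCascade

open HeatCascade

namespace HeatCascade

open Set Filter Topology

/-! ## Square-integrable functions on the unit interval -/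

/-! Put w = z - u·`lift`, which moves the control from the boundary into the equation. The generator
of the homogenised cascade is triangular; its generalised eigenvectors are (φ_{1,n}, 0) and
(φ_{2,m}, ψ_{2,m}), with dual family (φ_{1,n}, ψ_{1,n}) and (0, ψ_{2,m}). Pairing (y, w) with the
dual family turns the equations into scalar ODEs x' = λx + αu + βv, except that a resonant pair in Δ
gives a 2 × 2 triangular block, which lies inside `A1` (`IsSolution.hasDerivWithinAt_low`).

Three facts about the coefficients carry the analysis. The energy is equivalent to u² plus the sum
of (n+1)² times the squared coefficients, together with the observer part (`exists_energy_bounds`,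
`exists_plantEnergy_bounds`): y' is expanded in half-integer sines, w in cosines, and the cross
terms ∫ w ψ_{1,n} are O(n⁻²). The output is, pointwise, the sum of the modal series with
coefficients c_{i,k} growing at most linearly (`InDomain.output_expansion`). Finally, the excess
decay rate σ = -λ - δ of the modes above N₀, M₀ grows quadratically, so that these modes satisfy an
L²-in-time bound on ∑ (σx)², with input gain ∑ (α² + β²) < ∞ (`mode_family_estimate`).

In closed loop, the error of the low modes and the augmented observer state (X̂₁, u) are driven by
the two Hurwitz matrices and forced by p + ζ. Here p comes from the estimation errors of the
intermediate modes, which decay autonomously, and ζ is the part of the output series beyond N, M.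
Cauchy–Schwarz with weight σ gives ζ² ≤ ε ∑ (σx)², where ε → 0 as N, M → ∞ because ∑ (c/σ)²
converges. The loop from ζ through the finite-dimensional part to u, v, then through the high modes
back to ζ, has all its other gains independent of N and M; hence it closes once ε is small
(`closed_loop_estimate`). All estimates carry the weight exp(2δt), which gives the rate. -/

/-- Lebesgue measure on `[0,1]`. -/
noncomputable abbrev unitMeasure : Measure ℝ := volume.restrict (Icc (0 : ℝ) 1)

theorem integral_unitMeasure (f : ℝ → ℝ) : ∫ x, f x ∂unitMeasure = ∫ x in (0 : ℝ)..1, f x := by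
  rw [intervalIntegral.integral_of_le zero_le_one, integral_Icc_eq_integral_Ioc]

theorem intervalIntegrable_iff_unitMeasure {f : ℝ → ℝ} :
    IntervalIntegrable f volume 0 1 ↔ Integrable f unitMeasure := by
  rw [intervalIntegrable_iff_integrableOn_Icc_of_le zero_le_one]; rfl

theorem memLp_of_continuousOn {f : ℝ → ℝ} (hf : ContinuousOn f (Icc 0 1)) :
    MemLp f 2 unitMeasure := by
  obtain ⟨C, hC⟩ := isCompact_Icc.exists_bound_of_continuousOn hf
  refine MemLp.of_bound (hf.aestronglyMeasurable measurableSet_Icc) C ?_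
  exact (ae_restrict_iff' measurableSet_Icc).2 (Eventually.of_forall hC)

theorem _root_.MeasureTheory.MemLp.intervalIntegrable_mul {f g : ℝ → ℝ}
    (hf : MemLp f 2 unitMeasure) (hg : MemLp g 2 unitMeasure) :
    IntervalIntegrable (fun x => f x * g x) volume 0 1 :=
  intervalIntegrable_iff_unitMeasure.2 (hf.integrable_mul hg)

theorem _root_.MeasureTheory.MemLp.intervalIntegrable_sq {f : ℝ → ℝ}
    (hf : MemLp f 2 unitMeasure) : IntervalIntegrable (fun x => f x ^ 2) volume 0 1 := by
  simpa only [sq] using hf.intervalIntegrable_mul hf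

theorem _root_.MeasureTheory.MemLp.intervalIntegrable' {f : ℝ → ℝ}
    (hf : MemLp f 2 unitMeasure) : IntervalIntegrable f volume 0 1 :=
  intervalIntegrable_iff_unitMeasure.2 (hf.integrable (by norm_num))

theorem inner_toLp {f g : ℝ → ℝ} (hf : MemLp f 2 unitMeasure) (hg : MemLp g 2 unitMeasure) :
    inner ℝ (hf.toLp f) (hg.toLp g) = ∫ x in (0 : ℝ)..1, f x * g x := by
  rw [← integral_unitMeasure, L2.inner_def]
  refine integral_congr_ae ?_
  filter_upwards [hf.coeFn_toLp, hg.coeFn_toLp] with x h1 h2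
  rw [h1, h2]; simp [mul_comm]

theorem sq_integral_mul_le {f g : ℝ → ℝ} (hf : MemLp f 2 unitMeasure)
    (hg : MemLp g 2 unitMeasure) :
    (∫ x in (0 : ℝ)..1, f x * g x) ^ 2
      ≤ (∫ x in (0 : ℝ)..1, f x ^ 2) * ∫ x in (0 : ℝ)..1, g x ^ 2 := by
  have h := real_inner_mul_inner_self_le (hf.toLp f) (hg.toLp g)
  simp only [inner_toLp] at h
  simpa only [sq] using h

theorem sq_integral_le {f : ℝ → ℝ} (hf : MemLp f 2 unitMeasure) :
    (∫ x in (0 : ℝ)..1, f x) ^ 2 ≤ ∫ x in (0 : ℝ)..1, f x ^ 2 := by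
  have h := sq_integral_mul_le hf (memLp_of_continuousOn (f := fun _ => 1) continuousOn_const)
  simpa using h

theorem integral_sq_nonneg (f : ℝ → ℝ) : 0 ≤ ∫ x in (0 : ℝ)..1, f x ^ 2 :=
  intervalIntegral.integral_nonneg zero_le_one fun _ _ => sq_nonneg _

/-! ## Integration by parts -/

theorem IsH1.intervalIntegrable {f f' : ℝ → ℝ} (h : IsH1 f f') :
    IntervalIntegrable f' volume 0 1 := h.memLp.intervalIntegrable'

theorem IsH1.of_hasDerivAt {f f' : ℝ → ℝ} (h : ∀ x, HasDerivAt f (f' x) x)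
    (h' : Continuous f') : IsH1 f f' where
  memLp := memLp_of_continuousOn h'.continuousOn
  eq_integral x _ := by
    rw [intervalIntegral.integral_eq_sub_of_hasDerivAt (fun x _ => h x)
      (h'.intervalIntegrable _ _)]
    ring

/-- `IsH1` constrains `f` on [0,1] only, so absolute continuity is stated for the explicit
primitive, to which Lebesgue differentiation applies. -/
theorem IsH1.absolutelyContinuous {f f' : ℝ → ℝ} (h : IsH1 f f') :
    AbsolutelyContinuousOnInterval (fun x => f 0 + ∫ r in (0 : ℝ)..x, f' r) 0 1 := by
  have h1 := h.intervalIntegrable.absolutelyContinuousOnInterval_intervalIntegral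
    (c := 0) (by simp)
  have h2 : AbsolutelyContinuousOnInterval (fun _ : ℝ => f 0) 0 1 :=
    (LipschitzWith.const (f 0)).lipschitzOnWith.absolutelyContinuousOnInterval
  exact h2.add h1

theorem IsH1.continuousOn {f f' : ℝ → ℝ} (h : IsH1 f f') : ContinuousOn f (Icc 0 1) := by
  have := h.absolutelyContinuous.continuousOn
  rw [uIcc_of_le zero_le_one] at this
  exact this.congr h.eq_integral

theorem IsH1.memLp_self {f f' : ℝ → ℝ} (h : IsH1 f f') : MemLp f 2 unitMeasure :=
  memLp_of_continuousOn h.continuousOn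

theorem IsH1.deriv_ae {f f' : ℝ → ℝ} (h : IsH1 f f') :
    ∀ᵐ x, x ∈ uIoc (0 : ℝ) 1 → deriv (fun x => f 0 + ∫ r in (0 : ℝ)..x, f' r) x = f' x := by
  filter_upwards [h.intervalIntegrable.ae_hasDerivAt_integral] with x hx hx'
  have := (hx (uIoc_subset_uIcc hx') 0 (by simp)).const_add (f 0)
  exact this.deriv

/-- Integration by parts for absolutely continuous functions, applied to the two primitives, whose
derivatives are f' and g' almost everywhere. -/
theorem IsH1.integral_mul_add {f f' g g' : ℝ → ℝ} (hf : IsH1 f f') (hg : IsH1 g g') :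
    (∫ x in (0 : ℝ)..1, f' x * g x) + ∫ x in (0 : ℝ)..1, f x * g' x
      = f 1 * g 1 - f 0 * g 0 := by
  have key := hf.absolutelyContinuous.integral_deriv_mul_eq_sub hg.absolutelyContinuous
  rw [← hf.eq_integral 1 (by simp), ← hg.eq_integral 1 (by simp)] at key
  simp only [intervalIntegral.integral_same, add_zero] at key
  rw [← key, ← intervalIntegral.integral_add (hf.memLp.intervalIntegrable_mul hg.memLp_self)
    (hf.memLp_self.intervalIntegrable_mul hg.memLp)]
  refine intervalIntegral.integral_congr_ae ?_
  filter_upwards [hf.deriv_ae, hg.deriv_ae] with x h1 h2 hx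
  have hx' : x ∈ Icc (0 : ℝ) 1 := by
    rw [uIoc_of_le zero_le_one] at hx; exact Ioc_subset_Icc_self hx
  rw [h1 hx, h2 hx, hf.eq_integral x hx', hg.eq_integral x hx']

theorem IsH1.green {f f' f'' q q' q'' : ℝ → ℝ} (hf : IsH1 f f') (hf' : IsH1 f' f'')
    (hq : IsH1 q q') (hq' : IsH1 q' q'') :
    ∫ x in (0 : ℝ)..1, f'' x * q x
      = f' 1 * q 1 - f' 0 * q 0 - f 1 * q' 1 + f 0 * q' 0
        + ∫ x in (0 : ℝ)..1, f x * q'' x := by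
  have h1 := hf'.integral_mul_add hq
  have h2 := hf.integral_mul_add hq'
  linarith

theorem IsH1.sub {f f' g g' : ℝ → ℝ} (hf : IsH1 f f') (hg : IsH1 g g') :
    IsH1 (fun x => f x - g x) (fun x => f' x - g' x) where
  memLp := hf.memLp.sub hg.memLp
  eq_integral x hx := by
    have hs : uIcc (0 : ℝ) x ⊆ uIcc 0 1 := by
      rw [uIcc_of_le hx.1, uIcc_of_le zero_le_one]; exact Icc_subset_Icc_right hx.2
    rw [hf.eq_integral x hx, hg.eq_integral x hx, intervalIntegral.integral_sub
      (hf.intervalIntegrable.mono_set hs) (hg.intervalIntegrable.mono_set hs)]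
    ring

theorem IsH1.const_mul {f f' : ℝ → ℝ} (hf : IsH1 f f') (c : ℝ) :
    IsH1 (fun x => c * f x) (fun x => c * f' x) where
  memLp := hf.memLp.const_mul c
  eq_integral x hx := by
    rw [hf.eq_integral x hx, intervalIntegral.integral_const_mul]; ring

/-- Sobolev embedding in dimension one. -/
theorem IsH1.sq_le {f f' : ℝ → ℝ} (hf : IsH1 f f') {x : ℝ} (hx : x ∈ Icc (0 : ℝ) 1) :
    f x ^ 2 ≤ 2 * ((∫ r in (0 : ℝ)..1, f r ^ 2) + ∫ r in (0 : ℝ)..1, f' r ^ 2) := by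
  -- Cauchy–Schwarz controls the oscillation; averaging f(x)² ≤ 2 f(r)² + 2 (f(x) - f(r))² over r
  -- then bounds the value at x.
  have hb : ∀ r ∈ Icc (0 : ℝ) 1, |f x - f r| ^ 2 ≤ ∫ r in (0 : ℝ)..1, f' r ^ 2 := by
    intro r hr
    have h1 : f x - f r = ∫ t in r..x, f' t := by
      have hs : ∀ y ∈ Icc (0 : ℝ) 1, uIcc (0 : ℝ) y ⊆ uIcc 0 1 := fun y hy => by
        rw [uIcc_of_le hy.1, uIcc_of_le zero_le_one]; exact Icc_subset_Icc_right hy.2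
      rw [hf.eq_integral x hx, hf.eq_integral r hr, ← intervalIntegral.integral_interval_sub_left
        (hf.intervalIntegrable.mono_set (hs x hx)) (hf.intervalIntegrable.mono_set (hs r hr))]
      ring
    have h2 : |f x - f r| ≤ ∫ t in (0 : ℝ)..1, |f' t| := by
      rw [h1]
      refine (intervalIntegral.norm_integral_le_integral_norm_uIoc (f := f')).trans ?_
      rw [intervalIntegral.integral_of_le zero_le_one]
      refine setIntegral_mono_set ?_ (Eventually.of_forall fun _ => norm_nonneg _) ?_
      · exact ((intervalIntegrable_iff_integrableOn_Ioc_of_le zero_le_one).1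
          hf.intervalIntegrable).norm
      · refine Eventually.of_forall fun y hy => ?_
        rcases mem_uIoc.1 hy with h | h
        · exact ⟨hr.1.trans_lt h.1, h.2.trans hx.2⟩
        · exact ⟨hx.1.trans_lt h.1, h.2.trans hr.2⟩
    calc |f x - f r| ^ 2 ≤ (∫ t in (0 : ℝ)..1, |f' t|) ^ 2 := by gcongr
      _ ≤ ∫ t in (0 : ℝ)..1, |f' t| ^ 2 := sq_integral_le hf.memLp.abs
      _ = _ := by simp
  have h3 : ∫ _ in (0 : ℝ)..1, f x ^ 2
      ≤ ∫ r in (0 : ℝ)..1, (2 * f r ^ 2 + 2 * ∫ r in (0 : ℝ)..1, f' r ^ 2) := by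
    refine intervalIntegral.integral_mono_on zero_le_one (by simp) ?_ fun r hr => ?_
    · exact (hf.memLp_self.intervalIntegrable_sq.const_mul 2).add (by simp)
    · have := hb r hr
      rw [sq_abs] at this
      nlinarith [sq_nonneg (f x - 2 * f r)]
  rw [intervalIntegral.integral_add (hf.memLp_self.intervalIntegrable_sq.const_mul 2)
    (by simp), intervalIntegral.integral_const_mul] at h3
  simp at h3
  linarith

/-! ## Orthonormal families -/

/-- The family `e` of continuous functions is orthonormal in `L²(0,1)`. -/
structure IsONFamily (e : ℕ → ℝ → ℝ) : Prop where
  cont : ∀ i, Continuous (e i)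
  ortho : ∀ i j, ∫ x in (0 : ℝ)..1, e i x * e j x = if i = j then 1 else 0

/-- The family `e` is total in `L²(0,1)`. -/
def IsTotalFamily (e : ℕ → ℝ → ℝ) : Prop :=
  ∀ f : ℝ → ℝ, MemLp f 2 unitMeasure → (∀ i, ∫ x in (0 : ℝ)..1, f x * e i x = 0) →
    f =ᵐ[unitMeasure] 0

theorem IsONFamily.memLp {e : ℕ → ℝ → ℝ} (he : IsONFamily e) (i : ℕ) :
    MemLp (e i) 2 unitMeasure := memLp_of_continuousOn (he.cont i).continuousOn

theorem IsONFamily.orthonormal {e : ℕ → ℝ → ℝ} (he : IsONFamily e) :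
    Orthonormal ℝ (fun i => (he.memLp i).toLp (e i)) := by
  rw [orthonormal_iff_ite]
  intro i j
  rw [inner_toLp, he.ortho]

theorem IsONFamily.summable_sq {e : ℕ → ℝ → ℝ} (he : IsONFamily e) {f : ℝ → ℝ}
    (hf : MemLp f 2 unitMeasure) : Summable fun i => (∫ x in (0 : ℝ)..1, f x * e i x) ^ 2 := by
  have h := he.orthonormal.inner_products_summable (hf.toLp f)
  refine h.congr fun i => ?_
  rw [real_inner_comm, inner_toLp, Real.norm_eq_abs, sq_abs]

/-- Totality makes the orthogonal complement trivial, so the family is a Hilbert basis. The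
polarised form of Parseval is needed for mixed pairs such as (w'', w) and (w, ψ_{1,j}). -/
theorem IsONFamily.hasSum_mul {e : ℕ → ℝ → ℝ} (he : IsONFamily e) (ht : IsTotalFamily e)
    {f g : ℝ → ℝ} (hf : MemLp f 2 unitMeasure) (hg : MemLp g 2 unitMeasure) :
    HasSum (fun i => (∫ x in (0 : ℝ)..1, f x * e i x) * ∫ x in (0 : ℝ)..1, g x * e i x)
      (∫ x in (0 : ℝ)..1, f x * g x) := by
  let b : HilbertBasis ℕ ℝ (Lp ℝ 2 unitMeasure) :=
    HilbertBasis.mkOfOrthogonalEqBot he.orthonormal (by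
      rw [Submodule.eq_bot_iff]
      intro F hF
      have h0 : ((F : ℝ → ℝ)) =ᵐ[unitMeasure] 0 := by
        refine ht F (Lp.memLp F) fun i => ?_
        rw [← inner_toLp (Lp.memLp F) (he.memLp i), Lp.toLp_coeFn, real_inner_comm]
        exact (Submodule.mem_orthogonal _ _).1 hF _ (Submodule.subset_span ⟨i, rfl⟩)
      exact (Lp.eq_zero_iff_ae_eq_zero).2 h0)
  have hb : ∀ i, b i = (he.memLp i).toLp (e i) := fun i => by simp [b]
  have h := b.hasSum_inner_mul_inner (hf.toLp f) (hg.toLp g)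
  rw [inner_toLp] at h
  have e1 : (fun i => inner ℝ (hf.toLp f) (b i) * inner ℝ (b i) (hg.toLp g))
      = fun i => (∫ x in (0 : ℝ)..1, f x * e i x) * ∫ x in (0 : ℝ)..1, g x * e i x := by
    funext i
    rw [hb, inner_toLp, real_inner_comm, inner_toLp]
  rwa [e1] at h

theorem IsONFamily.hasSum_sq {e : ℕ → ℝ → ℝ} (he : IsONFamily e) (ht : IsTotalFamily e)
    {f : ℝ → ℝ} (hf : MemLp f 2 unitMeasure) :
    HasSum (fun i => (∫ x in (0 : ℝ)..1, f x * e i x) ^ 2) (∫ x in (0 : ℝ)..1, f x ^ 2) := by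
  simpa only [sq] using he.hasSum_mul ht hf hf

/-! ## Totality of trigonometric families -/

/-- Since cos(πx) is injective on [0,1], Weierstrass' theorem shows that polynomials in it
approximate continuous functions uniformly; hence f annihilates every test function. -/
theorem ae_eq_zero_of_integral_cos_pow {f : ℝ → ℝ} (hf : Integrable f unitMeasure)
    (h : ∀ k : ℕ, ∫ x in (0 : ℝ)..1, f x * Real.cos (Real.pi * x) ^ k = 0) :
    f =ᵐ[unitMeasure] 0 := by
  have hpoly : ∀ p : Polynomial ℝ,
      ∫ x, p.eval (Real.cos (Real.pi * x)) * f x ∂unitMeasure = 0 := by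
    intro p
    simp only [Polynomial.eval_eq_sum_range, Finset.sum_mul]
    rw [integral_finsetSum]
    · refine Finset.sum_eq_zero fun k _ => ?_
      rw [← mul_zero (p.coeff k), ← h k, ← integral_unitMeasure, ← integral_const_mul]
      congr 1; ext x; ring
    · intro k _
      have : (fun x => p.coeff k * Real.cos (Real.pi * x) ^ k * f x)
          = fun x => (p.coeff k * Real.cos (Real.pi * x) ^ k) * f x := rfl
      rw [this]
      refine hf.bdd_mul (c := |p.coeff k|) (by fun_prop) (Eventually.of_forall fun x => ?_)
      rw [norm_mul, norm_pow]
      exact mul_le_of_le_one_right (abs_nonneg _)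
        (pow_le_one₀ (norm_nonneg _) (Real.abs_cos_le_one _))
  refine ae_eq_zero_of_integral_contDiff_smul_eq_zero hf.locallyIntegrable ?_
  intro g hg _
  -- Change of variable y = cos(πx): the test function becomes a continuous function of y on [-1,1].
  have hgc : Continuous fun y => g (Real.arccos y / Real.pi) :=
    hg.continuous.comp (Real.continuous_arccos.div_const _)
  have hg1 : ∀ x ∈ Icc (0 : ℝ) 1, g (Real.arccos (Real.cos (Real.pi * x)) / Real.pi) = g x := by
    intro x hx
    have hpi := Real.pi_pos
    rw [Real.arccos_cos (by have := hx.1; positivity) (by nlinarith [hx.2])]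
    congr 1; field_simp
  have hfg : Integrable (fun x => g x * f x) unitMeasure := by
    obtain ⟨C, hC⟩ := isCompact_Icc.exists_bound_of_continuousOn
      (hg.continuous.continuousOn (s := Icc (0 : ℝ) 1))
    exact hf.bdd_mul (c := C) hg.continuous.aestronglyMeasurable
      ((ae_restrict_iff' measurableSet_Icc).2 (Eventually.of_forall hC))
  have key : ∀ ε > 0, |∫ x, g x * f x ∂unitMeasure| ≤ ε * ∫ x, |f x| ∂unitMeasure := by
    intro ε hε
    obtain ⟨p, hp⟩ := exists_polynomial_near_of_continuousOn (-1) 1 _ hgc.continuousOn ε hε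
    have hpf : Integrable (fun x => p.eval (Real.cos (Real.pi * x)) * f x) unitMeasure := by
      have hc : Continuous fun x => p.eval (Real.cos (Real.pi * x)) :=
        p.continuous.comp (by fun_prop)
      obtain ⟨C, hC⟩ := isCompact_Icc.exists_bound_of_continuousOn
        (hc.continuousOn (s := Icc (0 : ℝ) 1))
      exact hf.bdd_mul (c := C) hc.aestronglyMeasurable
        ((ae_restrict_iff' measurableSet_Icc).2 (Eventually.of_forall hC))
    have e1 : ∫ x, g x * f x ∂unitMeasure
        = ∫ x, (g x - p.eval (Real.cos (Real.pi * x))) * f x ∂unitMeasure := by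
      simp only [sub_mul]
      rw [integral_sub hfg hpf, hpoly p, sub_zero]
    rw [e1, ← integral_const_mul]
    rw [← Real.norm_eq_abs]
    refine (norm_integral_le_integral_norm _).trans ?_
    refine integral_mono_ae ?_ (hf.abs.const_mul ε) ?_
    · have := (hfg.sub hpf).norm
      refine this.congr (Eventually.of_forall fun x => ?_)
      simp [sub_mul]
    · refine (ae_restrict_iff' measurableSet_Icc).2 (Eventually.of_forall fun x hx => ?_)
      simp only [norm_mul, Real.norm_eq_abs]
      gcongr
      have := hp (Real.cos (Real.pi * x)) ⟨Real.neg_one_le_cos _, Real.cos_le_one _⟩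
      rw [hg1 x hx, abs_sub_comm] at this
      exact this.le
  have h0 : |∫ x, g x * f x ∂unitMeasure| ≤ 0 := by
    refine le_of_forall_pos_le_add fun ε hε => ?_
    set I := ∫ x, |f x| ∂unitMeasure
    have hI : 0 ≤ I := integral_nonneg fun _ => abs_nonneg _
    refine (key (ε / (I + 1)) (by positivity)).trans ?_
    rw [zero_add, div_mul_eq_mul_div, div_le_iff₀ (by positivity)]
    nlinarith
  simpa using abs_nonpos_iff.1 h0

/-- `√2 sin ((n + 1/2) π x)`. -/
noncomputable def sinHalf (n : ℕ) (x : ℝ) : ℝ :=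
  √2 * Real.sin (((n : ℝ) + 1 / 2) * Real.pi * x)

theorem integral_cos_int_mul_pi (k : ℤ) (hk : k ≠ 0) :
    ∫ x in (0 : ℝ)..1, Real.cos ((k : ℝ) * Real.pi * x) = 0 := by
  have hk' : (k : ℝ) * Real.pi ≠ 0 := mul_ne_zero (by exact_mod_cast hk) Real.pi_ne_zero
  rw [intervalIntegral.integral_comp_mul_left (fun x => Real.cos x) hk']
  simp [Real.sin_int_mul_pi]

theorem continuous_psi2 (m : ℕ) : Continuous (psi2 m) := by unfold psi2; fun_prop
theorem continuous_phi1 (n : ℕ) : Continuous (phi1 n) := by unfold phi1; fun_prop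
theorem continuous_sinHalf (n : ℕ) : Continuous (sinHalf n) := by unfold sinHalf; fun_prop

theorem isONFamily_phi1 : IsONFamily phi1 where
  cont := continuous_phi1
  ortho i j := by
    have h : ∀ x, phi1 i x * phi1 j x
        = Real.cos (((i - j : ℤ) : ℝ) * Real.pi * x)
          + Real.cos (((i + j + 1 : ℤ) : ℝ) * Real.pi * x) := by
      intro x
      have e1 : ((i - j : ℤ) : ℝ) * Real.pi * x
        = ((i : ℝ) + 1 / 2) * Real.pi * x - ((j : ℝ) + 1 / 2) * Real.pi * x := by push_cast; ring
      have e2 : ((i + j + 1 : ℤ) : ℝ) * Real.pi * x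
        = ((i : ℝ) + 1 / 2) * Real.pi * x + ((j : ℝ) + 1 / 2) * Real.pi * x := by push_cast; ring
      rw [e1, e2, Real.cos_sub, Real.cos_add]
      unfold phi1
      have := Real.mul_self_sqrt (show (0 : ℝ) ≤ 2 by norm_num)
      linear_combination (Real.cos (((i : ℝ) + 1 / 2) * Real.pi * x)
        * Real.cos (((j : ℝ) + 1 / 2) * Real.pi * x)) * this
    simp only [h]
    rw [intervalIntegral.integral_add (by apply Continuous.intervalIntegrable; fun_prop)
      (by apply Continuous.intervalIntegrable; fun_prop), integral_cos_int_mul_pi (i + j + 1)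
      (by positivity), add_zero]
    split_ifs with hij
    · subst hij; simp
    · exact integral_cos_int_mul_pi _ (by omega)

theorem isONFamily_sinHalf : IsONFamily sinHalf where
  cont := continuous_sinHalf
  ortho i j := by
    have h : ∀ x, sinHalf i x * sinHalf j x
        = Real.cos (((i - j : ℤ) : ℝ) * Real.pi * x)
          - Real.cos (((i + j + 1 : ℤ) : ℝ) * Real.pi * x) := by
      intro x
      have e1 : ((i - j : ℤ) : ℝ) * Real.pi * x
        = ((i : ℝ) + 1 / 2) * Real.pi * x - ((j : ℝ) + 1 / 2) * Real.pi * x := by push_cast; ring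
      have e2 : ((i + j + 1 : ℤ) : ℝ) * Real.pi * x
        = ((i : ℝ) + 1 / 2) * Real.pi * x + ((j : ℝ) + 1 / 2) * Real.pi * x := by push_cast; ring
      rw [e1, e2, Real.cos_sub, Real.cos_add]
      unfold sinHalf
      have := Real.mul_self_sqrt (show (0 : ℝ) ≤ 2 by norm_num)
      linear_combination (Real.sin (((i : ℝ) + 1 / 2) * Real.pi * x)
        * Real.sin (((j : ℝ) + 1 / 2) * Real.pi * x)) * this
    simp only [h]
    rw [intervalIntegral.integral_sub (by apply Continuous.intervalIntegrable; fun_prop)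
      (by apply Continuous.intervalIntegrable; fun_prop), integral_cos_int_mul_pi (i + j + 1)
      (by positivity), sub_zero]
    split_ifs with hij
    · subst hij; simp
    · exact integral_cos_int_mul_pi _ (by omega)

theorem isONFamily_psi2 : IsONFamily psi2 where
  cont := continuous_psi2
  ortho i j := by
    have h : ∀ x, psi2 i x * psi2 j x
        = muCoef i * muCoef j / 2 * (Real.cos (((i - j : ℤ) : ℝ) * Real.pi * x)
          + Real.cos (((i + j : ℤ) : ℝ) * Real.pi * x)) := by
      intro x
      have e1 : ((i - j : ℤ) : ℝ) * Real.pi * x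
        = (i : ℝ) * Real.pi * x - (j : ℝ) * Real.pi * x := by push_cast; ring
      have e2 : ((i + j : ℤ) : ℝ) * Real.pi * x
        = (i : ℝ) * Real.pi * x + (j : ℝ) * Real.pi * x := by push_cast; ring
      rw [e1, e2, Real.cos_sub, Real.cos_add]
      unfold psi2
      ring
    simp only [h]
    rw [intervalIntegral.integral_const_mul,
      intervalIntegral.integral_add (by apply Continuous.intervalIntegrable; fun_prop)
      (by apply Continuous.intervalIntegrable; fun_prop)]
    split_ifs with hij
    · subst hij
      rcases Nat.eq_zero_or_pos i with hi | hi
      · subst hi; norm_num [muCoef]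
      · rw [integral_cos_int_mul_pi (i + i) (by positivity)]
        have := Real.mul_self_sqrt (show (0 : ℝ) ≤ 2 by norm_num)
        simp [muCoef, hi.ne', this]
    · rw [integral_cos_int_mul_pi (i - j) (by omega), integral_cos_int_mul_pi (i + j) (by omega)]
      simp

theorem muCoef_pos (m : ℕ) : 0 < muCoef m := by unfold muCoef; split_ifs <;> positivity

/-- The product-to-sum formula trades a factor cos(πx) for the shifts m ± 1. Induction on the
exponent k, for all m at once, gives orthogonality to every power of cos(πx). -/
theorem isTotalFamily_psi2 : IsTotalFamily psi2 := by
  intro f hf h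
  refine ae_eq_zero_of_integral_cos_pow (hf.integrable (by norm_num)) ?_
  have key : ∀ k m : ℕ, ∫ x in (0 : ℝ)..1,
      f x * Real.cos (Real.pi * x) ^ k * Real.cos ((m : ℝ) * Real.pi * x) = 0 := by
    intro k
    induction k with
    | zero =>
      intro m
      have := h m
      simp only [psi2] at this
      rw [← mul_right_inj' (muCoef_pos m).ne', mul_zero, ← this,
        ← intervalIntegral.integral_const_mul]
      congr 1; ext x; ring
    | succ k ih =>
      have hint : ∀ m : ℝ, IntervalIntegrable (fun x =>
          f x * Real.cos (Real.pi * x) ^ k * Real.cos (m * Real.pi * x)) volume 0 1 := by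
        intro m
        have := hf.intervalIntegrable_mul (memLp_of_continuousOn (f := fun x =>
          Real.cos (Real.pi * x) ^ k * Real.cos (m * Real.pi * x)) (by fun_prop))
        simpa only [mul_assoc] using this
      intro m
      have e : ∀ x, f x * Real.cos (Real.pi * x) ^ (k + 1) * Real.cos ((m : ℝ) * Real.pi * x)
          = 1 / 2 * (f x * Real.cos (Real.pi * x) ^ k * Real.cos (((m + 1 : ℝ)) * Real.pi * x)
            + f x * Real.cos (Real.pi * x) ^ k * Real.cos (((m - 1 : ℝ)) * Real.pi * x)) := by
        intro x
        rw [show (m + 1 : ℝ) * Real.pi * x = m * Real.pi * x + Real.pi * x by ring,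
          show (m - 1 : ℝ) * Real.pi * x = m * Real.pi * x - Real.pi * x by ring,
          Real.cos_add, Real.cos_sub]
        ring
      simp only [e]
      rw [intervalIntegral.integral_const_mul, intervalIntegral.integral_add (hint _) (hint _)]
      have h1 := ih (m + 1)
      push_cast at h1
      rw [h1]
      -- The shift m - 1 leaves ℕ at m = 0; evenness of the cosine sends the frequency -1 to 1.
      rcases m with _ | m
      · have h2 := ih 1
        have e2 : ∀ x, Real.cos (((0 : ℕ) - 1 : ℝ) * Real.pi * x)
            = Real.cos (((1 : ℕ) : ℝ) * Real.pi * x) := by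
          intro x; rw [← Real.cos_neg]; congr 1; push_cast; ring
        simp only [e2, h2]; simp
      · have h2 := ih m
        push_cast
        simp only [add_sub_cancel_right, h2]; simp
  intro k
  simpa using key k 0

/-- The same recursion shows that f·sin(πx/2) is orthogonal to all powers of cos(πx), hence vanishes
almost everywhere; the sine factor has no zero in (0,1]. -/
theorem isTotalFamily_sinHalf : IsTotalFamily sinHalf := by
  intro f hf h
  have hint : ∀ (k : ℕ) (m : ℝ), IntervalIntegrable (fun x =>
      f x * Real.cos (Real.pi * x) ^ k * Real.sin (m * Real.pi * x)) volume 0 1 := by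
    intro k m
    have := hf.intervalIntegrable_mul (memLp_of_continuousOn (f := fun x =>
      Real.cos (Real.pi * x) ^ k * Real.sin (m * Real.pi * x)) (by fun_prop))
    simpa only [mul_assoc] using this
  have key : ∀ k m : ℕ, ∫ x in (0 : ℝ)..1,
      f x * Real.cos (Real.pi * x) ^ k * Real.sin (((m : ℝ) + 1 / 2) * Real.pi * x) = 0 := by
    intro k
    induction k with
    | zero =>
      intro m
      have := h m
      simp only [sinHalf] at this
      rw [← mul_right_inj' (show √2 ≠ 0 by positivity), mul_zero, ← this,
        ← intervalIntegral.integral_const_mul]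
      congr 1; ext x; ring
    | succ k ih =>
      intro m
      have e : ∀ x, f x * Real.cos (Real.pi * x) ^ (k + 1)
            * Real.sin (((m : ℝ) + 1 / 2) * Real.pi * x)
          = 1 / 2 * (f x * Real.cos (Real.pi * x) ^ k
              * Real.sin (((m + 1 : ℝ) + 1 / 2) * Real.pi * x)
            + f x * Real.cos (Real.pi * x) ^ k
              * Real.sin (((m - 1 : ℝ) + 1 / 2) * Real.pi * x)) := by
        intro x
        rw [show ((m + 1 : ℝ) + 1 / 2) * Real.pi * x
            = ((m : ℝ) + 1 / 2) * Real.pi * x + Real.pi * x by ring,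
          show ((m - 1 : ℝ) + 1 / 2) * Real.pi * x
            = ((m : ℝ) + 1 / 2) * Real.pi * x - Real.pi * x by ring,
          Real.sin_add, Real.sin_sub]
        ring
      simp only [e]
      rw [intervalIntegral.integral_const_mul, intervalIntegral.integral_add (hint _ _) (hint _ _)]
      have h1 := ih (m + 1)
      push_cast at h1
      rw [h1]
      rcases m with _ | m
      · have h2 := ih 0
        have e2 : ∀ x, Real.sin ((((0 : ℕ) - 1 : ℝ) + 1 / 2) * Real.pi * x)
            = -Real.sin ((((0 : ℕ) : ℝ) + 1 / 2) * Real.pi * x) := by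
          intro x; rw [← Real.sin_neg]; congr 1; push_cast; ring
        simp only [e2, mul_neg, intervalIntegral.integral_neg, h2]; simp
      · have h2 := ih m
        push_cast
        simp only [add_sub_cancel_right, h2]; simp
  have h0 : (fun x => f x * Real.sin (1 / 2 * Real.pi * x)) =ᵐ[unitMeasure] 0 := by
    refine ae_eq_zero_of_integral_cos_pow ?_ fun k => ?_
    · rw [← intervalIntegrable_iff_unitMeasure]
      simpa using hint 0 (1 / 2)
    · refine Eq.trans ?_ (key k 0)
      refine intervalIntegral.integral_congr fun x _ => ?_
      simp only [Nat.cast_zero, zero_add]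
      ring
  have hne : ∀ᵐ x ∂unitMeasure, x ≠ 0 ∧ x ∈ Icc (0 : ℝ) 1 := by
    refine Eventually.and ?_ ((ae_restrict_mem measurableSet_Icc))
    exact ae_restrict_of_ae (by simp [ae_iff, measure_singleton])
  filter_upwards [h0, hne] with x hx hx'
  have hpi := Real.pi_pos
  have hx0 : 0 < x := lt_of_le_of_ne hx'.2.1 (Ne.symm hx'.1)
  have : 0 < Real.sin (1 / 2 * Real.pi * x) :=
    Real.sin_pos_of_pos_of_lt_pi (by positivity) (by nlinarith [hx'.2.2])
  exact (mul_eq_zero.1 hx).resolve_right this.ne'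

/-! ## Resonances -/

theorem mem_Delta_iff {a b : ℝ} {n m : ℕ} : (n, m) ∈ Delta a b ↔ lam1 a n = lam2 b m := by
  unfold Delta lam1 lam2
  simp only [mem_ofPred_eq]
  constructor <;> intro h <;> linarith

theorem lam2_injective (b : ℝ) : Function.Injective (lam2 b) := by
  intro m k h
  have hpi : (0 : ℝ) < Real.pi ^ 2 := by positivity
  have h1 : (m : ℝ) ^ 2 = (k : ℝ) ^ 2 := by
    have : (m : ℝ) ^ 2 * Real.pi ^ 2 = (k : ℝ) ^ 2 * Real.pi ^ 2 := by unfold lam2 at h; linarith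
    exact mul_right_cancel₀ hpi.ne' this
  exact_mod_cast (pow_left_inj₀ (by positivity) (by positivity) two_ne_zero).1 h1

theorem lam1_injective (a : ℝ) : Function.Injective (lam1 a) := by
  intro m k h
  have hpi : (0 : ℝ) < Real.pi ^ 2 := by positivity
  have h1 : ((m : ℝ) + 1 / 2) ^ 2 = ((k : ℝ) + 1 / 2) ^ 2 := by
    have : ((m : ℝ) + 1 / 2) ^ 2 * Real.pi ^ 2 = ((k : ℝ) + 1 / 2) ^ 2 * Real.pi ^ 2 := by
      unfold lam1 at h; linarith
    exact mul_right_cancel₀ hpi.ne' this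
  have := (pow_left_inj₀ (by positivity) (by positivity) two_ne_zero).1 h1
  exact_mod_cast add_right_cancel this

theorem Delta_right_unique {a b : ℝ} {n m k : ℕ} (h : (n, m) ∈ Delta a b)
    (h' : (n, k) ∈ Delta a b) : m = k :=
  lam2_injective b ((mem_Delta_iff.1 h).symm.trans (mem_Delta_iff.1 h'))

theorem Delta_left_unique {a b : ℝ} {n m k : ℕ} (h : (n, m) ∈ Delta a b)
    (h' : (k, m) ∈ Delta a b) : n = k :=
  lam1_injective a ((mem_Delta_iff.1 h).trans (mem_Delta_iff.1 h').symm)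

theorem rootC_sq (x : ℝ) : rootC x ^ 2 = (x : ℂ) := by
  unfold rootC
  rw [show (1 / 2 : ℂ) = ((2 : ℕ) : ℂ)⁻¹ by norm_num]
  exact Complex.cpow_nat_inv_pow _ two_ne_zero

/-- The zeros of cosh are i(k + 1/2)π with k an integer. Negative k repeat the squares of
nonnegative ones, so natural indices suffice; for r_m the excluded values are exactly the
resonances. -/
theorem cosh_ne_zero_of_sq {r : ℂ} {x : ℝ} (h : r ^ 2 = (x : ℂ))
    (hx : ∀ k : ℕ, x ≠ -(((k : ℝ) + 1 / 2) * Real.pi) ^ 2) : Complex.cosh r ≠ 0 := by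
  intro h0
  rw [← Complex.cos_mul_I, Complex.cos_eq_zero_iff] at h0
  obtain ⟨k, hk⟩ := h0
  have h1 : (x : ℂ) = -((2 * k + 1) * Real.pi / 2) ^ 2 := by
    rw [← h, ← hk, mul_pow, Complex.I_sq]; ring
  have h2 : x = -((2 * (k : ℝ) + 1) * Real.pi / 2) ^ 2 := by exact_mod_cast h1
  rcases le_or_gt 0 k with h3 | h3
  · lift k to ℕ using h3
    exact hx k (by rw [h2]; push_cast; ring)
  · obtain ⟨j, hj⟩ : ∃ j : ℕ, (j : ℤ) = -k - 1 := ⟨(-k - 1).toNat, by omega⟩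
    have hj' : (k : ℝ) = -(j : ℝ) - 1 := by
      have : k = -(j : ℤ) - 1 := by omega
      rw [this]; push_cast; ring
    exact hx j (by rw [h2, hj']; ring)

theorem sinh_ne_zero_of_sq {r : ℂ} {x : ℝ} (h : r ^ 2 = (x : ℂ))
    (hx : ∀ k : ℕ, x ≠ -((k : ℝ) * Real.pi) ^ 2) : Complex.sinh r ≠ 0 := by
  intro h0
  have h0' : Complex.sin (r * Complex.I) = 0 := by rw [Complex.sin_mul_I, h0, zero_mul]
  rw [Complex.sin_eq_zero_iff] at h0'
  obtain ⟨k, hk⟩ := h0'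
  have h1 : (x : ℂ) = -(k * Real.pi) ^ 2 := by
    rw [← h, ← hk, mul_pow, Complex.I_sq]; ring
  have h2 : x = -((k : ℝ) * Real.pi) ^ 2 := by exact_mod_cast h1
  refine hx k.natAbs ?_
  rw [h2, mul_pow, mul_pow]
  congr 2
  rw [Nat.cast_natAbs, Int.cast_abs, sq_abs]

/-- A square root of -θ² is iθ or -iθ, and the modulus does not see the sign: the bounds do not
depend on the branch chosen in `rootC`. -/
theorem norm_sinh_mul_of_sq {r : ℂ} {θ : ℝ} (h : r ^ 2 = ((-θ ^ 2 : ℝ) : ℂ)) (y : ℝ) :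
    ‖Complex.sinh (r * y)‖ = |Real.sin (θ * y)| := by
  have h1 : r ^ 2 = (θ * Complex.I) ^ 2 := by rw [h, mul_pow, Complex.I_sq]; push_cast; ring
  have h2 : Complex.sinh (θ * Complex.I * y) = (Real.sin (θ * y) : ℝ) * Complex.I := by
    rw [show (θ : ℂ) * Complex.I * y = ((θ * y : ℝ) : ℂ) * Complex.I by push_cast; ring,
      Complex.sinh_mul_I, Complex.ofReal_sin]
  rcases sq_eq_sq_iff_eq_or_eq_neg.1 h1 with h3 | h3
  · rw [h3, h2]; simp [Complex.norm_real, -Complex.ofReal_sin]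
  · rw [h3, neg_mul, Complex.sinh_neg, h2]; simp [Complex.norm_real, -Complex.ofReal_sin]

theorem norm_cosh_mul_of_sq {r : ℂ} {θ : ℝ} (h : r ^ 2 = ((-θ ^ 2 : ℝ) : ℂ)) (y : ℝ) :
    ‖Complex.cosh (r * y)‖ = |Real.cos (θ * y)| := by
  have h1 : r ^ 2 = (θ * Complex.I) ^ 2 := by rw [h, mul_pow, Complex.I_sq]; push_cast; ring
  have h2 : Complex.cosh (θ * Complex.I * y) = (Real.cos (θ * y) : ℝ) := by
    rw [show (θ : ℂ) * Complex.I * y = ((θ * y : ℝ) : ℂ) * Complex.I by push_cast; ring,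
      Complex.cosh_mul_I, Complex.ofReal_cos]
  rcases sq_eq_sq_iff_eq_or_eq_neg.1 h1 with h3 | h3
  · rw [h3, h2]; simp [Complex.norm_real, -Complex.ofReal_cos]
  · rw [h3, neg_mul, Complex.cosh_neg, h2]; simp [Complex.norm_real, -Complex.ofReal_cos]

theorem norm_of_sq {r : ℂ} {θ : ℝ} (h : r ^ 2 = ((-θ ^ 2 : ℝ) : ℂ)) : ‖r‖ = |θ| := by
  have h1 : ‖r‖ ^ 2 = |θ| ^ 2 := by
    rw [← norm_pow, h, Complex.norm_real]; simp
  exact (pow_left_inj₀ (norm_nonneg _) (abs_nonneg _) two_ne_zero).1 h1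

/-- Perturbation of a frequency `τ`: the square root of `τ² + d` is close to `τ`. -/
theorem sqrt_perturb {τ d : ℝ} (h1 : 1 ≤ τ) (h2 : 2 * |d| ≤ τ) :
    0 < τ ^ 2 + d ∧ τ / 2 ≤ √(τ ^ 2 + d) ∧ |√(τ ^ 2 + d) - τ| ≤ 1 / 2 := by
  have hd : -(τ ^ 2 / 2) ≤ d := by nlinarith [neg_abs_le d]
  have hpos : 0 < τ ^ 2 + d := by nlinarith
  have hle : τ / 2 ≤ √(τ ^ 2 + d) := Real.le_sqrt_of_sq_le (by nlinarith)
  refine ⟨hpos, hle, ?_⟩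
  have hsq := Real.sq_sqrt hpos.le
  set θ := √(τ ^ 2 + d)
  have h3 : |θ - τ| * (θ + τ) = |d| := by
    rw [← abs_of_pos (show 0 < θ + τ by linarith), ← abs_mul]; congr 1; nlinarith
  nlinarith [abs_nonneg (θ - τ)]

/-- At a zero τ of the cosine, |sin θ| = |cos(θ - τ)| ≥ 1 - 1/8. Together with `sqrt_perturb` this
keeps the denominator of ψ_{1,n} away from zero for large n. -/
theorem half_le_abs_sin {τ θ : ℝ} (hτ : Real.cos τ = 0) (h : |θ - τ| ≤ 1 / 2) :
    1 / 2 ≤ |Real.sin θ| := by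
  have h1 : |Real.sin τ| = 1 := by
    have := Real.sin_sq_add_cos_sq τ
    rw [hτ] at this
    rw [← abs_one, ← sq_eq_sq_iff_abs_eq_abs]; linarith
  have h2 : Real.sin θ = Real.sin τ * Real.cos (θ - τ) := by
    have := Real.sin_add τ (θ - τ)
    rw [hτ] at this
    simpa using this
  rw [h2, abs_mul, h1, one_mul]
  have := Real.one_sub_sq_div_two_le_cos (x := θ - τ)
  have h3 := sq_le_sq' (by linarith [abs_nonneg (θ - τ)]) h
  rw [sq_abs] at h3
  exact le_trans (by linarith) (le_abs_self _)

theorem half_le_abs_cos {τ θ : ℝ} (hτ : Real.sin τ = 0) (h : |θ - τ| ≤ 1 / 2) :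
    1 / 2 ≤ |Real.cos θ| := by
  have h1 : |Real.cos τ| = 1 := by
    have := Real.sin_sq_add_cos_sq τ
    rw [hτ] at this
    rw [← abs_one, ← sq_eq_sq_iff_abs_eq_abs]; linarith
  have h2 : Real.cos θ = Real.cos τ * Real.cos (θ - τ) := by
    have := Real.cos_add τ (θ - τ)
    rw [hτ] at this
    simpa using this
  rw [h2, abs_mul, h1, one_mul]
  have := Real.one_sub_sq_div_two_le_cos (x := θ - τ)
  have h3 := sq_le_sq' (by linarith [abs_nonneg (θ - τ)]) h
  rw [sq_abs] at h3
  exact le_trans (by linarith) (le_abs_self _)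

/-- Only finitely many indices escape the bound for large n, and compactness of [0,1] handles each
of them. -/
theorem exists_uniform_bound {f : ℕ → ℝ → ℝ} (hf : ∀ n, Continuous (f n)) {C : ℝ} {n₀ : ℕ}
    (h : ∀ n ≥ n₀, ∀ x ∈ Icc (0 : ℝ) 1, |f n x| ≤ C) :
    ∃ K : ℝ, 0 < K ∧ ∀ n, ∀ x ∈ Icc (0 : ℝ) 1, |f n x| ≤ K := by
  have h1 : ∀ n, ∃ B : ℝ, ∀ x ∈ Icc (0 : ℝ) 1, |f n x| ≤ B := fun n =>
    isCompact_Icc.exists_bound_of_continuousOn (hf n).continuousOn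
  choose B hB using h1
  refine ⟨|C| + 1 + ∑ n ∈ Finset.range n₀, |B n|, by positivity, fun n x hx => ?_⟩
  have hs : 0 ≤ ∑ n ∈ Finset.range n₀, |B n| := Finset.sum_nonneg fun _ _ => abs_nonneg _
  rcases le_or_gt n₀ n with hn | hn
  · linarith [h n hn x hx, le_abs_self C]
  · have := Finset.single_le_sum (f := fun n => |B n|) (fun i _ => abs_nonneg (B i))
      (Finset.mem_range.2 hn)
    linarith [hB n x hx, le_abs_self (B n), abs_nonneg C]

/-! ## The modes `φ_{1,n}` and `ψ_{2,m}` -/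

theorem hasDerivAt_phi1 (n : ℕ) (x : ℝ) :
    HasDerivAt (phi1 n) (-((((n : ℝ) + 1 / 2) * Real.pi) * sinHalf n x)) x := by
  unfold phi1 sinHalf
  have h := (((hasDerivAt_id x).const_mul (((n : ℝ) + 1 / 2) * Real.pi)).cos).const_mul √2
  simp only [id_eq, mul_one] at h
  convert! h using 1
  ring

theorem hasDerivAt_sinHalf (n : ℕ) (x : ℝ) :
    HasDerivAt (sinHalf n) ((((n : ℝ) + 1 / 2) * Real.pi) * phi1 n x) x := by
  unfold phi1 sinHalf
  have h := (((hasDerivAt_id x).const_mul (((n : ℝ) + 1 / 2) * Real.pi)).sin).const_mul √2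
  simp only [id_eq, mul_one] at h
  convert! h using 1
  ring

theorem hasDerivAt_deriv_phi1 (n : ℕ) (x : ℝ) :
    HasDerivAt (fun x => -((((n : ℝ) + 1 / 2) * Real.pi) * sinHalf n x))
      (-(((n : ℝ) + 1 / 2) ^ 2 * Real.pi ^ 2) * phi1 n x) x := by
  have h := ((hasDerivAt_sinHalf n x).const_mul (((n : ℝ) + 1 / 2) * Real.pi)).neg
  convert! h using 1
  ring

theorem cos_half_mul_pi (n : ℕ) : Real.cos (((n : ℝ) + 1 / 2) * Real.pi) = 0 := by
  rw [Real.cos_eq_zero_iff]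
  exact ⟨n, by push_cast; ring⟩

theorem phi1_one (n : ℕ) : phi1 n 1 = 0 := by
  unfold phi1; rw [mul_one, cos_half_mul_pi, mul_zero]

theorem phi1_zero (n : ℕ) : phi1 n 0 = √2 := by simp [phi1]

theorem sinHalf_zero (n : ℕ) : sinHalf n 0 = 0 := by simp [sinHalf]

theorem isH1_phi1 (n : ℕ) :
    IsH1 (phi1 n) (fun x => -((((n : ℝ) + 1 / 2) * Real.pi) * sinHalf n x)) :=
  IsH1.of_hasDerivAt (hasDerivAt_phi1 n) (((continuous_sinHalf n).const_mul _).neg)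

theorem isH1_deriv_phi1 (n : ℕ) :
    IsH1 (fun x => -((((n : ℝ) + 1 / 2) * Real.pi) * sinHalf n x))
      (fun x => -(((n : ℝ) + 1 / 2) ^ 2 * Real.pi ^ 2) * phi1 n x) :=
  IsH1.of_hasDerivAt (hasDerivAt_deriv_phi1 n) ((continuous_phi1 n).const_mul _)

theorem isH1_sinHalf (n : ℕ) :
    IsH1 (sinHalf n) (fun x => (((n : ℝ) + 1 / 2) * Real.pi) * phi1 n x) :=
  IsH1.of_hasDerivAt (hasDerivAt_sinHalf n) ((continuous_phi1 n).const_mul _)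

/-- Derivative of `psi2 m`. -/
noncomputable def psi2Deriv (m : ℕ) (x : ℝ) : ℝ :=
  -(muCoef m * ((m : ℝ) * Real.pi) * Real.sin ((m : ℝ) * Real.pi * x))

theorem hasDerivAt_psi2 (m : ℕ) (x : ℝ) : HasDerivAt (psi2 m) (psi2Deriv m x) x := by
  unfold psi2 psi2Deriv
  have h := (((hasDerivAt_id x).const_mul ((m : ℝ) * Real.pi)).cos).const_mul (muCoef m)
  simp only [id_eq, mul_one] at h
  convert! h using 1
  ring

theorem hasDerivAt_psi2Deriv (m : ℕ) (x : ℝ) :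
    HasDerivAt (psi2Deriv m) (-((m : ℝ) ^ 2 * Real.pi ^ 2) * psi2 m x) x := by
  unfold psi2 psi2Deriv
  have h := ((((hasDerivAt_id x).const_mul ((m : ℝ) * Real.pi)).sin).const_mul
    (muCoef m * ((m : ℝ) * Real.pi))).neg
  simp only [id_eq, mul_one] at h
  convert! h using 1
  ring

theorem continuous_psi2Deriv (m : ℕ) : Continuous (psi2Deriv m) := by
  unfold psi2Deriv; fun_prop

theorem isH1_psi2 (m : ℕ) : IsH1 (psi2 m) (psi2Deriv m) :=
  IsH1.of_hasDerivAt (hasDerivAt_psi2 m) (continuous_psi2Deriv m)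

theorem isH1_psi2Deriv (m : ℕ) :
    IsH1 (psi2Deriv m) (fun x => -((m : ℝ) ^ 2 * Real.pi ^ 2) * psi2 m x) :=
  IsH1.of_hasDerivAt (hasDerivAt_psi2Deriv m) ((continuous_psi2 m).const_mul _)

theorem psi2Deriv_zero (m : ℕ) : psi2Deriv m 0 = 0 := by simp [psi2Deriv]

theorem psi2Deriv_one (m : ℕ) : psi2Deriv m 1 = 0 := by
  simp [psi2Deriv, Real.sin_nat_mul_pi]

theorem psi2_zero (m : ℕ) : psi2 m 0 = muCoef m := by simp [psi2]

/-! ## The modes `ψ_{1,n}` -/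

theorem psi1_of_mem_Delta {a b : ℝ} (s : ℝ) {n k : ℕ} (hk : (n, k) ∈ Delta a b) (x : ℝ) :
    psi1 a b s n x = if k = 0 then
      -s * √2 * (1 / 3 + 1 / ((2 * (n : ℝ) + 1) ^ 2 * Real.pi ^ 2)) + √2 * s * x
        - √2 / 2 * s * x ^ 2
    else
      √2 * s / ((k : ℝ) * Real.pi) * (1 - x) * Real.sin ((k : ℝ) * Real.pi * x)
        + -(2 * s / Real.pi ^ 2) * (1 / (2 * (n : ℝ) + 1) ^ 2 + 1 / (4 * (k : ℝ) ^ 2)) *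
            √2 * Real.cos ((k : ℝ) * Real.pi * x) := by
  have h : ∃ k : ℕ, (n, k) ∈ Delta a b := ⟨k, hk⟩
  have hc : h.choose = k := Delta_right_unique h.choose_spec hk
  unfold psi1
  rw [dif_pos h, hc]

theorem psi1_of_notMem {a b : ℝ} (s : ℝ) {n : ℕ} (hn : n ∉ Delta1 a b) (x : ℝ) :
    psi1 a b s n x = (-((√2 * s : ℝ) : ℂ) / (r1 a b n * Complex.sinh (r1 a b n)) *
      Complex.cosh (r1 a b n * (1 - (x : ℂ)))).re := by
  unfold psi1
  rw [dif_neg (show ¬ ∃ k : ℕ, (n, k) ∈ Delta a b from hn)]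

theorem r1_sq (a b : ℝ) (n : ℕ) : r1 a b n ^ 2 = ((lam1 a n - b : ℝ) : ℂ) := rootC_sq _

theorem r1_ne_zero {a b : ℝ} {n : ℕ} (hn : n ∉ Delta1 a b) : r1 a b n ≠ 0 := by
  intro h
  have h1 := r1_sq a b n
  rw [h, zero_pow two_ne_zero] at h1
  have h2 : lam1 a n - b = 0 := by exact_mod_cast h1.symm
  exact hn ⟨0, mem_Delta_iff.2 (by unfold lam2; push_cast; linarith)⟩

theorem sinh_r1_ne_zero {a b : ℝ} {n : ℕ} (hn : n ∉ Delta1 a b) :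
    Complex.sinh (r1 a b n) ≠ 0 := by
  refine sinh_ne_zero_of_sq (r1_sq a b n) fun k hk => hn ⟨k, mem_Delta_iff.2 ?_⟩
  unfold lam2
  linarith

/-- The properties of the second component of `ψ_{1,n}` as a solution of the adjoint eigenvalue
problem. -/
theorem exists_psi1_deriv (a b s : ℝ) (n : ℕ) : ∃ q' q'' : ℝ → ℝ,
    (∀ x, HasDerivAt (psi1 a b s n) (q' x) x) ∧ (∀ x, HasDerivAt q' (q'' x) x) ∧
    Continuous q'' ∧ q' 0 = √2 * s ∧ q' 1 = 0 ∧
    (n ∉ Delta1 a b → ∀ x, q'' x = (lam1 a n - b) * psi1 a b s n x) ∧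
    (∀ k, (n, k) ∈ Delta a b → ∀ x, q'' x = (lam1 a n - b) * psi1 a b s n x
      - √2 * s * muCoef k * psi2 k x) := by
  by_cases hn : n ∈ Delta1 a b
  · obtain ⟨k, hk⟩ := hn
    have hlam := mem_Delta_iff.1 hk
    have hsq := Real.mul_self_sqrt (show (0 : ℝ) ≤ 2 by norm_num)
    rcases Nat.eq_zero_or_pos k with h0 | h0
    · subst h0
      have hq : psi1 a b s n = fun x =>
          -s * √2 * (1 / 3 + 1 / ((2 * (n : ℝ) + 1) ^ 2 * Real.pi ^ 2)) + √2 * s * x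
            - √2 / 2 * s * x ^ 2 := by
        funext x; rw [psi1_of_mem_Delta s hk, if_pos rfl]
      refine ⟨fun x => √2 * s - √2 * s * x, fun _ => -(√2 * s), ?_, ?_, continuous_const,
        by simp, by simp, fun h => absurd ⟨0, hk⟩ h, ?_⟩
      · intro x
        rw [hq]
        have h := ((hasDerivAt_const x (-s * √2 * (1 / 3 + 1 / ((2 * (n : ℝ) + 1) ^ 2 *
          Real.pi ^ 2)))).add ((hasDerivAt_id x).const_mul (√2 * s))).sub
          ((hasDerivAt_pow 2 x).const_mul (√2 / 2 * s))
        convert! h using 1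
        norm_num; ring
      · intro x
        have h := ((hasDerivAt_id x).const_mul (√2 * s)).const_sub (√2 * s)
        simpa using h
      · intro k hk' x
        have := Delta_right_unique hk hk'
        subst this
        rw [hlam]
        simp [lam2, psi2, muCoef]
    · set w := (k : ℝ) * Real.pi with hw
      have hw0 : w ≠ 0 := by positivity
      set c := -(2 * s / Real.pi ^ 2) * (1 / (2 * (n : ℝ) + 1) ^ 2 + 1 / (4 * (k : ℝ) ^ 2)) * √2
      have hq : psi1 a b s n = fun x =>
          √2 * s / w * (1 - x) * Real.sin (w * x) + c * Real.cos (w * x) := by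
        funext x; rw [psi1_of_mem_Delta s hk, if_neg h0.ne']
      have hsin : ∀ x, HasDerivAt (fun x => Real.sin (w * x)) (w * Real.cos (w * x)) x := fun x => by
        have := ((hasDerivAt_id x).const_mul w).sin
        simpa [mul_comm] using this
      have hcos : ∀ x, HasDerivAt (fun x => Real.cos (w * x)) (-(w * Real.sin (w * x))) x :=
        fun x => by
          have := ((hasDerivAt_id x).const_mul w).cos
          simpa [mul_comm] using this
      have h1 : ∀ x, HasDerivAt (fun x : ℝ => 1 - x) (-1) x := fun x => by
        simpa using (hasDerivAt_id x).const_sub 1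
      refine ⟨fun x => √2 * s / w * (-Real.sin (w * x) + (1 - x) * (w * Real.cos (w * x)))
          - c * (w * Real.sin (w * x)),
        fun x => √2 * s / w * (-(2 * w * Real.cos (w * x)) - (1 - x) * (w ^ 2 * Real.sin (w * x)))
          - c * (w ^ 2 * Real.cos (w * x)), ?_, ?_, by fun_prop, ?_, ?_,
        fun h => absurd ⟨k, hk⟩ h, ?_⟩
      · intro x
        rw [hq]
        have h := (((h1 x).mul (hsin x)).const_mul (√2 * s / w)).add ((hcos x).const_mul c)
        have h' := h.congr_of_eventuallyEq (f₁ := fun x =>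
          √2 * s / w * (1 - x) * Real.sin (w * x) + c * Real.cos (w * x))
          (Eventually.of_forall fun y => by simp; ring)
        convert! h' using 1
        ring
      · intro x
        have h := (((hsin x).neg.add ((h1 x).mul ((hcos x).const_mul w))).const_mul
          (√2 * s / w)).sub (((hsin x).const_mul w).const_mul c)
        convert! h using 1
        ring
      · simp; field_simp
      · have : Real.sin w = 0 := Real.sin_nat_mul_pi k
        simp [this]
      · intro k' hk' x
        have := Delta_right_unique hk hk'
        subst this
        rw [hlam, hq]
        have hmu : muCoef k = √2 := by simp [muCoef, h0.ne']
        have hl : lam2 b k - b = -w ^ 2 := by unfold lam2; rw [hw]; ring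
        rw [hl]
        simp only [psi2, hmu, ← hw]
        field_simp
        linear_combination (s * Real.cos (w * x) * √2) * hsq
  · set r := r1 a b n
    set c : ℂ := -((√2 * s : ℝ) : ℂ) / (r * Complex.sinh r) with hc
    have hr0 : r ≠ 0 := r1_ne_zero hn
    have hs0 : Complex.sinh r ≠ 0 := sinh_r1_ne_zero hn
    have hq : psi1 a b s n = fun x : ℝ => (c * Complex.cosh (r * (1 - (x : ℂ)))).re := by
      funext x; rw [psi1_of_notMem s hn]
    -- Derivatives are taken in the complex variable and restricted to real parts afterwards, so the
    -- reality of the expression is not needed.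
    have hlin : ∀ z : ℂ, HasDerivAt (fun z : ℂ => r * (1 - z)) (-r) z := fun z => by
      simpa using ((hasDerivAt_id z).const_sub 1).const_mul r
    refine ⟨fun x => (-(c * r) * Complex.sinh (r * (1 - (x : ℂ)))).re,
      fun x => (c * r ^ 2 * Complex.cosh (r * (1 - (x : ℂ)))).re, ?_, ?_, ?_, ?_, ?_, ?_, ?_⟩
    · intro x
      rw [hq]
      have h := ((hlin (x : ℂ)).ccosh.const_mul c).real_of_complex
      convert! h using 1
      ring_nf
    · intro x
      have h := ((hlin (x : ℂ)).csinh.const_mul (-(c * r))).real_of_complex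
      convert! h using 1
      ring_nf
    · fun_prop
    · have : -(c * r) * Complex.sinh (r * (1 - ((0 : ℝ) : ℂ))) = ((√2 * s : ℝ) : ℂ) := by
        rw [hc]; simp only [Complex.ofReal_zero, sub_zero, mul_one]; field_simp
      simp only [this, Complex.ofReal_re]
    · simp
    · intro _ x
      simp only [hq]
      rw [show c * r ^ 2 * Complex.cosh (r * (1 - (x : ℂ)))
        = ((lam1 a n - b : ℝ) : ℂ) * (c * Complex.cosh (r * (1 - (x : ℂ)))) by
          rw [r1_sq]; ring, Complex.re_ofReal_mul]
    · intro k hk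
      exact absurd ⟨k, hk⟩ hn

theorem hasDerivAt_psi1 (a b s : ℝ) (n : ℕ) (x : ℝ) :
    HasDerivAt (psi1 a b s n) (deriv (psi1 a b s n) x) x := by
  obtain ⟨q', q'', h1, -⟩ := exists_psi1_deriv a b s n
  rw [(h1 x).deriv]; exact h1 x

theorem continuous_psi1 (a b s : ℝ) (n : ℕ) : Continuous (psi1 a b s n) :=
  continuous_iff_continuousAt.2 fun x => (hasDerivAt_psi1 a b s n x).continuousAt

theorem psi1_properties (a b s : ℝ) (n : ℕ) : ∃ q'' : ℝ → ℝ,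
    IsH1 (psi1 a b s n) (deriv (psi1 a b s n)) ∧ IsH1 (deriv (psi1 a b s n)) q'' ∧
    Continuous (deriv (psi1 a b s n)) ∧
    deriv (psi1 a b s n) 0 = √2 * s ∧ deriv (psi1 a b s n) 1 = 0 ∧
    (n ∉ Delta1 a b → ∀ x, q'' x = (lam1 a n - b) * psi1 a b s n x) ∧
    (∀ k, (n, k) ∈ Delta a b → ∀ x, q'' x = (lam1 a n - b) * psi1 a b s n x
      - √2 * s * muCoef k * psi2 k x) := by
  obtain ⟨q', q'', h1, h2, h3, h4⟩ := exists_psi1_deriv a b s n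
  have e : deriv (psi1 a b s n) = q' := funext fun x => (h1 x).deriv
  rw [e]
  have hc : Continuous q' := continuous_iff_continuousAt.2 fun x => (h2 x).continuousAt
  exact ⟨q'', .of_hasDerivAt h1 hc, .of_hasDerivAt h2 h3, hc, h4⟩

/-- Here r = ±iθ with θ close to (n + 1/2)π, so the prefactor of cosh(r(1 - x)) has modulus √2|s| /
(θ|sin θ|) with |sin θ| ≥ 1/2. Differentiation costs one factor θ: ψ is O(1/n) and ψ' is O(1). -/
theorem psi1_bounds_of_large {a b s : ℝ} {n : ℕ} (hn : n ∉ Delta1 a b)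
    (h : 2 * |b - a| ≤ ((n : ℝ) + 1 / 2) * Real.pi) :
    ∀ x : ℝ, |((n : ℝ) + 1) * psi1 a b s n x| ≤ 8 * (√2 * |s|) ∧
      |deriv (psi1 a b s n) x| ≤ 2 * (√2 * |s|) := by
  intro x
  have hpi := Real.pi_gt_three
  set τ := ((n : ℝ) + 1 / 2) * Real.pi with hτ
  have hτ1 : 1 ≤ τ := by nlinarith [(Nat.cast_nonneg n : (0 : ℝ) ≤ n)]
  obtain ⟨hpos, hle, hclose⟩ := sqrt_perturb (d := b - a) hτ1 h
  set θ := √(τ ^ 2 + (b - a)) with hθ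
  have hr : r1 a b n ^ 2 = ((-θ ^ 2 : ℝ) : ℂ) := by
    rw [r1_sq, hθ, Real.sq_sqrt hpos.le]; congr 1; unfold lam1; rw [hτ]; ring
  have hsin := half_le_abs_sin (cos_half_mul_pi n) hclose
  have hθpos : 0 < θ := by linarith
  set r := r1 a b n
  set c : ℂ := -((√2 * s : ℝ) : ℂ) / (r * Complex.sinh r) with hc
  have hcn : ‖c‖ * (θ * |Real.sin θ|) = √2 * |s| := by
    have h1 := norm_sinh_mul_of_sq hr 1
    rw [Complex.ofReal_one, mul_one, mul_one] at h1
    rw [hc, norm_div, norm_mul, h1, norm_of_sq hr, norm_neg, Complex.norm_real, abs_of_pos hθpos]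
    have : |Real.sin θ| ≠ 0 := by linarith
    field_simp
    rw [Real.norm_eq_abs, abs_mul, abs_of_nonneg (Real.sqrt_nonneg 2)]
  have hc1 : ‖c‖ * θ ≤ 2 * (√2 * |s|) := by
    rw [← hcn]; nlinarith [mul_nonneg (norm_nonneg c) hθpos.le]
  have hlin : ∀ z : ℂ, HasDerivAt (fun z : ℂ => r * (1 - z)) (-r) z := fun z => by
    simpa using ((hasDerivAt_id z).const_sub 1).const_mul r
  have hq : psi1 a b s n = fun x : ℝ => (c * Complex.cosh (r * (1 - (x : ℂ)))).re := by
    funext x; rw [psi1_of_notMem s hn]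
  have hy : (1 - (x : ℂ)) = ((1 - x : ℝ) : ℂ) := by push_cast; ring
  constructor
  · have h1 : |psi1 a b s n x| ≤ ‖c‖ := by
      rw [hq]
      refine (Complex.abs_re_le_norm _).trans ?_
      rw [norm_mul, hy, norm_cosh_mul_of_sq hr]
      exact mul_le_of_le_one_right (norm_nonneg _) (Real.abs_cos_le_one _)
    rw [abs_mul, abs_of_pos (by positivity : (0 : ℝ) < n + 1)]
    have h2 : (n : ℝ) + 1 ≤ 4 * θ := by
      nlinarith [(Nat.cast_nonneg n : (0 : ℝ) ≤ n)]
    have h3 : ((n : ℝ) + 1) * |psi1 a b s n x| ≤ 4 * θ * ‖c‖ := by gcongr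
    linarith
  · have h := ((hlin (x : ℂ)).ccosh.const_mul c).real_of_complex
    rw [hq, h.deriv]
    refine (Complex.abs_re_le_norm _).trans ?_
    rw [norm_mul, norm_mul, hy, norm_sinh_mul_of_sq hr, norm_neg, norm_of_sq hr,
      abs_of_pos hθpos]
    calc ‖c‖ * (|Real.sin (θ * (1 - x))| * θ) ≤ ‖c‖ * (1 * θ) := by
          gcongr; exact Real.abs_sin_le_one _
      _ ≤ _ := by rw [one_mul]; exact hc1

theorem psi1_bound {a b s : ℝ} {N₀ : ℕ} (hΔ₁ : ∀ n ∈ Delta1 a b, n ≤ N₀) :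
    ∃ K : ℝ, 0 < K ∧ ∀ n : ℕ, ∀ x ∈ Icc (0 : ℝ) 1,
      |((n : ℝ) + 1) * psi1 a b s n x| ≤ K ∧ |deriv (psi1 a b s n) x| ≤ K := by
  obtain ⟨n₁, hn₁⟩ := exists_nat_ge (2 * |b - a|)
  have hlarge : ∀ n ≥ max n₁ (N₀ + 1), n ∉ Delta1 a b ∧
      2 * |b - a| ≤ ((n : ℝ) + 1 / 2) * Real.pi := by
    intro n hn
    refine ⟨fun h => ?_, ?_⟩
    · have := hΔ₁ n h
      have := le_trans (le_max_right _ _) hn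
      omega
    · have h1 : (n₁ : ℝ) ≤ n := by exact_mod_cast le_trans (le_max_left _ _) hn
      nlinarith [Real.pi_gt_three, (Nat.cast_nonneg n : (0 : ℝ) ≤ n)]
  obtain ⟨K₁, hK₁, h1⟩ := exists_uniform_bound
    (f := fun n x => ((n : ℝ) + 1) * psi1 a b s n x)
    (fun n => (continuous_psi1 a b s n).const_mul _) (C := 8 * (√2 * |s|))
    (n₀ := max n₁ (N₀ + 1)) fun n hn x _ =>
      (psi1_bounds_of_large (hlarge n hn).1 (hlarge n hn).2 x).1
  obtain ⟨K₂, hK₂, h2⟩ := exists_uniform_bound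
    (f := fun n x => deriv (psi1 a b s n) x)
    (fun n => by obtain ⟨_, _, _, h, _⟩ := psi1_properties a b s n; exact h)
    (C := 2 * (√2 * |s|)) (n₀ := max n₁ (N₀ + 1)) fun n hn x _ =>
      (psi1_bounds_of_large (hlarge n hn).1 (hlarge n hn).2 x).2
  exact ⟨K₁ + K₂, by positivity, fun n x hx =>
    ⟨(h1 n x hx).trans (by linarith), (h2 n x hx).trans (by linarith)⟩⟩

/-! ## The modes `φ_{2,m}` -/

theorem phi2_of_mem_Delta {a b : ℝ} (s : ℝ) {k m : ℕ} (hk : (k, m) ∈ Delta a b) (x : ℝ) :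
    phi2 a b s m x = s * muCoef m / (((k : ℝ) + 1 / 2) * Real.pi) * (1 - x) *
      Real.sin (((k : ℝ) + 1 / 2) * Real.pi * x) := by
  have h : ∃ k : ℕ, (k, m) ∈ Delta a b := ⟨k, hk⟩
  have hc : h.choose = k := Delta_left_unique h.choose_spec hk
  unfold phi2
  rw [dif_pos h, hc]

theorem phi2_of_eq {a b : ℝ} (s : ℝ) {m : ℕ} (hm : m ∉ Delta2 a b)
    (h : b - a = (m : ℝ) ^ 2 * Real.pi ^ 2) (x : ℝ) :
    phi2 a b s m x = s * muCoef m * (-1 + x) := by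
  unfold phi2
  rw [dif_neg (show ¬ ∃ k : ℕ, (k, m) ∈ Delta a b from hm), if_pos h]

theorem phi2_of_ne {a b : ℝ} (s : ℝ) {m : ℕ} (hm : m ∉ Delta2 a b)
    (h : b - a ≠ (m : ℝ) ^ 2 * Real.pi ^ 2) (x : ℝ) :
    phi2 a b s m x = (-((s * muCoef m : ℝ) : ℂ) / (r2 a b m * Complex.cosh (r2 a b m)) *
      Complex.sinh (r2 a b m * (1 - (x : ℂ)))).re := by
  unfold phi2
  rw [dif_neg (show ¬ ∃ k : ℕ, (k, m) ∈ Delta a b from hm), if_neg h]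

theorem r2_sq (a b : ℝ) (m : ℕ) : r2 a b m ^ 2 = ((lam2 b m - a : ℝ) : ℂ) := rootC_sq _

theorem r2_ne_zero {a b : ℝ} {m : ℕ} (h : b - a ≠ (m : ℝ) ^ 2 * Real.pi ^ 2) :
    r2 a b m ≠ 0 := by
  intro h0
  have h1 := r2_sq a b m
  rw [h0, zero_pow two_ne_zero] at h1
  have h2 : lam2 b m - a = 0 := by exact_mod_cast h1.symm
  unfold lam2 at h2
  exact h (by linarith)

theorem cosh_r2_ne_zero {a b : ℝ} {m : ℕ} (hm : m ∉ Delta2 a b) :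
    Complex.cosh (r2 a b m) ≠ 0 := by
  refine cosh_ne_zero_of_sq (r2_sq a b m) fun k hk => hm ⟨k, mem_Delta_iff.2 ?_⟩
  unfold lam1
  linarith

/-- The properties of the first component of `φ_{2,m}` as a solution of the eigenvalue problem. -/
theorem exists_phi2_deriv (a b s : ℝ) (m : ℕ) : ∃ f' f'' : ℝ → ℝ,
    (∀ x, HasDerivAt (phi2 a b s m) (f' x) x) ∧ (∀ x, HasDerivAt f' (f'' x) x) ∧
    Continuous f'' ∧ f' 0 = s * muCoef m ∧ phi2 a b s m 1 = 0 ∧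
    (m ∉ Delta2 a b → ∀ x, f'' x = (lam2 b m - a) * phi2 a b s m x) ∧
    (∀ k, (k, m) ∈ Delta a b → ∀ x, f'' x = (lam2 b m - a) * phi2 a b s m x
      - √2 * s * muCoef m * phi1 k x) := by
  by_cases hm : m ∈ Delta2 a b
  · obtain ⟨k, hk⟩ := hm
    have hlam := mem_Delta_iff.1 hk
    have hsq := Real.mul_self_sqrt (show (0 : ℝ) ≤ 2 by norm_num)
    set w := ((k : ℝ) + 1 / 2) * Real.pi with hw
    have hw0 : w ≠ 0 := by positivity
    have hf : phi2 a b s m = fun x => s * muCoef m / w * (1 - x) * Real.sin (w * x) := by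
      funext x; rw [phi2_of_mem_Delta s hk]
    have hsin : ∀ x, HasDerivAt (fun x => Real.sin (w * x)) (w * Real.cos (w * x)) x := fun x => by
      have := ((hasDerivAt_id x).const_mul w).sin
      simpa [mul_comm] using this
    have hcos : ∀ x, HasDerivAt (fun x => Real.cos (w * x)) (-(w * Real.sin (w * x))) x :=
      fun x => by
        have := ((hasDerivAt_id x).const_mul w).cos
        simpa [mul_comm] using this
    have h1 : ∀ x, HasDerivAt (fun x : ℝ => 1 - x) (-1) x := fun x => by
      simpa using (hasDerivAt_id x).const_sub 1
    refine ⟨fun x => s * muCoef m / w * (-Real.sin (w * x) + (1 - x) * (w * Real.cos (w * x))),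
      fun x => s * muCoef m / w *
        (-(2 * w * Real.cos (w * x)) - (1 - x) * (w ^ 2 * Real.sin (w * x))),
      ?_, ?_, by fun_prop, ?_, ?_, fun h => absurd ⟨k, hk⟩ h, ?_⟩
    · intro x
      rw [hf]
      have h := ((h1 x).mul (hsin x)).const_mul (s * muCoef m / w)
      have h' := h.congr_of_eventuallyEq (f₁ := fun x =>
        s * muCoef m / w * (1 - x) * Real.sin (w * x))
        (Eventually.of_forall fun y => by simp; ring)
      convert! h' using 1
      ring
    · intro x
      have h := ((hsin x).neg.add ((h1 x).mul ((hcos x).const_mul w))).const_mul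
        (s * muCoef m / w)
      convert! h using 1
      ring
    · simp; field_simp
    · rw [hf]; simp
    · intro k' hk' x
      have := Delta_left_unique hk hk'
      subst this
      have hl : lam2 b m - a = -w ^ 2 := by rw [← hlam]; unfold lam1; rw [hw]; ring
      rw [hf, hl]
      simp only [phi1, ← hw]
      field_simp
      linear_combination (s * muCoef m * Real.cos (w * x)) * hsq
  · by_cases h : b - a = (m : ℝ) ^ 2 * Real.pi ^ 2
    · have hf : phi2 a b s m = fun x => s * muCoef m * (-1 + x) := by
        funext x; rw [phi2_of_eq s hm h]
      refine ⟨fun _ => s * muCoef m, fun _ => 0, ?_, fun x => hasDerivAt_const _ _,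
        continuous_const, rfl, by rw [hf]; simp, ?_, fun k hk => absurd ⟨k, hk⟩ hm⟩
      · intro x
        rw [hf]
        simpa using ((hasDerivAt_id x).const_add (-1)).const_mul (s * muCoef m)
      · intro _ x
        have : lam2 b m - a = 0 := by unfold lam2; linarith
        rw [this, zero_mul]
    · set r := r2 a b m
      set c : ℂ := -((s * muCoef m : ℝ) : ℂ) / (r * Complex.cosh r) with hc
      have hr0 : r ≠ 0 := r2_ne_zero h
      have hs0 : Complex.cosh r ≠ 0 := cosh_r2_ne_zero hm
      have hf : phi2 a b s m = fun x : ℝ => (c * Complex.sinh (r * (1 - (x : ℂ)))).re := by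
        funext x; rw [phi2_of_ne s hm h]
      have hlin : ∀ z : ℂ, HasDerivAt (fun z : ℂ => r * (1 - z)) (-r) z := fun z => by
        simpa using ((hasDerivAt_id z).const_sub 1).const_mul r
      refine ⟨fun x => (-(c * r) * Complex.cosh (r * (1 - (x : ℂ)))).re,
        fun x => (c * r ^ 2 * Complex.sinh (r * (1 - (x : ℂ)))).re, ?_, ?_, ?_, ?_, ?_, ?_, ?_⟩
      · intro x
        rw [hf]
        have h := ((hlin (x : ℂ)).csinh.const_mul c).real_of_complex
        convert! h using 1
        ring_nf
      · intro x
        have h := ((hlin (x : ℂ)).ccosh.const_mul (-(c * r))).real_of_complex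
        convert! h using 1
        ring_nf
      · fun_prop
      · have : -(c * r) * Complex.cosh (r * (1 - ((0 : ℝ) : ℂ))) = ((s * muCoef m : ℝ) : ℂ) := by
          rw [hc]; simp only [Complex.ofReal_zero, sub_zero, mul_one]; field_simp
        simp only [this, Complex.ofReal_re]
      · rw [hf]; simp
      · intro _ x
        simp only [hf]
        rw [show c * r ^ 2 * Complex.sinh (r * (1 - (x : ℂ)))
          = ((lam2 b m - a : ℝ) : ℂ) * (c * Complex.sinh (r * (1 - (x : ℂ)))) by
            rw [r2_sq]; ring, Complex.re_ofReal_mul]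
      · intro k hk
        exact absurd ⟨k, hk⟩ hm

theorem hasDerivAt_phi2 (a b s : ℝ) (m : ℕ) (x : ℝ) :
    HasDerivAt (phi2 a b s m) (deriv (phi2 a b s m) x) x := by
  obtain ⟨q', q'', h1, -⟩ := exists_phi2_deriv a b s m
  rw [(h1 x).deriv]; exact h1 x

theorem continuous_phi2 (a b s : ℝ) (m : ℕ) : Continuous (phi2 a b s m) :=
  continuous_iff_continuousAt.2 fun x => (hasDerivAt_phi2 a b s m x).continuousAt

theorem phi2_properties (a b s : ℝ) (m : ℕ) : ∃ f'' : ℝ → ℝ,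
    IsH1 (phi2 a b s m) (deriv (phi2 a b s m)) ∧ IsH1 (deriv (phi2 a b s m)) f'' ∧
    Continuous (deriv (phi2 a b s m)) ∧
    deriv (phi2 a b s m) 0 = s * muCoef m ∧ phi2 a b s m 1 = 0 ∧
    (m ∉ Delta2 a b → ∀ x, f'' x = (lam2 b m - a) * phi2 a b s m x) ∧
    (∀ k, (k, m) ∈ Delta a b → ∀ x, f'' x = (lam2 b m - a) * phi2 a b s m x
      - √2 * s * muCoef m * phi1 k x) := by
  obtain ⟨q', q'', h1, h2, h3, h4⟩ := exists_phi2_deriv a b s m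
  have e : deriv (phi2 a b s m) = q' := funext fun x => (h1 x).deriv
  rw [e]
  have hc : Continuous q' := continuous_iff_continuousAt.2 fun x => (h2 x).continuousAt
  exact ⟨q'', .of_hasDerivAt h1 hc, .of_hasDerivAt h2 h3, hc, h4⟩

theorem muCoef_le (m : ℕ) : muCoef m ≤ √2 := by
  unfold muCoef
  split_ifs
  · exact Real.one_le_sqrt.2 (by norm_num)
  · exact le_rfl

/-- The prefactor has modulus |s|μ_m / (θ|cos θ|), where θ is close to the sine zero mπ and hence
|cos θ| ≥ 1/2; differentiation multiplies by θ and cancels the 1/θ. -/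
theorem deriv_phi2_bound_of_large {a b s : ℝ} {m : ℕ} (hm : m ∉ Delta2 a b)
    (hm1 : 1 ≤ m) (h : 2 * |a - b| ≤ (m : ℝ) * Real.pi) (x : ℝ) :
    |deriv (phi2 a b s m) x| ≤ 2 * (|s| * √2) := by
  have hpi := Real.pi_gt_three
  have hm1' : (1 : ℝ) ≤ m := by exact_mod_cast hm1
  set τ := (m : ℝ) * Real.pi with hτ
  have hτ1 : 1 ≤ τ := by nlinarith
  obtain ⟨hpos, hle, hclose⟩ := sqrt_perturb (d := a - b) hτ1 h
  set θ := √(τ ^ 2 + (a - b)) with hθ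
  have hr : r2 a b m ^ 2 = ((-θ ^ 2 : ℝ) : ℂ) := by
    rw [r2_sq, hθ, Real.sq_sqrt hpos.le]; congr 1; unfold lam2; rw [hτ]; ring
  have hcos := half_le_abs_cos (Real.sin_nat_mul_pi m) hclose
  have hθpos : 0 < θ := by linarith
  have hne : b - a ≠ (m : ℝ) ^ 2 * Real.pi ^ 2 := by
    intro h'
    have : τ ^ 2 + (a - b) = 0 := by rw [hτ]; linarith
    linarith
  set r := r2 a b m
  set c : ℂ := -((s * muCoef m : ℝ) : ℂ) / (r * Complex.cosh r) with hc
  have hcn : ‖c‖ * (θ * |Real.cos θ|) = |s| * muCoef m := by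
    have h1 := norm_cosh_mul_of_sq hr 1
    rw [Complex.ofReal_one, mul_one, mul_one] at h1
    rw [hc, norm_div, norm_mul, h1, norm_of_sq hr, norm_neg, Complex.norm_real, abs_of_pos hθpos]
    have : |Real.cos θ| ≠ 0 := by linarith
    field_simp
    rw [Real.norm_eq_abs, abs_mul, abs_of_pos (muCoef_pos m), mul_comm]
  have hc1 : ‖c‖ * θ ≤ 2 * (|s| * √2) := by
    have : |s| * muCoef m ≤ |s| * √2 := by gcongr; exact muCoef_le m
    nlinarith [mul_nonneg (norm_nonneg c) hθpos.le]
  have hlin : ∀ z : ℂ, HasDerivAt (fun z : ℂ => r * (1 - z)) (-r) z := fun z => by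
    simpa using ((hasDerivAt_id z).const_sub 1).const_mul r
  have hf : phi2 a b s m = fun x : ℝ => (c * Complex.sinh (r * (1 - (x : ℂ)))).re := by
    funext x; rw [phi2_of_ne s hm hne]
  have hy : (1 - (x : ℂ)) = ((1 - x : ℝ) : ℂ) := by push_cast; ring
  have h := ((hlin (x : ℂ)).csinh.const_mul c).real_of_complex
  rw [hf, h.deriv]
  refine (Complex.abs_re_le_norm _).trans ?_
  rw [norm_mul, norm_mul, hy, norm_cosh_mul_of_sq hr, norm_neg, norm_of_sq hr,
    abs_of_pos hθpos]
  calc ‖c‖ * (|Real.cos (θ * (1 - x))| * θ) ≤ ‖c‖ * (1 * θ) := by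
        gcongr; exact Real.abs_cos_le_one _
    _ ≤ _ := by rw [one_mul]; exact hc1

theorem deriv_phi2_bound {a b s : ℝ} {M₀ : ℕ} (hΔ₂ : ∀ m ∈ Delta2 a b, m ≤ M₀) :
    ∃ K : ℝ, 0 < K ∧ ∀ m : ℕ, ∀ x ∈ Icc (0 : ℝ) 1, |deriv (phi2 a b s m) x| ≤ K := by
  obtain ⟨n₁, hn₁⟩ := exists_nat_ge (2 * |a - b|)
  refine exists_uniform_bound (C := 2 * (|s| * √2)) (n₀ := max n₁ (M₀ + 1))
    (fun m => by obtain ⟨_, _, _, h, _⟩ := phi2_properties a b s m; exact h) ?_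
  intro m hm x _
  have h1 : M₀ + 1 ≤ m := le_trans (le_max_right _ _) hm
  have h2 : (n₁ : ℝ) ≤ m := by exact_mod_cast le_trans (le_max_left _ _) hm
  refine deriv_phi2_bound_of_large (fun h => ?_) (by omega) ?_ x
  · have := hΔ₂ m h; omega
  · nlinarith [Real.pi_gt_three, (Nat.cast_nonneg m : (0 : ℝ) ≤ m)]

/-- Mean value inequality from the endpoint 1, where φ_{2,m} vanishes. -/
theorem phi2_bound_of_deriv {a b s : ℝ} {m : ℕ} {K : ℝ}
    (hK : ∀ x ∈ Icc (0 : ℝ) 1, |deriv (phi2 a b s m) x| ≤ K) :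
    ∀ x ∈ Icc (0 : ℝ) 1, |phi2 a b s m x| ≤ K := by
  intro x hx
  obtain ⟨_, _, _, _, _, h1, _⟩ := phi2_properties a b s m
  have := (convex_Icc (0 : ℝ) 1).norm_image_sub_le_of_norm_hasDerivWithin_le
    (fun y hy => (hasDerivAt_phi2 a b s m y).hasDerivWithinAt) (fun y hy => hK y hy)
    (right_mem_Icc.2 zero_le_one) hx
  rw [h1, sub_zero, Real.norm_eq_abs, Real.norm_eq_abs] at this
  refine this.trans (mul_le_of_le_one_right ((abs_nonneg _).trans (hK x hx)) ?_)
  rw [abs_le]; constructor <;> linarith [hx.1, hx.2]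

/-! ## Modal coefficients -/

/-- `(y, w)` is in the domain of the generator of the homogenised cascade. -/
structure InDomain (s : ℝ) (y y' y'' w w' w'' : ℝ → ℝ) : Prop where
  y_h1 : IsH1 y y'
  y_h2 : IsH1 y' y''
  w_h1 : IsH1 w w'
  w_h2 : IsH1 w' w''
  y_bc_zero : y' 0 = s * w 0
  y_bc_one : y 1 = 0
  w_bc_zero : w' 0 = 0
  w_bc_one : w' 1 = 0

/-- Coefficient of `(y, w)` along `φ_{1,n}`. -/
noncomputable def mode1 (a b s : ℝ) (y w : ℝ → ℝ) (n : ℕ) : ℝ :=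
  (∫ x in (0 : ℝ)..1, y x * phi1 n x) + ∫ x in (0 : ℝ)..1, w x * psi1 a b s n x

/-- Coefficient of `(y, w)` along `φ_{2,m}`. -/
noncomputable def mode2 (w : ℝ → ℝ) (m : ℕ) : ℝ := ∫ x in (0 : ℝ)..1, w x * psi2 m x

theorem memLp_psi1 (a b s : ℝ) (n : ℕ) : MemLp (psi1 a b s n) 2 unitMeasure :=
  memLp_of_continuousOn (continuous_psi1 a b s n).continuousOn

section Generator

variable {s : ℝ} {y y' y'' w w' w'' : ℝ → ℝ}

theorem InDomain.integral_psi2 (h : InDomain s y y' y'' w w' w'') (m : ℕ) :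
    ∫ x in (0 : ℝ)..1, w'' x * psi2 m x = -((m : ℝ) ^ 2 * Real.pi ^ 2) * mode2 w m := by
  rw [h.w_h1.green h.w_h2 (isH1_psi2 m) (isH1_psi2Deriv m), h.w_bc_zero, h.w_bc_one,
    psi2Deriv_zero, psi2Deriv_one, mode2, ← intervalIntegral.integral_const_mul]
  simp only [zero_mul, mul_zero, sub_zero, add_zero, zero_add]
  congr 1; ext x; ring

/-- The coupling y'(0) = s w(0) leaves a trace term. The boundary value ψ_{1,n}'(0) = √2 s is what
makes the corresponding term for w cancel it in `mode1`. -/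
theorem InDomain.integral_phi1 (h : InDomain s y y' y'' w w' w'') (n : ℕ) :
    ∫ x in (0 : ℝ)..1, y'' x * phi1 n x = -(√2 * s * w 0)
      - ((n : ℝ) + 1 / 2) ^ 2 * Real.pi ^ 2 * ∫ x in (0 : ℝ)..1, y x * phi1 n x := by
  have e : ∫ x in (0 : ℝ)..1, y x * (-(((n : ℝ) + 1 / 2) ^ 2 * Real.pi ^ 2) * phi1 n x)
      = -(((n : ℝ) + 1 / 2) ^ 2 * Real.pi ^ 2) * ∫ x in (0 : ℝ)..1, y x * phi1 n x := by
    rw [← intervalIntegral.integral_const_mul]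
    congr 1; ext x; ring
  rw [h.y_h1.green h.y_h2 (isH1_phi1 n) (isH1_deriv_phi1 n), h.y_bc_zero, h.y_bc_one,
    phi1_one, phi1_zero, sinHalf_zero, e]
  ring

theorem InDomain.integral_psi1 (h : InDomain s y y' y'' w w' w'') {a b : ℝ} {n : ℕ}
    (hn : n ∉ Delta1 a b) :
    ∫ x in (0 : ℝ)..1, w'' x * psi1 a b s n x = √2 * s * w 0
      + (lam1 a n - b) * ∫ x in (0 : ℝ)..1, w x * psi1 a b s n x := by
  obtain ⟨q'', h1, h2, -, h3, h4, h5, -⟩ := psi1_properties a b s n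
  rw [h.w_h1.green h.w_h2 h1 h2, h.w_bc_zero, h.w_bc_one, h3, h4,
    ← intervalIntegral.integral_const_mul]
  congr 1
  · ring
  · congr 1; ext x; rw [h5 hn]; ring

theorem InDomain.integral_psi1_of_mem (h : InDomain s y y' y'' w w' w'') {a b : ℝ} {n k : ℕ}
    (hk : (n, k) ∈ Delta a b) :
    ∫ x in (0 : ℝ)..1, w'' x * psi1 a b s n x = √2 * s * w 0
      + (lam1 a n - b) * (∫ x in (0 : ℝ)..1, w x * psi1 a b s n x)
      - √2 * s * muCoef k * mode2 w k := by
  obtain ⟨q'', h1, h2, -, h3, h4, -, h5⟩ := psi1_properties a b s n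
  rw [h.w_h1.green h.w_h2 h1 h2, h.w_bc_zero, h.w_bc_one, h3, h4, mode2, add_sub_assoc,
    ← intervalIntegral.integral_const_mul, ← intervalIntegral.integral_const_mul,
    ← intervalIntegral.integral_sub]
  · congr 1
    · ring
    · congr 1; ext x; rw [h5 k hk]; ring
  · exact (h.w_h1.memLp_self.intervalIntegrable_mul (memLp_psi1 a b s n)).const_mul _
  · exact (h.w_h1.memLp_self.intervalIntegrable_mul (isONFamily_psi2.memLp k)).const_mul _

theorem integral_linear_mul {f g e : ℝ → ℝ} (hf : MemLp f 2 unitMeasure)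
    (hg : MemLp g 2 unitMeasure) (he : MemLp e 2 unitMeasure) (c : ℝ) :
    ∫ x in (0 : ℝ)..1, (f x + c * g x) * e x
      = (∫ x in (0 : ℝ)..1, f x * e x) + c * ∫ x in (0 : ℝ)..1, g x * e x := by
  rw [← intervalIntegral.integral_const_mul, ← intervalIntegral.integral_add
    (hf.intervalIntegrable_mul he) ((hg.intervalIntegrable_mul he).const_mul c)]
  congr 1; ext x; ring

theorem InDomain.mode2_generator (h : InDomain s y y' y'' w w' w'') (b : ℝ) (m : ℕ) :
    mode2 (fun x => w'' x + b * w x) m = lam2 b m * mode2 w m := by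
  have h1 := h.integral_psi2 m
  rw [mode2, integral_linear_mul h.w_h2.memLp h.w_h1.memLp_self (isONFamily_psi2.memLp m), h1]
  unfold lam2 mode2
  ring

theorem InDomain.mode1_generator (h : InDomain s y y' y'' w w' w'') {a b : ℝ} {n : ℕ}
    (hn : n ∉ Delta1 a b) :
    mode1 a b s (fun x => y'' x + a * y x) (fun x => w'' x + b * w x) n
      = lam1 a n * mode1 a b s y w n := by
  unfold mode1
  rw [integral_linear_mul h.w_h2.memLp h.w_h1.memLp_self (memLp_psi1 a b s n),
    integral_linear_mul h.y_h2.memLp h.y_h1.memLp_self (isONFamily_phi1.memLp n),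
    h.integral_phi1, h.integral_psi1 hn]
  unfold lam1
  ring

/-- At a resonance the source term in the equation of ψ_{1,n} survives as a coupling to mode (2,k):
this is the off-diagonal entry of `A1`. -/
theorem InDomain.mode1_generator_of_mem (h : InDomain s y y' y'' w w' w'') {a b : ℝ} {n k : ℕ}
    (hk : (n, k) ∈ Delta a b) :
    mode1 a b s (fun x => y'' x + a * y x) (fun x => w'' x + b * w x) n
      = lam1 a n * mode1 a b s y w n - √2 * s * muCoef k * mode2 w k := by
  unfold mode1
  rw [integral_linear_mul h.w_h2.memLp h.w_h1.memLp_self (memLp_psi1 a b s n),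
    integral_linear_mul h.y_h2.memLp h.y_h1.memLp_self (isONFamily_phi1.memLp n),
    h.integral_phi1, h.integral_psi1_of_mem hk]
  unfold lam1
  ring

end Generator

/-! ## Biorthogonality -/

theorem inDomain_phi2 (a b s : ℝ) (m : ℕ) : ∃ f'' : ℝ → ℝ,
    InDomain s (phi2 a b s m) (deriv (phi2 a b s m)) f'' (psi2 m) (psi2Deriv m)
      (fun x => -((m : ℝ) ^ 2 * Real.pi ^ 2) * psi2 m x) ∧
    (m ∉ Delta2 a b → ∀ x, f'' x = (lam2 b m - a) * phi2 a b s m x) ∧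
    (∀ k, (k, m) ∈ Delta a b → ∀ x, f'' x = (lam2 b m - a) * phi2 a b s m x
      - √2 * s * muCoef m * phi1 k x) := by
  obtain ⟨f'', h1, h2, -, h3, h4, h5, h6⟩ := phi2_properties a b s m
  exact ⟨f'', ⟨h1, h2, isH1_psi2 m, isH1_psi2Deriv m, by rw [h3, psi2_zero], h4,
    psi2Deriv_zero m, psi2Deriv_one m⟩, h5, h6⟩

theorem integral_one_sub_mul_sin {w : ℝ} (hw : w ≠ 0) (h : Real.sin w = 0) :
    ∫ x in (0 : ℝ)..1, (1 - x) * Real.sin (w * x) = 1 / w := by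
  have hd : ∀ x ∈ uIcc (0 : ℝ) 1, HasDerivAt
      (fun x => -((1 - x) * Real.cos (w * x) / w) - Real.sin (w * x) / w ^ 2)
      ((1 - x) * Real.sin (w * x)) x := by
    intro x _
    have hsin : HasDerivAt (fun x => Real.sin (w * x)) (w * Real.cos (w * x)) x := by
      have := ((hasDerivAt_id x).const_mul w).sin
      simpa [mul_comm] using this
    have hcos : HasDerivAt (fun x => Real.cos (w * x)) (-(w * Real.sin (w * x))) x := by
      have := ((hasDerivAt_id x).const_mul w).cos
      simpa [mul_comm] using this
    have h1 : HasDerivAt (fun x : ℝ => 1 - x) (-1) x := by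
      simpa using (hasDerivAt_id x).const_sub 1
    have := ((h1.mul hcos).div_const w).neg.sub (hsin.div_const (w ^ 2))
    convert! this using 1
    field_simp
    ring
  rw [intervalIntegral.integral_eq_sub_of_hasDerivAt hd
    (by apply Continuous.intervalIntegrable; fun_prop)]
  simp [h]

theorem integral_one_sub_mul_sin_mul_cos {w : ℝ} (hw : w ≠ 0) (h : Real.sin (2 * w) = 0) :
    ∫ x in (0 : ℝ)..1, (1 - x) * Real.sin (w * x) * Real.cos (w * x) = 1 / (4 * w) := by
  have e : ∀ x, (1 - x) * Real.sin (w * x) * Real.cos (w * x)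
      = 1 / 2 * ((1 - x) * Real.sin (2 * w * x)) := by
    intro x
    rw [mul_assoc 2 w x, Real.sin_two_mul]; ring
  simp only [e]
  rw [intervalIntegral.integral_const_mul, integral_one_sub_mul_sin (by positivity) h]
  field_simp
  norm_num

/-- With equal eigenvalues the spectral argument is void. The pairing vanishes because the cosine
(or constant) summand of ψ_{1,n} is normalised so that the two integrals are opposite. -/
theorem biorthogonal_of_mem {a b : ℝ} (s : ℝ) {n m : ℕ} (hnm : (n, m) ∈ Delta a b) :
    mode1 a b s (phi2 a b s m) (psi2 m) n = 0 := by
  have hsq := Real.mul_self_sqrt (show (0 : ℝ) ≤ 2 by norm_num)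
  have hpi := Real.pi_ne_zero
  have hn : (2 * (n : ℝ) + 1) ≠ 0 := by positivity
  have h1 : ∫ x in (0 : ℝ)..1, phi2 a b s m x * phi1 n x
      = √2 * s * muCoef m / ((2 * (n : ℝ) + 1) ^ 2 * Real.pi ^ 2) := by
    have hw : ((n : ℝ) + 1 / 2) * Real.pi ≠ 0 := by positivity
    have e : ∀ x, phi2 a b s m x * phi1 n x
        = √2 * (s * muCoef m / (((n : ℝ) + 1 / 2) * Real.pi)) * ((1 - x)
          * Real.sin (((n : ℝ) + 1 / 2) * Real.pi * x)
          * Real.cos (((n : ℝ) + 1 / 2) * Real.pi * x)) := by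
      intro x; rw [phi2_of_mem_Delta s hnm, phi1]; ring
    simp only [e]
    rw [intervalIntegral.integral_const_mul, integral_one_sub_mul_sin_mul_cos hw]
    · field_simp
      ring
    · have := Real.sin_nat_mul_pi (2 * n + 1)
      rw [← this]; congr 1; push_cast; ring
  have h2 : ∫ x in (0 : ℝ)..1, psi2 m x * psi1 a b s n x
      = -(√2 * s * muCoef m / ((2 * (n : ℝ) + 1) ^ 2 * Real.pi ^ 2)) := by
    rcases Nat.eq_zero_or_pos m with h0 | h0
    · subst h0
      simp only [psi1_of_mem_Delta s hnm, if_pos, psi2, muCoef, Nat.cast_zero, zero_mul,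
        Real.cos_zero, one_mul, mul_one]
      set c := -s * √2 * (1 / 3 + 1 / ((2 * (n : ℝ) + 1) ^ 2 * Real.pi ^ 2)) with hc
      have hd : ∀ x ∈ uIcc (0 : ℝ) 1, HasDerivAt
          (fun x : ℝ => c * x + √2 * s / 2 * x ^ 2 - √2 / 6 * s * x ^ 3)
          (c + √2 * s * x - √2 / 2 * s * x ^ 2) x := by
        intro x _
        have := (((hasDerivAt_id x).const_mul c).add ((hasDerivAt_pow 2 x).const_mul
          (√2 * s / 2))).sub ((hasDerivAt_pow 3 x).const_mul (√2 / 6 * s))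
        convert! this using 1
        norm_num; ring
      rw [intervalIntegral.integral_eq_sub_of_hasDerivAt hd
        (by apply Continuous.intervalIntegrable; fun_prop), hc]
      field_simp
      ring
    · have hm : (m : ℝ) ≠ 0 := by exact_mod_cast h0.ne'
      have hw : (m : ℝ) * Real.pi ≠ 0 := by positivity
      set c := -(2 * s / Real.pi ^ 2) * (1 / (2 * (n : ℝ) + 1) ^ 2 + 1 / (4 * (m : ℝ) ^ 2))
        with hc
      have e : ∀ x, psi2 m x * psi1 a b s n x
          = √2 * √2 * s / ((m : ℝ) * Real.pi) * ((1 - x) * Real.sin ((m : ℝ) * Real.pi * x)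
            * Real.cos ((m : ℝ) * Real.pi * x)) + c * (psi2 m x * psi2 m x) := by
        intro x
        rw [psi1_of_mem_Delta s hnm, if_neg h0.ne', ← hc]
        simp only [psi2, muCoef, if_neg h0.ne']
        ring
      simp only [e]
      rw [intervalIntegral.integral_add, intervalIntegral.integral_const_mul,
        intervalIntegral.integral_const_mul, isONFamily_psi2.ortho, if_pos rfl,
        integral_one_sub_mul_sin_mul_cos hw, hsq, hc]
      · simp only [muCoef, if_neg h0.ne']
        rw [show √2 * s * √2 = (√2 * √2) * s by ring, hsq]
        field_simp
        ring
      · have := Real.sin_nat_mul_pi (2 * m)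
        rw [← this]; congr 1; push_cast; ring
      · apply Continuous.intervalIntegrable; fun_prop
      · have := continuous_psi2 m
        apply Continuous.intervalIntegrable; fun_prop
  rw [mode1, h1, h2]; ring

/-- Pairing the image of (φ_{2,m}, ψ_{2,m}) under the generator with the dual element of (1,n) gives
both λ_{1,n} and λ_{2,m} times the original pairing, which therefore vanishes when they differ.
Coupling terms from other resonant pairs drop out by orthonormality of the cosine families. -/
theorem biorthogonal (a b s : ℝ) (n m : ℕ) :
    mode1 a b s (phi2 a b s m) (psi2 m) n = 0 := by
  by_cases hnm : (n, m) ∈ Delta a b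
  · exact biorthogonal_of_mem s hnm
  have hne : lam2 b m - lam1 a n ≠ 0 := fun h0 =>
    hnm (mem_Delta_iff.2 (by linarith))
  obtain ⟨f'', hD, hf1, hf2⟩ := inDomain_phi2 a b s m
  have e1 : mode1 a b s (fun x => f'' x + a * phi2 a b s m x)
      (fun x => -((m : ℝ) ^ 2 * Real.pi ^ 2) * psi2 m x + b * psi2 m x) n
      = lam1 a n * mode1 a b s (phi2 a b s m) (psi2 m) n := by
    by_cases hn : n ∈ Delta1 a b
    · obtain ⟨k, hk⟩ := hn
      have hkm : ¬ m = k := fun h => hnm (h ▸ hk)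
      rw [hD.mode1_generator_of_mem hk, mode2, isONFamily_psi2.ortho, if_neg hkm]; ring
    · exact hD.mode1_generator hn
  have hphi := memLp_of_continuousOn (continuous_phi2 a b s m).continuousOn
  have e2 : mode1 a b s (fun x => f'' x + a * phi2 a b s m x)
      (fun x => -((m : ℝ) ^ 2 * Real.pi ^ 2) * psi2 m x + b * psi2 m x) n
      = lam2 b m * mode1 a b s (phi2 a b s m) (psi2 m) n := by
    have e3 : ∫ x in (0 : ℝ)..1, (f'' x + a * phi2 a b s m x) * phi1 n x
        = lam2 b m * ∫ x in (0 : ℝ)..1, phi2 a b s m x * phi1 n x := by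
      by_cases hm : m ∈ Delta2 a b
      · obtain ⟨k, hk⟩ := hm
        have hkn : ¬ k = n := fun h => hnm (h ▸ hk)
        have e4 : ∀ x, f'' x + a * phi2 a b s m x = -(√2 * s * muCoef m) * phi1 k x
            + lam2 b m * phi2 a b s m x := fun x => by rw [hf2 k hk]; ring
        simp only [e4]
        rw [integral_linear_mul ((isONFamily_phi1.memLp k).const_mul _) hphi
          (isONFamily_phi1.memLp n)]
        simp only [mul_assoc, intervalIntegral.integral_const_mul, isONFamily_phi1.ortho,
          if_neg hkn]
        ring
      · rw [← intervalIntegral.integral_const_mul]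
        congr 1; ext x; rw [hf1 hm]; ring
    rw [mode1, mode1, e3, mul_add, ← intervalIntegral.integral_const_mul (lam2 b m)
      (fun x => psi2 m x * psi1 a b s n x)]
    congr 2; ext x; unfold lam2; ring
  have e3 : (lam2 b m - lam1 a n) * mode1 a b s (phi2 a b s m) (psi2 m) n = 0 := by
    linarith
  exact (mul_eq_zero.1 e3).resolve_left hne

/-! ## Decay of the modal coefficients -/

theorem summable_one_div_succ_sq : Summable fun n : ℕ => 1 / ((n : ℝ) + 1) ^ 2 := by
  have := (summable_nat_add_iff 1).2 (Real.summable_one_div_nat_pow.2 one_lt_two)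
  simpa using this

theorem sq_mul_integral_psi1_le {a b s K : ℝ} {n : ℕ}
    (hK : ∀ x ∈ Icc (0 : ℝ) 1, |((n : ℝ) + 1) * psi1 a b s n x| ≤ K)
    {f : ℝ → ℝ} (hf : MemLp f 2 unitMeasure) :
    (((n : ℝ) + 1) * ∫ x in (0 : ℝ)..1, f x * psi1 a b s n x) ^ 2
      ≤ K ^ 2 * ∫ x in (0 : ℝ)..1, f x ^ 2 := by
  rw [← intervalIntegral.integral_const_mul]
  have e : ∀ x, ((n : ℝ) + 1) * (f x * psi1 a b s n x)
      = f x * (((n : ℝ) + 1) * psi1 a b s n x) := fun x => by ring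
  simp only [e]
  have hm := (memLp_psi1 a b s n).const_mul ((n : ℝ) + 1)
  refine (sq_integral_mul_le hf hm).trans ?_
  rw [mul_comm]
  gcongr
  · exact integral_sq_nonneg f
  · calc _ ≤ ∫ _ in (0 : ℝ)..1, K ^ 2 := by
          refine intervalIntegral.integral_mono_on zero_le_one hm.intervalIntegrable_sq (by simp)
            fun x hx => ?_
          exact sq_le_sq' (abs_le.1 (hK x hx)).1 (abs_le.1 (hK x hx)).2
      _ = _ := by simp

/-- The pointwise bound ψ_{1,n} = O(1/n) suffices for any square-integrable f. With f = α and f = β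
it gives the finite total input gain of the high modes. -/
theorem summable_sq_mul_integral_psi1 {a b s : ℝ} {N₀ : ℕ} (hΔ₁ : ∀ n ∈ Delta1 a b, n ≤ N₀)
    {f : ℝ → ℝ} (hf : MemLp f 2 unitMeasure) :
    Summable fun n => (∫ x in (0 : ℝ)..1, f x * psi1 a b s n x) ^ 2 := by
  obtain ⟨K, hK, hb⟩ := psi1_bound (s := s) hΔ₁
  refine Summable.of_nonneg_of_le (fun _ => sq_nonneg _) (fun n => ?_)
    (summable_one_div_succ_sq.mul_left (K ^ 2 * ∫ x in (0 : ℝ)..1, f x ^ 2))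
  have := sq_mul_integral_psi1_le (fun x hx => (hb n x hx).1) hf
  rw [mul_pow] at this
  rw [mul_one_div, le_div_iff₀ (by positivity), mul_comm]
  exact this

theorem summable_mode1_sq {a b s : ℝ} {N₀ : ℕ} (hΔ₁ : ∀ n ∈ Delta1 a b, n ≤ N₀)
    {f g : ℝ → ℝ} (hf : MemLp f 2 unitMeasure) (hg : MemLp g 2 unitMeasure) :
    Summable fun n => mode1 a b s f g n ^ 2 := by
  refine Summable.of_nonneg_of_le (fun _ => sq_nonneg _) (fun n => ?_)
    (((isONFamily_phi1.summable_sq hf).mul_left 2).add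
      ((summable_sq_mul_integral_psi1 (s := s) hΔ₁ hg).mul_left 2))
  unfold mode1
  nlinarith [sq_nonneg ((∫ x in (0 : ℝ)..1, f x * phi1 n x)
    - ∫ x in (0 : ℝ)..1, g x * psi1 a b s n x)]

/-- The generator multiplies the coefficient by λ_{1,n}, of order n², and the coefficients of its
square-integrable image are square summable. The possibly resonant indices n ≤ N₀ are finitely many.
-/
theorem InDomain.summable_mode1 {s : ℝ} {y y' y'' w w' w'' : ℝ → ℝ}
    (h : InDomain s y y' y'' w w' w'') {a b : ℝ} {N₀ : ℕ} (hΔ₁ : ∀ n ∈ Delta1 a b, n ≤ N₀) :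
    Summable fun n : ℕ => (((n : ℝ) + 1) ^ 2 * mode1 a b s y w n) ^ 2 := by
  have h1 := summable_mode1_sq (s := s) hΔ₁ h.y_h1.memLp_self h.w_h1.memLp_self
  have h2 := summable_mode1_sq (s := s) hΔ₁ (h.y_h2.memLp.add (h.y_h1.memLp_self.const_mul a))
    (h.w_h2.memLp.add (h.w_h1.memLp_self.const_mul b))
  refine Summable.of_norm_bounded_eventually_nat ((h1.mul_left (2 * a ^ 2)).add (h2.mul_left 2)) ?_
  filter_upwards [eventually_gt_atTop N₀] with n hn
  have h3 : mode1 a b s (fun x => y'' x + a * y x) (fun x => w'' x + b * w x) n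
      = lam1 a n * mode1 a b s y w n := h.mode1_generator fun h' => by
    have := hΔ₁ n h'; omega
  simp only [Pi.add_def]
  rw [h3, Real.norm_eq_abs, abs_of_nonneg (sq_nonneg _)]
  set x := mode1 a b s y w n
  have h4 : ((n : ℝ) + 1) ^ 2 ≤ a - lam1 a n := by
    unfold lam1
    nlinarith [Real.pi_gt_three, (Nat.cast_nonneg n : (0 : ℝ) ≤ n),
      mul_le_mul (show (n : ℝ) + 1 ≤ 2 * (n + 1 / 2) by
        linarith [(Nat.cast_nonneg n : (0 : ℝ) ≤ n)])
      (show (n : ℝ) + 1 ≤ 2 * (n + 1 / 2) by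
        linarith [(Nat.cast_nonneg n : (0 : ℝ) ≤ n)]) (by positivity) (by positivity),
      mul_nonneg (sq_nonneg ((n : ℝ) + 1 / 2)) (show (0 : ℝ) ≤ Real.pi ^ 2 - 4 by
        nlinarith [Real.pi_gt_three])]
  calc (((n : ℝ) + 1) ^ 2 * x) ^ 2 = (((n : ℝ) + 1) ^ 2) ^ 2 * x ^ 2 := by ring
    _ ≤ (a - lam1 a n) ^ 2 * x ^ 2 := by gcongr
    _ ≤ _ := by nlinarith [sq_nonneg (a * x + lam1 a n * x)]

theorem InDomain.summable_mode2 {s : ℝ} {y y' y'' w w' w'' : ℝ → ℝ}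
    (h : InDomain s y y' y'' w w' w'') :
    Summable fun m : ℕ => (((m : ℝ) + 1) ^ 2 * mode2 w m) ^ 2 := by
  have h1 := isONFamily_psi2.summable_sq h.w_h1.memLp_self
  have h2 := isONFamily_psi2.summable_sq h.w_h2.memLp
  refine Summable.of_nonneg_of_le (fun _ => sq_nonneg _) (fun m => ?_)
    ((h1.mul_left 8).add (h2.mul_left 8))
  rw [h.integral_psi2]
  change _ ≤ 8 * mode2 w m ^ 2 + _
  have h3 : ((m : ℝ) + 1) ^ 4 ≤ 8 + 8 * (m : ℝ) ^ 4 := by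
    nlinarith [sq_nonneg ((m : ℝ) - 1), sq_nonneg ((m : ℝ) ^ 2 - 1), sq_nonneg ((m : ℝ) + 1),
      sq_nonneg ((m : ℝ) ^ 2 - m)]
  have h4 : (1 : ℝ) ≤ Real.pi ^ 4 := one_le_pow₀ (by linarith [Real.pi_gt_three])
  have h5 : (m : ℝ) ^ 4 ≤ (m : ℝ) ^ 4 * Real.pi ^ 4 := le_mul_of_one_le_right (by positivity) h4
  calc (((m : ℝ) + 1) ^ 2 * mode2 w m) ^ 2 = ((m : ℝ) + 1) ^ 4 * mode2 w m ^ 2 := by ring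
    _ ≤ (8 + 8 * ((m : ℝ) ^ 4 * Real.pi ^ 4)) * mode2 w m ^ 2 := by gcongr; linarith
    _ = _ := by ring

/-- Integrating by parts once against ψ'' = (λ - b)ψ gives (b - λ) ∫ wψ = ∫ w'ψ' + √2 s w(0), where
ψ' is bounded and the trace is controlled by the Sobolev inequality. The resulting n⁻² makes the
cross terms summable with weight (n+1)²; ψ = O(1/n) alone only bounds the weighted terms
individually. -/
theorem exists_integral_psi1_decay {a b : ℝ} (s : ℝ) {N₀ : ℕ} (hΔ₁ : ∀ n ∈ Delta1 a b, n ≤ N₀) :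
    ∃ C : ℝ, 0 < C ∧ ∀ w w' : ℝ → ℝ, IsH1 w w' → ∀ n : ℕ,
      (((n : ℝ) + 1) ^ 2 * ∫ x in (0 : ℝ)..1, w x * psi1 a b s n x) ^ 2
        ≤ C * ((∫ x in (0 : ℝ)..1, w x ^ 2) + ∫ x in (0 : ℝ)..1, w' x ^ 2) := by
  obtain ⟨K, hK, hb⟩ := psi1_bound (s := s) hΔ₁
  obtain ⟨n₁, hn₁⟩ := exists_nat_ge (|b - a|)
  -- Beyond `n₂` there is no resonance, and b - λ_{1,n} dominates (n+1)²/2.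
  set n₂ := max n₁ (N₀ + 1)
  refine ⟨((n₂ : ℝ) + 1) ^ 2 * K ^ 2 + (4 * (8 * s ^ 2) + 8 * K ^ 2), by positivity,
    fun w w' hw n => ?_⟩
  have hI := integral_sq_nonneg w
  have hI' := integral_sq_nonneg w'
  rcases le_or_gt n₂ n with hn | hn
  · have hn0 : n ∉ Delta1 a b := fun h => by
      have := hΔ₁ n h
      have := le_trans (le_max_right n₁ (N₀ + 1)) hn
      omega
    have hna : (n₁ : ℝ) ≤ n := by exact_mod_cast le_trans (le_max_left _ _) hn
    obtain ⟨q'', h1, h2, hc, h3, h4, h5, -⟩ := psi1_properties a b s n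
    have e1 := hw.integral_mul_add h2
    have e2 : ∫ x in (0 : ℝ)..1, w x * q'' x
        = (lam1 a n - b) * ∫ x in (0 : ℝ)..1, w x * psi1 a b s n x := by
      rw [← intervalIntegral.integral_const_mul]
      congr 1; ext x; rw [h5 hn0]; ring
    rw [e2, h3, h4] at e1
    set J := ∫ x in (0 : ℝ)..1, w x * psi1 a b s n x
    set L := ∫ x in (0 : ℝ)..1, w' x * deriv (psi1 a b s n) x
    have hL : L ^ 2 ≤ K ^ 2 * ∫ x in (0 : ℝ)..1, w' x ^ 2 := by
      have hm := memLp_of_continuousOn hc.continuousOn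
      refine (sq_integral_mul_le hw.memLp hm).trans ?_
      rw [mul_comm]
      gcongr
      calc _ ≤ ∫ _ in (0 : ℝ)..1, K ^ 2 := by
            refine intervalIntegral.integral_mono_on zero_le_one hm.intervalIntegrable_sq
              (by simp) fun x hx => ?_
            exact sq_le_sq' (abs_le.1 (hb n x hx).2).1 (abs_le.1 (hb n x hx).2).2
        _ = _ := by simp
    have hw0 := hw.sq_le (left_mem_Icc.2 zero_le_one)
    have hlam : ((n : ℝ) + 1) ^ 2 ≤ 2 * (b - lam1 a n) := by
      unfold lam1
      have := neg_abs_le (b - a)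
      nlinarith [Real.pi_gt_three, (Nat.cast_nonneg n : (0 : ℝ) ≤ n),
        mul_nonneg (sq_nonneg ((n : ℝ) + 1 / 2)) (show (0 : ℝ) ≤ Real.pi ^ 2 - 9 by
        nlinarith [Real.pi_gt_three])]
    have hsq := Real.mul_self_sqrt (show (0 : ℝ) ≤ 2 by norm_num)
    have hJ : (b - lam1 a n) * J = L + w 0 * (√2 * s) := by linarith
    calc (((n : ℝ) + 1) ^ 2 * J) ^ 2 = (((n : ℝ) + 1) ^ 2) ^ 2 * J ^ 2 := by ring
      _ ≤ (2 * (b - lam1 a n)) ^ 2 * J ^ 2 := by gcongr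
      _ = 4 * (L + w 0 * (√2 * s)) ^ 2 := by rw [← hJ]; ring
      _ ≤ 4 * (2 * L ^ 2 + 2 * (w 0 * (√2 * s)) ^ 2) := by
          nlinarith [sq_nonneg (L - w 0 * (√2 * s))]
      _ = 8 * L ^ 2 + 8 * ((√2 * √2) * s ^ 2) * w 0 ^ 2 := by ring
      _ ≤ 8 * (K ^ 2 * ∫ x in (0 : ℝ)..1, w' x ^ 2) + 8 * ((√2 * √2) * s ^ 2)
          * (2 * ((∫ r in (0 : ℝ)..1, w r ^ 2) + ∫ r in (0 : ℝ)..1, w' r ^ 2)) := by gcongr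
      _ ≤ _ := by
          rw [hsq]
          nlinarith [mul_nonneg (sq_nonneg K) hI, mul_nonneg (sq_nonneg K) hI',
            mul_nonneg (mul_nonneg (sq_nonneg ((n₂ : ℝ) + 1)) (sq_nonneg K)) hI,
            mul_nonneg (mul_nonneg (sq_nonneg ((n₂ : ℝ) + 1)) (sq_nonneg K)) hI']
  -- For the finitely many indices below `n₂` the O(1/n) bound is enough, at the price of a factor
  -- (n₂+1)².
  · have h1 := sq_mul_integral_psi1_le (fun x hx => (hb n x hx).1) hw.memLp_self
    have h2 : ((n : ℝ) + 1) ^ 2 ≤ ((n₂ : ℝ) + 1) ^ 2 := by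
      have : (n : ℝ) ≤ n₂ := by exact_mod_cast hn.le
      gcongr
    set J := ∫ x in (0 : ℝ)..1, w x * psi1 a b s n x
    calc (((n : ℝ) + 1) ^ 2 * J) ^ 2 = ((n : ℝ) + 1) ^ 2 * (((n : ℝ) + 1) * J) ^ 2 := by ring
      _ ≤ ((n₂ : ℝ) + 1) ^ 2 * (K ^ 2 * ∫ x in (0 : ℝ)..1, w x ^ 2) := by gcongr
      _ ≤ _ := by
          nlinarith [mul_nonneg (mul_nonneg (sq_nonneg ((n₂ : ℝ) + 1)) (sq_nonneg K)) hI',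
            mul_nonneg (sq_nonneg K) hI, mul_nonneg (sq_nonneg K) hI',
            mul_nonneg (sq_nonneg s) hI, mul_nonneg (sq_nonneg s) hI']

/-! ## Equivalence of the energy with weighted sums of modal coefficients -/

/-- The half-integer sines are, up to a factor, the derivatives of φ_{1,n}. They vanish at 0 and y
vanishes at 1, so integration by parts leaves no boundary term. -/
theorem IsH1.integral_sinHalf {y y' : ℝ → ℝ} (hy : IsH1 y y') (h1 : y 1 = 0) (n : ℕ) :
    ∫ x in (0 : ℝ)..1, y' x * sinHalf n x
      = -((((n : ℝ) + 1 / 2) * Real.pi) * ∫ x in (0 : ℝ)..1, y x * phi1 n x) := by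
  have h := hy.integral_mul_add (isH1_sinHalf n)
  rw [h1, sinHalf_zero] at h
  have e : ∫ x in (0 : ℝ)..1, y x * ((((n : ℝ) + 1 / 2) * Real.pi) * phi1 n x)
      = (((n : ℝ) + 1 / 2) * Real.pi) * ∫ x in (0 : ℝ)..1, y x * phi1 n x := by
    rw [← intervalIntegral.integral_const_mul]
    congr 1; ext x; ring
  rw [e] at h
  linarith

theorem IsH1.hasSum_deriv_sq {y y' : ℝ → ℝ} (hy : IsH1 y y') (h1 : y 1 = 0) :
    HasSum (fun n : ℕ => ((((n : ℝ) + 1 / 2) * Real.pi) * ∫ x in (0 : ℝ)..1, y x * phi1 n x) ^ 2)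
      (∫ x in (0 : ℝ)..1, y' x ^ 2) := by
  have h := isONFamily_sinHalf.hasSum_sq isTotalFamily_sinHalf hy.memLp
  simpa only [hy.integral_sinHalf h1, neg_sq] using h

theorem InDomain.hasSum_mode2_sq {s : ℝ} {y y' y'' w w' w'' : ℝ → ℝ}
    (h : InDomain s y y' y'' w w' w'') :
    HasSum (fun m : ℕ => mode2 w m ^ 2) (∫ x in (0 : ℝ)..1, w x ^ 2) :=
  isONFamily_psi2.hasSum_sq isTotalFamily_psi2 h.w_h1.memLp_self

/-- Parseval for the pair (w'', w) in cosines, combined with ∫ w'² = -∫ w''w. No second basis of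
integer sines is needed. -/
theorem InDomain.hasSum_mode2_deriv_sq {s : ℝ} {y y' y'' w w' w'' : ℝ → ℝ}
    (h : InDomain s y y' y'' w w' w'') :
    HasSum (fun m : ℕ => (((m : ℝ) * Real.pi) * mode2 w m) ^ 2)
      (∫ x in (0 : ℝ)..1, w' x ^ 2) := by
  have h1 := (isONFamily_psi2.hasSum_mul isTotalFamily_psi2 h.w_h2.memLp h.w_h1.memLp_self).neg
  have h2 := h.w_h2.integral_mul_add h.w_h1
  rw [h.w_bc_zero, h.w_bc_one] at h2
  have h3 : -∫ x in (0 : ℝ)..1, w'' x * w x = ∫ x in (0 : ℝ)..1, w' x ^ 2 := by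
    simp only [sq]; linarith
  rw [h3] at h1
  have e : (fun m : ℕ => (((m : ℝ) * Real.pi) * mode2 w m) ^ 2)
      = fun i => -((∫ x in (0 : ℝ)..1, w'' x * psi2 i x) * ∫ x in (0 : ℝ)..1, w x * psi2 i x) := by
    funext m
    rw [h.integral_psi2 m]
    change _ = -(_ * mode2 w m)
    ring
  rw [e]
  exact h1

theorem InDomain.integral_w_le {s : ℝ} {y y' y'' w w' w'' : ℝ → ℝ}
    (h : InDomain s y y' y'' w w' w'') :
    (∫ x in (0 : ℝ)..1, w x ^ 2) + ∫ x in (0 : ℝ)..1, w' x ^ 2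
      ≤ 20 * ∑' m : ℕ, (((m : ℝ) + 1) * mode2 w m) ^ 2 := by
  have hsum : Summable fun m : ℕ => (((m : ℝ) + 1) * mode2 w m) ^ 2 := by
    refine Summable.of_nonneg_of_le (fun _ => sq_nonneg _) (fun m => ?_) h.summable_mode2
    rw [mul_pow, mul_pow]
    gcongr
    have : (1 : ℝ) ≤ (m : ℝ) + 1 := by linarith [(Nat.cast_nonneg m : (0 : ℝ) ≤ m)]
    nlinarith
  have h1 := h.hasSum_mode2_sq.add h.hasSum_mode2_deriv_sq
  rw [← h1.tsum_eq, ← tsum_mul_left]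
  refine Summable.tsum_le_tsum (fun m => ?_) h1.summable (hsum.mul_left 20)
  have hpi : Real.pi ^ 2 ≤ 16 := by nlinarith [Real.pi_le_four, Real.pi_pos]
  have : (m : ℝ) ^ 2 * Real.pi ^ 2 ≤ (m : ℝ) ^ 2 * 16 := by gcongr
  have h2 : 1 + (m : ℝ) ^ 2 * Real.pi ^ 2 ≤ 20 * ((m : ℝ) + 1) ^ 2 := by
    nlinarith [(Nat.cast_nonneg m : (0 : ℝ) ≤ m), sq_nonneg (m : ℝ)]
  nlinarith [mul_le_mul_of_nonneg_right h2 (sq_nonneg (mode2 w m))]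

theorem InDomain.tsum_mode2_le {s : ℝ} {y y' y'' w w' w'' : ℝ → ℝ}
    (h : InDomain s y y' y'' w w' w'') :
    Summable (fun m : ℕ => (((m : ℝ) + 1) * mode2 w m) ^ 2) ∧
    ∑' m : ℕ, (((m : ℝ) + 1) * mode2 w m) ^ 2
      ≤ 2 * ((∫ x in (0 : ℝ)..1, w x ^ 2) + ∫ x in (0 : ℝ)..1, w' x ^ 2) := by
  have h1 := h.hasSum_mode2_sq.add h.hasSum_mode2_deriv_sq
  have hle : ∀ m : ℕ, (((m : ℝ) + 1) * mode2 w m) ^ 2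
      ≤ 2 * (mode2 w m ^ 2 + (((m : ℝ) * Real.pi) * mode2 w m) ^ 2) := by
    intro m
    have hpi : 1 ≤ Real.pi ^ 2 := by nlinarith [Real.pi_gt_three]
    have : (m : ℝ) ^ 2 ≤ (m : ℝ) ^ 2 * Real.pi ^ 2 := le_mul_of_one_le_right (sq_nonneg _) hpi
    have h2 : ((m : ℝ) + 1) ^ 2 ≤ 2 * (1 + (m : ℝ) ^ 2 * Real.pi ^ 2) := by
      nlinarith [sq_nonneg ((m : ℝ) - 1)]
    nlinarith [mul_le_mul_of_nonneg_right h2 (sq_nonneg (mode2 w m))]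
  have hs := Summable.of_nonneg_of_le (fun _ => sq_nonneg _) hle (h1.summable.mul_left 2)
  refine ⟨hs, ?_⟩
  rw [← h1.tsum_eq, ← tsum_mul_left]
  exact Summable.tsum_le_tsum hle hs (h1.summable.mul_left 2)

theorem half_freq_bounds (n : ℕ) : ((n : ℝ) + 1) ≤ ((n : ℝ) + 1 / 2) * Real.pi ∧
    ((n : ℝ) + 1 / 2) * Real.pi ≤ 4 * ((n : ℝ) + 1) := by
  have := Real.pi_gt_three
  have := Real.pi_le_four
  constructor <;> nlinarith [(Nat.cast_nonneg n : (0 : ℝ) ≤ n)]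

theorem exists_tsum_integral_psi1_le {a b : ℝ} (s : ℝ) {N₀ : ℕ}
    (hΔ₁ : ∀ n ∈ Delta1 a b, n ≤ N₀) :
    ∃ C : ℝ, 0 < C ∧ ∀ w w' : ℝ → ℝ, IsH1 w w' →
      Summable (fun n : ℕ => (((n : ℝ) + 1) * ∫ x in (0 : ℝ)..1, w x * psi1 a b s n x) ^ 2) ∧
      ∑' n : ℕ, (((n : ℝ) + 1) * ∫ x in (0 : ℝ)..1, w x * psi1 a b s n x) ^ 2
        ≤ C * ((∫ x in (0 : ℝ)..1, w x ^ 2) + ∫ x in (0 : ℝ)..1, w' x ^ 2) := by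
  obtain ⟨C, hC, h⟩ := exists_integral_psi1_decay s hΔ₁
  have hZ := summable_one_div_succ_sq
  refine ⟨C * (∑' n : ℕ, 1 / ((n : ℝ) + 1) ^ 2) + 1, by positivity, fun w w' hw => ?_⟩
  set E := (∫ x in (0 : ℝ)..1, w x ^ 2) + ∫ x in (0 : ℝ)..1, w' x ^ 2
  have hE : 0 ≤ E := add_nonneg (integral_sq_nonneg _) (integral_sq_nonneg _)
  have hle : ∀ n : ℕ, (((n : ℝ) + 1) * ∫ x in (0 : ℝ)..1, w x * psi1 a b s n x) ^ 2
      ≤ C * E * (1 / ((n : ℝ) + 1) ^ 2) := by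
    intro n
    rw [mul_one_div, le_div_iff₀ (by positivity)]
    refine le_trans (le_of_eq ?_) (h w w' hw n)
    ring
  have hs := Summable.of_nonneg_of_le (fun _ => sq_nonneg _) hle (hZ.mul_left _)
  refine ⟨hs, (Summable.tsum_le_tsum hle hs (hZ.mul_left _)).trans ?_⟩
  rw [tsum_mul_left]
  nlinarith

/-- The coefficient along φ_{1,n} differs from ∫ yφ_{1,n} by ∫ wψ_{1,n}, whose weighted square sum
is bounded by the H¹ norm of w. Parseval for y' thus transfers in both directions. -/
theorem exists_energy_bounds {a b : ℝ} (s : ℝ) {N₀ : ℕ} (hΔ₁ : ∀ n ∈ Delta1 a b, n ≤ N₀) :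
    ∃ C : ℝ, 0 < C ∧ ∀ y y' y'' w w' w'' : ℝ → ℝ, InDomain s y y' y'' w w' w'' →
      Summable (fun n : ℕ => (((n : ℝ) + 1) * mode1 a b s y w n) ^ 2) ∧
      ∑' n : ℕ, (((n : ℝ) + 1) * mode1 a b s y w n) ^ 2
        ≤ C * ((∫ x in (0 : ℝ)..1, y' x ^ 2) + (∫ x in (0 : ℝ)..1, w x ^ 2)
          + ∫ x in (0 : ℝ)..1, w' x ^ 2) ∧
      (∫ x in (0 : ℝ)..1, y' x ^ 2) ≤ C * (∑' n : ℕ, (((n : ℝ) + 1) * mode1 a b s y w n) ^ 2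
        + ∑' m : ℕ, (((m : ℝ) + 1) * mode2 w m) ^ 2) := by
  obtain ⟨C, hC, h⟩ := exists_tsum_integral_psi1_le s hΔ₁
  -- 32 = 2·4² comes from (n + 1/2)π ≤ 4(n+1), and 20 is the constant of `InDomain.integral_w_le`.
  refine ⟨32 + 32 * (20 * C) + 2 * C, by positivity, fun y y' y'' w w' w'' hD => ?_⟩
  obtain ⟨hs1, hle1⟩ := h w w' hD.w_h1
  have hy := hD.y_h1.hasSum_deriv_sq hD.y_bc_one
  have hw := hD.integral_w_le
  set Iy := ∫ x in (0 : ℝ)..1, y' x ^ 2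
  set E := (∫ x in (0 : ℝ)..1, w x ^ 2) + ∫ x in (0 : ℝ)..1, w' x ^ 2 with hE
  have hE0 : 0 ≤ E := add_nonneg (integral_sq_nonneg _) (integral_sq_nonneg _)
  have hIy : 0 ≤ Iy := integral_sq_nonneg _
  have hS2 : 0 ≤ ∑' m : ℕ, (((m : ℝ) + 1) * mode2 w m) ^ 2 := tsum_nonneg fun _ => sq_nonneg _
  have hb1 : ∀ n : ℕ, (((n : ℝ) + 1) * mode1 a b s y w n) ^ 2
      ≤ 2 * ((((n : ℝ) + 1 / 2) * Real.pi) * ∫ x in (0 : ℝ)..1, y x * phi1 n x) ^ 2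
        + 2 * (((n : ℝ) + 1) * ∫ x in (0 : ℝ)..1, w x * psi1 a b s n x) ^ 2 := by
    intro n
    unfold mode1
    set p := ∫ x in (0 : ℝ)..1, y x * phi1 n x
    set q := ∫ x in (0 : ℝ)..1, w x * psi1 a b s n x
    have h1 : (((n : ℝ) + 1) * p) ^ 2 ≤ ((((n : ℝ) + 1 / 2) * Real.pi) * p) ^ 2 := by
      rw [mul_pow, mul_pow]; gcongr; exact (half_freq_bounds n).1
    nlinarith [sq_nonneg (((n : ℝ) + 1) * p - ((n : ℝ) + 1) * q)]
  have hsum := (hy.summable.mul_left 2).add (hs1.mul_left 2)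
  have hs := Summable.of_nonneg_of_le (fun _ => sq_nonneg _) hb1 hsum
  have hS1 : 0 ≤ ∑' n : ℕ, (((n : ℝ) + 1) * mode1 a b s y w n) ^ 2 :=
    tsum_nonneg fun _ => sq_nonneg _
  refine ⟨hs, ?_, ?_⟩
  · have h1 := Summable.tsum_le_tsum hb1 hs hsum
    rw [(hy.summable.mul_left 2).tsum_add (hs1.mul_left 2), tsum_mul_left, tsum_mul_left,
      hy.tsum_eq] at h1
    nlinarith [mul_nonneg hC.le hIy, mul_nonneg hC.le hE0]
  · have hb2 : ∀ n : ℕ, ((((n : ℝ) + 1 / 2) * Real.pi) * ∫ x in (0 : ℝ)..1, y x * phi1 n x) ^ 2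
        ≤ 32 * (((n : ℝ) + 1) * mode1 a b s y w n) ^ 2
        + 32 * (((n : ℝ) + 1) * ∫ x in (0 : ℝ)..1, w x * psi1 a b s n x) ^ 2 := by
      intro n
      unfold mode1
      set p := ∫ x in (0 : ℝ)..1, y x * phi1 n x
      set q := ∫ x in (0 : ℝ)..1, w x * psi1 a b s n x
      have hpi := Real.pi_pos
      have h1 : ((((n : ℝ) + 1 / 2) * Real.pi) * p) ^ 2 ≤ (4 * ((n : ℝ) + 1) * p) ^ 2 := by
        have h0 := (half_freq_bounds n).2
        rw [mul_pow, mul_pow _ p]; gcongr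
      nlinarith [sq_nonneg (((n : ℝ) + 1) * (p + q) + ((n : ℝ) + 1) * q)]
    have hsum2 := (hs.mul_left 32).add (hs1.mul_left 32)
    have h1 := Summable.tsum_le_tsum hb2 hy.summable hsum2
    rw [(hs.mul_left 32).tsum_add (hs1.mul_left 32), tsum_mul_left, tsum_mul_left,
      hy.tsum_eq] at h1
    nlinarith [mul_nonneg hC.le hS1, mul_nonneg hC.le hS2, mul_le_mul_of_nonneg_left hw hC.le]

/-! ## Modal expansion of the output -/

/-- Young's inequality for the product of (n+1)²|x_n| and 1/(n+1), both square summable. This gives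
normal convergence of the differentiated series. -/
theorem summable_succ_mul_abs {x : ℕ → ℝ} (h : Summable fun n : ℕ => (((n : ℝ) + 1) ^ 2 * x n) ^ 2) :
    Summable fun n : ℕ => ((n : ℝ) + 1) * |x n| := by
  refine Summable.of_nonneg_of_le (fun n => by positivity) (fun n => ?_)
    (h.add summable_one_div_succ_sq)
  have h1 : ((n : ℝ) + 1) * |x n| = (((n : ℝ) + 1) ^ 2 * |x n|) * (1 / ((n : ℝ) + 1)) := by
    field_simp
  have h2 : (((n : ℝ) + 1) ^ 2 * x n) ^ 2 = (((n : ℝ) + 1) ^ 2 * |x n|) ^ 2 := by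
    rw [mul_pow, mul_pow, sq_abs]
  rw [h1, h2, ← one_div_pow]
  nlinarith [sq_nonneg ((((n : ℝ) + 1) ^ 2 * |x n|) - (1 / ((n : ℝ) + 1))),
    sq_nonneg (((n : ℝ) + 1) ^ 2 * |x n|), sq_nonneg (1 / ((n : ℝ) + 1))]

theorem summable_abs_of_weighted {x : ℕ → ℝ}
    (h : Summable fun n : ℕ => (((n : ℝ) + 1) ^ 2 * x n) ^ 2) : Summable fun n : ℕ => |x n| := by
  refine Summable.of_nonneg_of_le (fun n => abs_nonneg _) (fun n => ?_) (summable_succ_mul_abs h)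
  exact le_mul_of_one_le_left (abs_nonneg _) (by linarith [(Nat.cast_nonneg n : (0 : ℝ) ≤ n)])

theorem deriv_phi1 (n : ℕ) (x : ℝ) :
    deriv (phi1 n) x = -((((n : ℝ) + 1 / 2) * Real.pi) * sinHalf n x) :=
  (hasDerivAt_phi1 n x).deriv

theorem continuous_deriv_phi1 (n : ℕ) : Continuous (deriv (phi1 n)) := by
  rw [funext (deriv_phi1 n)]; exact ((continuous_sinHalf n).const_mul _).neg

theorem continuous_deriv_phi2 (a b s : ℝ) (m : ℕ) : Continuous (deriv (phi2 a b s m)) := by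
  obtain ⟨_, _, _, h, _⟩ := phi2_properties a b s m; exact h

theorem abs_deriv_phi1_le (n : ℕ) (x : ℝ) : |deriv (phi1 n) x| ≤ 8 * ((n : ℝ) + 1) := by
  have h0 : 0 ≤ ((n : ℝ) + 1 / 2) * Real.pi := by positivity
  rw [deriv_phi1, abs_neg, abs_mul, abs_of_nonneg h0, sinHalf, abs_mul,
    abs_of_nonneg (Real.sqrt_nonneg 2)]
  have h1 := (half_freq_bounds n).2
  have h2 : √2 * |Real.sin (((n : ℝ) + 1 / 2) * Real.pi * x)| ≤ 2 * 1 := by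
    gcongr
    · rw [Real.sqrt_le_left (by norm_num)]; norm_num
    · exact Real.abs_sin_le_one _
  calc _ ≤ 4 * ((n : ℝ) + 1) * (2 * 1) := by gcongr
    _ = _ := by ring

theorem abs_phi1_le (n : ℕ) (x : ℝ) : |phi1 n x| ≤ 2 := by
  rw [phi1, abs_mul, abs_of_nonneg (Real.sqrt_nonneg 2)]
  have h2 : √2 * |Real.cos (((n : ℝ) + 1 / 2) * Real.pi * x)| ≤ 2 * 1 := by
    gcongr
    · rw [Real.sqrt_le_left (by norm_num)]; norm_num
    · exact Real.abs_cos_le_one _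
  linarith

/-- Termwise integration of a normally convergent series of continuous functions. -/
theorem hasSum_integral_of_normal {f : ℕ → ℝ → ℝ} (hf : ∀ n, Continuous (f n)) {u : ℕ → ℝ}
    (hu : Summable u) (hfu : ∀ n, ∀ x ∈ Icc (0 : ℝ) 1, |f n x| ≤ u n)
    {c d : ℝ} (hc : c ∈ Icc (0 : ℝ) 1) (hd : d ∈ Icc (0 : ℝ) 1) {g : ℝ → ℝ}
    (hg : Continuous g) :
    HasSum (fun n => ∫ x in c..d, f n x * g x) (∫ x in c..d, (∑' n, f n x) * g x) := by
  obtain ⟨B, hB⟩ := isCompact_Icc.exists_bound_of_continuousOn (hg.continuousOn (s := Icc 0 1))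
  have hsub : ∀ x, x ∈ uIoc c d → x ∈ Icc (0 : ℝ) 1 := fun x hx =>
    uIcc_subset_Icc hc hd (uIoc_subset_uIcc hx)
  have hsum : ∀ x ∈ Icc (0 : ℝ) 1, Summable fun n => f n x := fun x hx =>
    Summable.of_norm_bounded hu fun n => hfu n x hx
  refine intervalIntegral.hasSum_integral_of_dominated_convergence (fun n _ => u n * B)
    (fun n => ((hf n).mul hg).aestronglyMeasurable) (fun n => ?_) ?_ (by simp) ?_
  · refine Eventually.of_forall fun x hx => ?_
    have hx' := hsub x hx
    rw [norm_mul]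
    exact mul_le_mul (hfu n x hx') (hB x hx') (norm_nonneg _)
      ((abs_nonneg _).trans (hfu n x hx'))
  · exact Eventually.of_forall fun x _ => hu.mul_right B
  · exact Eventually.of_forall fun x hx => ((hsum x (hsub x hx)).hasSum).mul_right _

/-- Both series converge normally, so the right side is continuous and can be tested termwise
against the total family `sinHalf`. No completeness of the full biorthogonal system is invoked. -/
theorem InDomain.deriv_expansion {s : ℝ} {y y' y'' w w' w'' : ℝ → ℝ}
    (h : InDomain s y y' y'' w w' w'') {a b : ℝ} {N₀ M₀ : ℕ} (hΔ₁ : ∀ n ∈ Delta1 a b, n ≤ N₀)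
    (hΔ₂ : ∀ m ∈ Delta2 a b, m ≤ M₀) :
    ∀ x ∈ Icc (0 : ℝ) 1, y' x = ∑' n, mode1 a b s y w n * deriv (phi1 n) x
      + ∑' m, mode2 w m * deriv (phi2 a b s m) x := by
  obtain ⟨K, hK, hphi2⟩ := deriv_phi2_bound (s := s) hΔ₂
  set X := mode1 a b s y w with hX
  set Z := mode2 w with hZ
  have hX1 := (summable_succ_mul_abs (h.summable_mode1 hΔ₁)).mul_left 8
  have hZ1 := (summable_abs_of_weighted h.summable_mode2).mul_right K
  have hbX : ∀ n, ∀ x ∈ Icc (0 : ℝ) 1, |X n * deriv (phi1 n) x| ≤ 8 * (((n : ℝ) + 1) * |X n|) := by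
    intro n x _
    rw [abs_mul]
    have := mul_le_mul_of_nonneg_left (abs_deriv_phi1_le n x) (abs_nonneg (X n))
    linarith
  have hbZ : ∀ m, ∀ x ∈ Icc (0 : ℝ) 1, |Z m * deriv (phi2 a b s m) x| ≤ |Z m| * K := by
    intro m x hx
    rw [abs_mul]
    exact mul_le_mul_of_nonneg_left (hphi2 m x hx) (abs_nonneg _)
  have hcX : ∀ n, Continuous fun x => X n * deriv (phi1 n) x := fun n =>
    (continuous_deriv_phi1 n).const_mul _
  have hcZ : ∀ m, Continuous fun x => Z m * deriv (phi2 a b s m) x := fun m =>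
    (continuous_deriv_phi2 a b s m).const_mul _
  set g1 : ℝ → ℝ := fun x => ∑' n, X n * deriv (phi1 n) x with hg1
  set g2 : ℝ → ℝ := fun x => ∑' m, Z m * deriv (phi2 a b s m) x with hg2
  have hg1c : ContinuousOn g1 (Icc 0 1) :=
    continuousOn_tsum (fun n => (hcX n).continuousOn) hX1 hbX
  have hg2c : ContinuousOn g2 (Icc 0 1) :=
    continuousOn_tsum (fun n => (hcZ n).continuousOn) hZ1 hbZ
  have h01 : (0 : ℝ) ∈ Icc (0 : ℝ) 1 := left_mem_Icc.2 zero_le_one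
  have h11 : (1 : ℝ) ∈ Icc (0 : ℝ) 1 := right_mem_Icc.2 zero_le_one
  have hgm := memLp_of_continuousOn (hg1c.add hg2c)
  have key : ∀ j, ∫ x in (0 : ℝ)..1, (y' x - (g1 x + g2 x)) * sinHalf j x = 0 := by
    intro j
    set κ := ((j : ℝ) + 1 / 2) * Real.pi with hκ
    have hS := continuous_sinHalf j
    have e1 := (hasSum_integral_of_normal hcX hX1 hbX h01 h11 hS).tsum_eq
    have e2 := (hasSum_integral_of_normal hcZ hZ1 hbZ h01 h11 hS).tsum_eq
    have t1 : ∀ n, ∫ x in (0 : ℝ)..1, X n * deriv (phi1 n) x * sinHalf j x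
        = if n = j then -(κ * X j) else 0 := by
      intro n
      simp only [mul_assoc, intervalIntegral.integral_const_mul, deriv_phi1, neg_mul,
        intervalIntegral.integral_neg, isONFamily_sinHalf.ortho]
      split_ifs with hnj
      · subst hnj; rw [hκ]; ring
      · ring
    -- Biorthogonality replaces ∫ φ_{2,m} φ_{1,j} by -∫ ψ_{2,m} ψ_{1,j}.
    have t2 : ∀ m, ∫ x in (0 : ℝ)..1, Z m * deriv (phi2 a b s m) x * sinHalf j x
        = κ * (Z m * ∫ x in (0 : ℝ)..1, psi1 a b s j x * psi2 m x) := by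
      intro m
      obtain ⟨f'', hD, -⟩ := inDomain_phi2 a b s m
      have hb := biorthogonal a b s j m
      rw [mode1] at hb
      simp only [mul_assoc, intervalIntegral.integral_const_mul]
      rw [hD.y_h1.integral_sinHalf hD.y_bc_one, ← hκ]
      simp only [mul_comm (psi1 a b s j _)]
      linear_combination (-(Z m * κ)) * hb
    simp only [t1, tsum_ite_eq] at e1
    simp only [t2, tsum_mul_left] at e2
    -- Parseval sums the second series to κ ∫ wψ_{1,j}. This removes the ψ-part of the coefficient
    -- in the first series and leaves -κ ∫ yφ_{1,j}, the sine coefficient of y'.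
    have e3 := (isONFamily_psi2.hasSum_mul isTotalFamily_psi2 h.w_h1.memLp_self
      (memLp_psi1 a b s j)).tsum_eq
    change ∑' i, Z i * _ = _ at e3
    rw [e3] at e2
    have e4 := h.y_h1.integral_sinHalf h.y_bc_one j
    simp only [sub_mul, add_mul]
    rw [intervalIntegral.integral_sub, intervalIntegral.integral_add, ← e1, ← e2, e4, ← hκ]
    · rw [hX, mode1]; ring
    · exact (memLp_of_continuousOn hg1c).intervalIntegrable_mul (isONFamily_sinHalf.memLp j)
    · exact (memLp_of_continuousOn hg2c).intervalIntegrable_mul (isONFamily_sinHalf.memLp j)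
    · exact h.y_h1.memLp.intervalIntegrable_mul (isONFamily_sinHalf.memLp j)
    · have := hgm.intervalIntegrable_mul (isONFamily_sinHalf.memLp j)
      simpa only [Pi.add_apply, add_mul] using this
  have hae := isTotalFamily_sinHalf _ (h.y_h1.memLp.sub hgm) key
  have hae' : y' =ᵐ[unitMeasure] fun x => g1 x + g2 x := by
    filter_upwards [hae] with x hx
    exact sub_eq_zero.1 hx
  -- Continuity of both sides upgrades equality almost everywhere to every point, endpoints
  -- included, as a pointwise measurement requires.
  exact Measure.eqOn_Icc_of_ae_eq volume zero_ne_one hae' h.y_h2.continuousOn (hg1c.add hg2c)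

/-- The expansion of y' is integrated from ξ to 1, where y and all the modes vanish. -/
theorem InDomain.expansion {s : ℝ} {y y' y'' w w' w'' : ℝ → ℝ}
    (h : InDomain s y y' y'' w w' w'') {a b : ℝ} {N₀ M₀ : ℕ} (hΔ₁ : ∀ n ∈ Delta1 a b, n ≤ N₀)
    (hΔ₂ : ∀ m ∈ Delta2 a b, m ≤ M₀) :
    ∀ x ∈ Icc (0 : ℝ) 1, y x = ∑' n, mode1 a b s y w n * phi1 n x
      + ∑' m, mode2 w m * phi2 a b s m x := by
  intro ξ hξ
  obtain ⟨K, hK, hphi2⟩ := deriv_phi2_bound (s := s) hΔ₂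
  have hexp := h.deriv_expansion hΔ₁ hΔ₂
  set X := mode1 a b s y w with hX
  set Z := mode2 w with hZ
  have hX1 := (summable_succ_mul_abs (h.summable_mode1 hΔ₁)).mul_left 8
  have hZ1 := (summable_abs_of_weighted h.summable_mode2).mul_right K
  have hbX : ∀ n, ∀ x ∈ Icc (0 : ℝ) 1, |X n * deriv (phi1 n) x| ≤ 8 * (((n : ℝ) + 1) * |X n|) := by
    intro n x _
    rw [abs_mul]
    have := mul_le_mul_of_nonneg_left (abs_deriv_phi1_le n x) (abs_nonneg (X n))
    linarith
  have hbZ : ∀ m, ∀ x ∈ Icc (0 : ℝ) 1, |Z m * deriv (phi2 a b s m) x| ≤ |Z m| * K := by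
    intro m x hx
    rw [abs_mul]
    exact mul_le_mul_of_nonneg_left (hphi2 m x hx) (abs_nonneg _)
  have hcX : ∀ n, Continuous fun x => X n * deriv (phi1 n) x := fun n =>
    (continuous_deriv_phi1 n).const_mul _
  have hcZ : ∀ m, Continuous fun x => Z m * deriv (phi2 a b s m) x := fun m =>
    (continuous_deriv_phi2 a b s m).const_mul _
  have h11 : (1 : ℝ) ∈ Icc (0 : ℝ) 1 := right_mem_Icc.2 zero_le_one
  have e1 := (hasSum_integral_of_normal hcX hX1 hbX hξ h11 continuous_one).tsum_eq
  have e2 := (hasSum_integral_of_normal hcZ hZ1 hbZ hξ h11 continuous_one).tsum_eq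
  simp only [mul_one, Pi.one_apply, intervalIntegral.integral_const_mul] at e1 e2
  have i1 : ∀ n, ∫ x in ξ..1, deriv (phi1 n) x = -phi1 n ξ := fun n => by
    rw [intervalIntegral.integral_deriv_eq_sub (fun x _ => (hasDerivAt_phi1 n x).differentiableAt)
      ((continuous_deriv_phi1 n).intervalIntegrable _ _), phi1_one, zero_sub]
  have i2 : ∀ m, ∫ x in ξ..1, deriv (phi2 a b s m) x = -phi2 a b s m ξ := fun m => by
    obtain ⟨_, _, _, _, _, h1, _⟩ := phi2_properties a b s m
    rw [intervalIntegral.integral_deriv_eq_sub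
      (fun x _ => (hasDerivAt_phi2 a b s m x).differentiableAt)
      ((continuous_deriv_phi2 a b s m).intervalIntegrable _ _), h1, zero_sub]
  simp only [i1, i2, mul_neg, tsum_neg] at e1 e2
  have hs : ∀ x ∈ Icc (0 : ℝ) 1, uIcc (0 : ℝ) x ⊆ uIcc 0 1 := fun x hx => by
    rw [uIcc_of_le hx.1, uIcc_of_le zero_le_one]; exact Icc_subset_Icc_right hx.2
  have hy : y ξ = -∫ x in ξ..1, y' x := by
    have h1 := h.y_h1.eq_integral 1 h11
    have h2 := h.y_h1.eq_integral ξ hξ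
    rw [← intervalIntegral.integral_interval_sub_left h.y_h1.intervalIntegrable
      (h.y_h1.intervalIntegrable.mono_set (hs ξ hξ))]
    rw [h.y_bc_one] at h1
    linarith
  have hint : ∫ x in ξ..1, y' x = (∫ x in ξ..1, ∑' n, X n * deriv (phi1 n) x)
      + ∫ x in ξ..1, ∑' m, Z m * deriv (phi2 a b s m) x := by
    have hsub : uIcc ξ 1 ⊆ Icc (0 : ℝ) 1 := uIcc_subset_Icc hξ h11
    rw [← intervalIntegral.integral_add
      ((continuousOn_tsum (fun n => (hcX n).continuousOn) hX1 hbX).mono hsub).intervalIntegrable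
      ((continuousOn_tsum (fun n => (hcZ n).continuousOn) hZ1 hbZ).mono hsub).intervalIntegrable]
    exact intervalIntegral.integral_congr fun x hx => hexp x (hsub hx)
  rw [hy, hint, ← e1, ← e2]
  ring

theorem exists_c1_bound (ms : Measurement) (ξ : ℝ) :
    ∀ n : ℕ, |c1 ms ξ n| ≤ 8 * ((n : ℝ) + 1) := by
  intro n
  cases ms with
  | dirichlet =>
    exact (abs_phi1_le n ξ).trans (by linarith [(Nat.cast_nonneg n : (0 : ℝ) ≤ n)])
  | neumann => exact abs_deriv_phi1_le n ξ

theorem exists_c2_bound (ms : Measurement) {a b : ℝ} (s : ℝ) {ξ : ℝ} (hξ : ξ ∈ Icc (0 : ℝ) 1)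
    {M₀ : ℕ} (hΔ₂ : ∀ m ∈ Delta2 a b, m ≤ M₀) :
    ∃ K : ℝ, 0 < K ∧ ∀ m : ℕ, |c2 ms a b s ξ m| ≤ K := by
  obtain ⟨K, hK, h⟩ := deriv_phi2_bound (s := s) hΔ₂
  refine ⟨K, hK, fun m => ?_⟩
  cases ms with
  | dirichlet => exact phi2_bound_of_deriv (h m) ξ hξ
  | neumann => exact h m ξ hξ

theorem InDomain.output_expansion {s : ℝ} {y y' y'' w w' w'' : ℝ → ℝ}
    (h : InDomain s y y' y'' w w' w'') {a b : ℝ} {N₀ M₀ : ℕ} (hΔ₁ : ∀ n ∈ Delta1 a b, n ≤ N₀)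
    (hΔ₂ : ∀ m ∈ Delta2 a b, m ≤ M₀) (ms : Measurement) {ξ : ℝ} (hξ : ξ ∈ Icc (0 : ℝ) 1) :
    (match ms with | .dirichlet => y ξ | .neumann => y' ξ)
      = ∑' n, c1 ms ξ n * mode1 a b s y w n + ∑' m, c2 ms a b s ξ m * mode2 w m := by
  cases ms with
  | dirichlet =>
    simp only [h.expansion hΔ₁ hΔ₂ ξ hξ, c1, c2, mul_comm]
  | neumann =>
    simp only [h.deriv_expansion hΔ₁ hΔ₂ ξ hξ, c1, c2, mul_comm]

/-! ## A Lyapunov form for a Hurwitz matrix -/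

section Lyapunov

variable {ι : Type} [Fintype ι]

/-- The real part of the Hermitian inner product on `ι → ℂ`, as a real bilinear form. -/
noncomputable def reInner (ι : Type) [Fintype ι] : (ι → ℂ) →ₗ[ℝ] (ι → ℂ) →ₗ[ℝ] ℝ :=
  LinearMap.mk₂ ℝ (fun u v => ∑ i, ((u i).re * (v i).re + (u i).im * (v i).im))
    (fun u u' v => by
      rw [← Finset.sum_add_distrib]
      refine Finset.sum_congr rfl fun i _ => ?_
      simp only [Pi.add_apply, Complex.add_re, Complex.add_im]; ring)
    (fun c u v => by
      rw [smul_eq_mul, Finset.mul_sum]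
      refine Finset.sum_congr rfl fun i _ => ?_
      simp only [Pi.smul_apply, Complex.smul_re, Complex.smul_im, smul_eq_mul]; ring)
    (fun u v v' => by
      rw [← Finset.sum_add_distrib]
      refine Finset.sum_congr rfl fun i _ => ?_
      simp only [Pi.add_apply, Complex.add_re, Complex.add_im]; ring)
    (fun c u v => by
      rw [smul_eq_mul, Finset.mul_sum]
      refine Finset.sum_congr rfl fun i _ => ?_
      simp only [Pi.smul_apply, Complex.smul_re, Complex.smul_im, smul_eq_mul]; ring)

theorem reInner_apply (u v : ι → ℂ) :
    reInner ι u v = ∑ i, ((u i).re * (v i).re + (u i).im * (v i).im) := rfl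

theorem reInner_comm (u v : ι → ℂ) : reInner ι u v = reInner ι v u := by
  rw [reInner_apply, reInner_apply]
  exact Finset.sum_congr rfl fun i _ => by ring

theorem reInner_self_nonneg (u : ι → ℂ) : 0 ≤ reInner ι u u := by
  rw [reInner_apply]
  exact Finset.sum_nonneg fun i _ => add_nonneg (mul_self_nonneg _) (mul_self_nonneg _)

/-- Young's inequality for a symmetric nonnegative bilinear form. -/
theorem two_mul_form_le {E : Type*} [AddCommGroup E] [Module ℝ E] (P : E →ₗ[ℝ] E →ₗ[ℝ] ℝ)
    (hsymm : ∀ x y, P x y = P y x) (hpos : ∀ x, 0 ≤ P x x) {η : ℝ} (hη : 0 < η) (x y : E) :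
    2 * P x y ≤ η * P x x + η⁻¹ * P y y := by
  have h := hpos (η • x - y)
  simp only [map_sub, map_smul, LinearMap.sub_apply, LinearMap.smul_apply, smul_eq_mul] at h
  rw [hsymm y x] at h
  have h2 := mul_nonneg (inv_nonneg.2 hη.le) h
  have h3 : η⁻¹ * η = 1 := inv_mul_cancel₀ hη.ne'
  have e : η⁻¹ * (η * (η * P x x) - η * P x y - (η * P x y - P y y))
      = (η⁻¹ * η) * (η * P x x) - 2 * (η⁻¹ * η) * P x y + η⁻¹ * P y y := by ring
  rw [h3] at e
  linarith

theorem reInner_mul_self (z : ℂ) (q : ι → ℂ) :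
    reInner ι q (z • q) = z.re * reInner ι q q := by
  rw [reInner_apply, reInner_apply, Finset.mul_sum]
  refine Finset.sum_congr rfl fun i _ => ?_
  simp only [Pi.smul_apply, smul_eq_mul, Complex.mul_re, Complex.mul_im]; ring

theorem exists_mulVec_bound (F : Matrix ι ι ℂ) :
    ∃ K : ℝ, 0 ≤ K ∧ ∀ x, reInner ι (F.mulVec x) (F.mulVec x) ≤ K * reInner ι x x := by
  have hN : ∀ x : ι → ℂ, reInner ι x x = ∑ i, ‖x i‖ ^ 2 := fun x => by
    rw [reInner_apply]
    refine Finset.sum_congr rfl fun i _ => ?_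
    rw [Complex.sq_norm, Complex.normSq_apply]
  refine ⟨∑ i, ∑ j, ‖F i j‖ ^ 2, by positivity, fun x => ?_⟩
  rw [hN, hN, Finset.sum_mul]
  refine Finset.sum_le_sum fun i _ => ?_
  calc ‖F.mulVec x i‖ ^ 2 ≤ (∑ j, ‖F i j‖ * ‖x j‖) ^ 2 := by
        gcongr
        refine (norm_sum_le _ _).trans (Finset.sum_le_sum fun j _ => ?_)
        rw [norm_mul]
    _ ≤ _ := Finset.sum_mul_sq_le_sq_mul_sq _ _ _

/-- The Lyapunov form is built one eigenvalue at a time, without Jordan form or matrix exponential.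
With Q_l the product of the factors F - z over the list, the defect is bounded by C|Q_l x|². For the
empty list Q = 1 and a large C suffices. A further z adds a multiple of |Q_l x|² to the form, which
pushes the defect to |(F - z)Q_l x|². -/
theorem exists_lyapunov_of_list [DecidableEq ι] (F : Matrix ι ι ℂ) {δ : ℝ} (l : List ℂ)
    (hl : ∀ z ∈ l, z.re < -δ) :
    ∃ P : (ι → ℂ) →ₗ[ℝ] (ι → ℂ) →ₗ[ℝ] ℝ, (∀ x y, P x y = P y x) ∧
      (∀ x, reInner ι x x ≤ P x x) ∧ ∃ C : ℝ, 0 ≤ C ∧ ∀ x,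
        2 * P x (F.mulVec x) + 2 * δ * P x x ≤ -reInner ι x x
          + C * reInner ι
            ((Polynomial.aeval F (l.map fun z => Polynomial.X - Polynomial.C z).prod).mulVec x)
            ((Polynomial.aeval F (l.map fun z => Polynomial.X - Polynomial.C z).prod).mulVec x) := by
  induction l with
  | nil =>
    obtain ⟨K, hK, h⟩ := exists_mulVec_bound F
    refine ⟨reInner ι, reInner_comm, fun _ => le_rfl, K + 2 * |δ| + 2, by positivity, fun x => ?_⟩
    have h1 := two_mul_form_le (reInner ι) reInner_comm reInner_self_nonneg one_pos x (F.mulVec x)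
    have h2 := h x
    have h3 : δ * reInner ι x x ≤ |δ| * reInner ι x x :=
      mul_le_mul_of_nonneg_right (le_abs_self _) (reInner_self_nonneg x)
    simp only [List.map_nil, List.prod_nil, map_one, Matrix.one_mulVec]
    rw [inv_one] at h1
    linarith
  | cons z l ih =>
    obtain ⟨P, hs, hp, C, hC, h⟩ := ih fun z hz => hl z (List.mem_cons_of_mem _ hz)
    set p := (l.map fun z => Polynomial.X - Polynomial.C z).prod
    set Q := Polynomial.aeval F p with hQ
    set η := -(z.re + δ) with hη
    have hη0 : 0 < η := by have := hl z List.mem_cons_self; linarith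
    have hcomm : ∀ x, Q.mulVec (F.mulVec x) = F.mulVec (Q.mulVec x) := fun x => by
      have : Q * F = F * Q := by
        have h1 : Polynomial.aeval F (p * Polynomial.X) = Q * F := by simp [hQ]
        have h2 : Polynomial.aeval F (Polynomial.X * p) = F * Q := by simp [hQ]
        rw [← h1, ← h2, mul_comm]
      rw [Matrix.mulVec_mulVec, Matrix.mulVec_mulVec, this]
    have hQ' : ∀ x, (Polynomial.aeval F
        ((z :: l).map fun z => Polynomial.X - Polynomial.C z).prod).mulVec x
        = F.mulVec (Q.mulVec x) - z • Q.mulVec x := fun x => by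
      change (Polynomial.aeval F ((Polynomial.X - Polynomial.C z) * p)).mulVec x = _
      rw [map_mul, map_sub, Polynomial.aeval_X, Polynomial.aeval_C, ← Matrix.mulVec_mulVec,
        Matrix.sub_mulVec, Algebra.algebraMap_eq_smul_one, Matrix.smul_mulVec, Matrix.one_mulVec]
    let q : (ι → ℂ) →ₗ[ℝ] (ι → ℂ) := Q.mulVecLin.restrictScalars ℝ
    have hq : ∀ x, q x = Q.mulVec x := fun x => rfl
    -- For v = Qx and r = (F - z)v, the new term contributes (C/η)(2⟨v, r⟩ - 2η|v|²) ≤ -C|v|² +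
    -- (C/η²)|r|², which cancels the previous defect C|v|².
    refine ⟨P + (C / η) • (reInner ι).compl₁₂ q q, ?_, ?_, C / η / η, by positivity, ?_⟩
    · intro x y
      simp [hs x y, reInner_comm (q x) (q y)]
    · intro x
      have := reInner_self_nonneg (q x)
      have h1 : 0 ≤ C / η * reInner ι (q x) (q x) := by positivity
      simp only [LinearMap.add_apply, LinearMap.smul_apply, LinearMap.compl₁₂_apply, smul_eq_mul]
      linarith [hp x]
    · intro x
      simp only [LinearMap.add_apply, LinearMap.smul_apply, LinearMap.compl₁₂_apply, smul_eq_mul,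
        hQ', hq, hcomm]
      set v := Q.mulVec x
      set r := F.mulVec v - z • v with hr
      have e : F.mulVec v = r + z • v := by rw [hr]; abel
      rw [e, map_add, reInner_mul_self]
      have h1 := two_mul_form_le (reInner ι) reInner_comm reInner_self_nonneg hη0 v r
      have h2 : C / η * (2 * reInner ι v r)
          ≤ C / η * (η * reInner ι v v + η⁻¹ * reInner ι r r) :=
        mul_le_mul_of_nonneg_left h1 (by positivity)
      have h3 : C / η * (η * reInner ι v v + η⁻¹ * reInner ι r r)
          = C * reInner ι v v + C / η / η * reInner ι r r := by field_simp
      have h4 : C / η * (2 * (z.re * reInner ι v v) + 2 * δ * reInner ι v v)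
          = -(2 * C * reInner ι v v) := by
        rw [show 2 * (z.re * reInner ι v v) + 2 * δ * reInner ι v v
          = -(2 * η * reInner ι v v) by rw [hη]; ring]
        field_simp
      have h5 := h x
      linarith

/-- For the list of all roots of the characteristic polynomial, Cayley–Hamilton makes the defect
vanish; the complex form is then restricted to real vectors. -/
theorem exists_lyapunov [DecidableEq ι] {F : Matrix ι ι ℝ} {δ : ℝ} (hF : HurwitzWithRate F δ) :
    ∃ B : (ι → ℝ) →ₗ[ℝ] (ι → ℝ) →ₗ[ℝ] ℝ, (∀ x y, B x y = B y x) ∧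
      (∀ x, ∑ i, x i ^ 2 ≤ B x x) ∧
      ∀ x, 2 * B x (F.mulVec x) + 2 * δ * B x x ≤ -∑ i, x i ^ 2 := by
  set G : Matrix ι ι ℂ := F.map (fun x : ℝ => (x : ℂ)) with hG
  have hsplit := IsAlgClosed.splits G.charpoly
  have hprod := hsplit.eq_prod_roots_of_monic (Matrix.charpoly_monic G)
  obtain ⟨P, hs, hp, C, hC, h⟩ := exists_lyapunov_of_list G (δ := δ) G.charpoly.roots.toList
    fun z hz => hF z (Matrix.mem_spectrum_iff_isRoot_charpoly.2
      (Polynomial.isRoot_of_mem_roots (Multiset.mem_toList.1 hz)))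
  have hzero : Polynomial.aeval G
      (G.charpoly.roots.toList.map fun z => Polynomial.X - Polynomial.C z).prod = 0 := by
    have h1 : (G.charpoly.roots.toList.map fun z => Polynomial.X - Polynomial.C z).prod
        = G.charpoly := by
      conv_rhs => rw [hprod]
      rw [← Multiset.prod_coe, ← Multiset.map_coe, Multiset.coe_toList]
    rw [h1, Matrix.aeval_self_charpoly]
  let c : (ι → ℝ) →ₗ[ℝ] (ι → ℂ) := Complex.ofRealCLM.toLinearMap.compLeft ι
  have hc : ∀ x i, c x i = (x i : ℂ) := fun _ _ => rfl
  have hN : ∀ x, reInner ι (c x) (c x) = ∑ i, x i ^ 2 := fun x => by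
    rw [reInner_apply]
    exact Finset.sum_congr rfl fun i _ => by simp [hc, sq]
  have hFc : ∀ x, c (F.mulVec x) = G.mulVec (c x) := fun x => by
    ext i
    simp [hc, Matrix.mulVec, dotProduct, hG]
  refine ⟨P.compl₁₂ c c, fun x y => by simp [hs (c x)], fun x => ?_, fun x => ?_⟩
  · rw [LinearMap.compl₁₂_apply, ← hN]; exact hp _
  · have h1 := h (c x)
    rw [hzero, Matrix.zero_mulVec, map_zero, mul_zero, add_zero, hN] at h1
    simp only [LinearMap.compl₁₂_apply, hFc]
    exact h1

theorem hasDerivWithinAt_form {B : (ι → ℝ) →ₗ[ℝ] (ι → ℝ) →ₗ[ℝ] ℝ} (hB : ∀ x y, B x y = B y x)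
    {X : ℝ → ι → ℝ} {X' : ι → ℝ} {s : Set ℝ} {t : ℝ} (hX : HasDerivWithinAt X X' s t) :
    HasDerivWithinAt (fun t => B (X t) (X t)) (2 * B (X t) X') s t := by
  let Bc : (ι → ℝ) →L[ℝ] (ι → ℝ) →L[ℝ] ℝ :=
    LinearMap.toContinuousLinearMap
      ((LinearMap.toContinuousLinearMap : ((ι → ℝ) →ₗ[ℝ] ℝ) ≃ₗ[ℝ] _).toLinearMap ∘ₗ B)
  have h1 : HasDerivWithinAt (fun t => Bc (X t)) (Bc X') s t :=
    Bc.hasFDerivAt.comp_hasDerivWithinAt t hX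
  have h2 := h1.clm_apply hX
  have e : 2 * B (X t) X' = Bc X' (X t) + Bc (X t) X' := by
    change _ = B X' (X t) + B (X t) X'
    rw [hB X' (X t)]; ring
  rw [e]
  exact h2

theorem exists_form_bound (B : (ι → ℝ) →ₗ[ℝ] (ι → ℝ) →ₗ[ℝ] ℝ) :
    ∃ K : ℝ, 0 < K ∧ ∀ x, B x x ≤ K * ∑ i, x i ^ 2 := by
  let Bc : (ι → ℝ) →L[ℝ] (ι → ℝ) →L[ℝ] ℝ :=
    LinearMap.toContinuousLinearMap
      ((LinearMap.toContinuousLinearMap : ((ι → ℝ) →ₗ[ℝ] ℝ) ≃ₗ[ℝ] _).toLinearMap ∘ₗ B)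
  refine ⟨‖Bc‖ + 1, by positivity, fun x => ?_⟩
  have h1 : B x x ≤ ‖Bc‖ * ‖x‖ * ‖x‖ := (le_abs_self _).trans (Bc.le_opNorm₂ x x)
  have h2 : ‖x‖ ^ 2 ≤ ∑ i, x i ^ 2 := by
    have hS : 0 ≤ ∑ i, x i ^ 2 := Finset.sum_nonneg fun _ _ => sq_nonneg _
    rw [← Real.le_sqrt (norm_nonneg _) hS, pi_norm_le_iff_of_nonneg (Real.sqrt_nonneg _)]
    intro i
    rw [Real.norm_eq_abs]
    refine Real.abs_le_sqrt ?_
    exact Finset.single_le_sum (f := fun i => x i ^ 2) (fun i _ => sq_nonneg _)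
      (Finset.mem_univ i)
  nlinarith [norm_nonneg Bc, sq_nonneg ‖x‖, mul_le_mul_of_nonneg_left h2 (norm_nonneg Bc)]

theorem hasDerivWithinAt_exp_mul {f : ℝ → ℝ} {f' c : ℝ} {s : Set ℝ} {t : ℝ}
    (hf : HasDerivWithinAt f f' s t) :
    HasDerivWithinAt (fun t => Real.exp (c * t) * f t)
      (Real.exp (c * t) * (f' + c * f t)) s t := by
  have h1 : HasDerivWithinAt (fun t : ℝ => Real.exp (c * t)) (Real.exp (c * t) * c) s t := by
    have := ((hasDerivAt_id t).const_mul c).exp.hasDerivWithinAt (s := s)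
    simpa using this
  convert! h1.mul hf using 1
  ring

/-- Input-to-state stability in weighted `L²` norms of a linear system with a Hurwitz matrix. -/
theorem exists_L2_gain [DecidableEq ι] {F : Matrix ι ι ℝ} {δ : ℝ} (hF : HurwitzWithRate F δ) :
    ∃ C : ℝ, 0 < C ∧ ∀ X g : ℝ → ι → ℝ,
      (∀ t, 0 ≤ t → HasDerivWithinAt X (F.mulVec (X t) + g t) (Ici 0) t) →
      ∀ T, 0 ≤ T → ∀ D : ℝ → ℝ, IntegrableOn D (Icc 0 T) →
        (∀ t ∈ Icc 0 T, Real.exp (2 * δ * t) * ∑ i, g t i ^ 2 ≤ D t) →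
        Real.exp (2 * δ * T) * ∑ i, X T i ^ 2 ≤ C * (∑ i, X 0 i ^ 2 + ∫ t in (0 : ℝ)..T, D t) ∧
        ∫ t in (0 : ℝ)..T, Real.exp (2 * δ * t) * ∑ i, X t i ^ 2
          ≤ C * (∑ i, X 0 i ^ 2 + ∫ t in (0 : ℝ)..T, D t) := by
  obtain ⟨B, hs, hp, hB⟩ := exists_lyapunov hF
  obtain ⟨K, hK, hBK⟩ := exists_form_bound B
  have hBpos : ∀ x, 0 ≤ B x x := fun x =>
    (Finset.sum_nonneg fun _ _ => sq_nonneg _).trans (hp x)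
  -- The integrable majorant `D` stands in for the forcing, whose measurability is never assumed.
  refine ⟨2 * K + 4 * K ^ 2, by positivity, fun X g hX T hT D hD hg => ?_⟩
  have hXc : ContinuousOn X (Icc 0 T) := fun t ht =>
    ((hX t ht.1).continuousWithinAt).mono Icc_subset_Ici_self
  set N : ℝ → ℝ := fun t => Real.exp (2 * δ * t) * ∑ i, X t i ^ 2 with hN
  have hNc : ContinuousOn N (Icc 0 T) := by
    refine ContinuousOn.mul (by fun_prop) (continuousOn_finsetSum _ fun i _ => ?_)
    exact ((continuousOn_pi.1 hXc) i).pow 2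
  have hVd : ∀ t, 0 ≤ t → HasDerivWithinAt (fun t => Real.exp (2 * δ * t) * B (X t) (X t))
      (Real.exp (2 * δ * t) * (2 * B (X t) (F.mulVec (X t) + g t) + 2 * δ * B (X t) (X t)))
      (Ici 0) t := fun t ht => hasDerivWithinAt_exp_mul (hasDerivWithinAt_form hs (hX t ht))
  have key := intervalIntegral.sub_le_integral_of_hasDeriv_right_of_le (a := 0) (b := T)
    (g := fun t => Real.exp (2 * δ * t) * B (X t) (X t))
    (φ := fun t => 2 * K ^ 2 * D t - 1 / 2 * N t) hT
    (fun t ht => ((hVd t ht.1).continuousWithinAt).mono Icc_subset_Ici_self)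
    (fun t ht => (hVd t ht.1.le).mono fun x hx => ht.1.le.trans (le_of_lt hx))
    (Integrable.sub' (Integrable.const_mul hD (2 * K ^ 2))
      (Integrable.const_mul hNc.integrableOn_Icc (1 / 2)))
    (fun t ht => by
      -- Since B(X, X) ≤ K|X|², this choice of η spends half of the dissipation -|X|² on the cross
      -- term.
      have h1 := two_mul_form_le B hs hBpos (η := (2 * K)⁻¹) (by positivity) (X t) (g t)
      rw [inv_inv] at h1
      have h2 : (2 * K)⁻¹ * B (X t) (X t) ≤ 1 / 2 * ∑ i, X t i ^ 2 := by
        calc _ ≤ (2 * K)⁻¹ * (K * ∑ i, X t i ^ 2) := by gcongr; exact hBK _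
          _ = _ := by field_simp
      have h3 : 2 * K * B (g t) (g t) ≤ 2 * K * (K * ∑ i, g t i ^ 2) := by gcongr; exact hBK _
      have h4 := hB (X t)
      have h5 : 2 * B (X t) (F.mulVec (X t) + g t) + 2 * δ * B (X t) (X t)
          ≤ -(1 / 2 * ∑ i, X t i ^ 2) + 2 * K ^ 2 * ∑ i, g t i ^ 2 := by
        rw [map_add]; linarith
      have h6 := mul_le_mul_of_nonneg_left h5 (Real.exp_pos (2 * δ * t)).le
      have h7 := mul_le_mul_of_nonneg_left (hg t (Ioo_subset_Icc_self ht))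
        (show 0 ≤ 2 * K ^ 2 by positivity)
      refine h6.trans ?_
      rw [hN]
      linarith)
  have hDi : IntervalIntegrable D volume 0 T :=
    (intervalIntegrable_iff_integrableOn_Icc_of_le hT).2 hD
  have hNi : IntervalIntegrable N volume 0 T :=
    (intervalIntegrable_iff_integrableOn_Icc_of_le hT).2 hNc.integrableOn_Icc
  rw [intervalIntegral.integral_sub (hDi.const_mul _) (hNi.const_mul _),
    intervalIntegral.integral_const_mul,
    intervalIntegral.integral_const_mul] at key
  simp only [mul_zero, Real.exp_zero, one_mul] at key
  have hV0 := hBK (X 0)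
  have hVT : N T ≤ Real.exp (2 * δ * T) * B (X T) (X T) :=
    mul_le_mul_of_nonneg_left (hp _) (Real.exp_pos _).le
  have hNT : 0 ≤ N T := by positivity
  have hNI : 0 ≤ ∫ t in (0 : ℝ)..T, N t :=
    intervalIntegral.integral_nonneg hT fun t _ => by positivity
  have hDI : 0 ≤ ∫ t in (0 : ℝ)..T, D t :=
    intervalIntegral.integral_nonneg hT fun t ht => le_trans (by positivity) (hg t ht)
  have hX0 : 0 ≤ ∑ i, X 0 i ^ 2 := Finset.sum_nonneg fun _ _ => sq_nonneg _
  constructor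
  · change N T ≤ _
    nlinarith [mul_nonneg (sq_nonneg K) hX0, mul_nonneg hK.le hDI, mul_nonneg hK.le hX0,
      mul_nonneg (sq_nonneg K) hDI]
  · nlinarith [mul_nonneg (sq_nonneg K) hX0, mul_nonneg hK.le hDI, mul_nonneg hK.le hX0,
      mul_nonneg (sq_nonneg K) hDI]

end Lyapunov

/-! ## Infinite families of scalar modes -/

/-- Integrability of the pointwise sum is obtained in [0, ∞]. Where the series diverges, both the
real `tsum` and the `toReal` of the infinite sum are 0, so the identification needs no exceptional
set. -/
theorem integrableOn_tsum_of_nonneg {f : ℕ → ℝ → ℝ} {s : Set ℝ} (hs : MeasurableSet s)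
    (hf : ∀ k, IntegrableOn (f k) s) (h0 : ∀ k, ∀ t ∈ s, 0 ≤ f k t)
    (hsum : Summable fun k => ∫ t in s, f k t) :
    IntegrableOn (fun t => ∑' k, f k t) s ∧ ∫ t in s, ∑' k, f k t = ∑' k, ∫ t in s, f k t := by
  have hnorm : ∀ k, ∫ t in s, ‖f k t‖ = ∫ t in s, f k t := fun k =>
    setIntegral_congr_fun hs fun t ht => Real.norm_of_nonneg (h0 k t ht)
  have hsum' : Summable fun k => ∫ t in s, ‖f k t‖ := by simpa only [hnorm] using hsum
  refine ⟨?_, (integral_tsum_of_summable_integral_norm hf hsum').symm⟩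
  have hmeas : AEMeasurable (fun t => ∑' k, ENNReal.ofReal (f k t)) (volume.restrict s) :=
    AEMeasurable.tsum fun k => (hf k).aemeasurable.ennreal_ofReal
  have hlin : ∫⁻ t in s, ∑' k, ENNReal.ofReal (f k t) ≠ ⊤ := by
    rw [lintegral_tsum fun k => (hf k).aemeasurable.ennreal_ofReal]
    have e : ∀ k, ∫⁻ t in s, ENNReal.ofReal (f k t) = ENNReal.ofReal (∫ t in s, f k t) := fun k =>
      (ofReal_integral_eq_lintegral_ofReal (hf k)
        ((ae_restrict_iff' hs).2 (Eventually.of_forall (h0 k)))).symm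
    simp only [e]
    rw [← ENNReal.ofReal_tsum_of_nonneg (fun k => setIntegral_nonneg hs (h0 k)) hsum]
    exact ENNReal.ofReal_ne_top
  refine (integrable_toReal_of_lintegral_ne_top hmeas hlin).congr ?_
  refine (ae_restrict_iff' hs).2 (Eventually.of_forall fun t ht => ?_)
  change (∑' k, ENNReal.ofReal (f k t)).toReal = ∑' k, f k t
  rw [ENNReal.tsum_toReal_eq fun k => ENNReal.ofReal_ne_top]
  exact tsum_congr fun k => ENNReal.toReal_ofReal (h0 k t ht)

/-- Differentiating exp(2δt)σx² cancels δ and leaves -2(σx)² + 2σx(αu + βv). Weighting x² by σ makes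
the dissipation (σx)², so Young's inequality leaves an input gain α² + β² free of σ. -/
theorem scalar_mode_estimate {σ δ α β : ℝ} {x u v : ℝ → ℝ}
    (hx : ∀ t, 0 ≤ t →
      HasDerivWithinAt x ((-σ - δ) * x t + α * u t + β * v t) (Ici 0) t)
    (hu : ContinuousOn u (Ici 0)) (hv : ContinuousOn v (Ici 0)) {T : ℝ} (hT : 0 ≤ T) :
    Real.exp (2 * δ * T) * (σ * x T ^ 2)
      + ∫ t in Icc 0 T, Real.exp (2 * δ * t) * (σ * x t) ^ 2
      ≤ σ * x 0 ^ 2 + (α ^ 2 + β ^ 2)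
        * ∫ t in (0 : ℝ)..T, Real.exp (2 * δ * t) * (u t ^ 2 + v t ^ 2) := by
  have hxc : ContinuousOn x (Icc 0 T) := fun t ht =>
    ((hx t ht.1).continuousWithinAt).mono Icc_subset_Ici_self
  have huc : ContinuousOn u (Icc 0 T) := hu.mono Icc_subset_Ici_self
  have hvc : ContinuousOn v (Icc 0 T) := hv.mono Icc_subset_Ici_self
  have hd : ∀ t, 0 ≤ t → HasDerivWithinAt (fun t => Real.exp (2 * δ * t) * (σ * x t ^ 2))
      (Real.exp (2 * δ * t) * (σ * (2 * x t * ((-σ - δ) * x t + α * u t + β * v t))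
        + 2 * δ * (σ * x t ^ 2))) (Ici 0) t := fun t ht => by
    refine hasDerivWithinAt_exp_mul ?_
    have := ((hx t ht).pow 2).const_mul σ
    convert! this using 1
    norm_num
  have c1 : ContinuousOn (fun t => Real.exp (2 * δ * t) * (σ * x t) ^ 2) (Icc 0 T) :=
    ContinuousOn.mul (by fun_prop) ((hxc.const_mul σ).pow 2)
  have c2 : ContinuousOn (fun t => Real.exp (2 * δ * t) * (u t ^ 2 + v t ^ 2)) (Icc 0 T) :=
    ContinuousOn.mul (by fun_prop) ((huc.pow 2).add (hvc.pow 2))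
  have key := intervalIntegral.sub_le_integral_of_hasDeriv_right_of_le (a := 0) (b := T)
    (g := fun t => Real.exp (2 * δ * t) * (σ * x t ^ 2))
    (φ := fun t => (α ^ 2 + β ^ 2) * (Real.exp (2 * δ * t) * (u t ^ 2 + v t ^ 2))
      - Real.exp (2 * δ * t) * (σ * x t) ^ 2) hT
    (fun t ht => ((hd t ht.1).continuousWithinAt).mono Icc_subset_Ici_self)
    (fun t ht => (hd t ht.1.le).mono fun x hx => ht.1.le.trans (le_of_lt hx))
    (Integrable.sub' (Integrable.const_mul c2.integrableOn_Icc _) c1.integrableOn_Icc)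
    (fun t _ => by
      have h1 : σ * (2 * x t * ((-σ - δ) * x t + α * u t + β * v t)) + 2 * δ * (σ * x t ^ 2)
          ≤ -(σ * x t) ^ 2 + (α ^ 2 + β ^ 2) * (u t ^ 2 + v t ^ 2) := by
        nlinarith [sq_nonneg (σ * x t - (α * u t + β * v t)),
          sq_nonneg (α * v t - β * u t)]
      have h2 := mul_le_mul_of_nonneg_left h1 (Real.exp_pos (2 * δ * t)).le
      linarith)
  have i1 : IntervalIntegrable _ volume 0 T := (intervalIntegrable_iff_integrableOn_Icc_of_le hT).2 c1.integrableOn_Icc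
  have i2 : IntervalIntegrable _ volume 0 T := (intervalIntegrable_iff_integrableOn_Icc_of_le hT).2 c2.integrableOn_Icc
  rw [intervalIntegral.integral_sub (i2.const_mul _) i1,
    intervalIntegral.integral_const_mul] at key
  simp only [mul_zero, Real.exp_zero, one_mul] at key
  rw [integral_Icc_eq_integral_Ioc, ← intervalIntegral.integral_of_le hT]
  linarith

/-- Weighted `L²` estimate for a family of stable scalar modes driven by `u` and `v`. -/
theorem mode_family_estimate {σ α β : ℕ → ℝ} {δ A : ℝ} (hσ : ∀ k, 0 < σ k)
    (hα : Summable fun k => α k ^ 2 + β k ^ 2) (hA : ∑' k, (α k ^ 2 + β k ^ 2) ≤ A)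
    {x : ℕ → ℝ → ℝ} {u v : ℝ → ℝ}
    (hx : ∀ k, ∀ t, 0 ≤ t →
      HasDerivWithinAt (x k) ((-σ k - δ) * x k t + α k * u t + β k * v t) (Ici 0) t)
    (hu : ContinuousOn u (Ici 0)) (hv : ContinuousOn v (Ici 0))
    (h0 : Summable fun k => σ k * x k 0 ^ 2) {T : ℝ} (hT : 0 ≤ T) :
    IntegrableOn (fun t => Real.exp (2 * δ * t) * ∑' k, (σ k * x k t) ^ 2) (Icc 0 T) ∧
    Summable (fun k => σ k * x k T ^ 2) ∧
    Real.exp (2 * δ * T) * (∑' k, σ k * x k T ^ 2)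
      + ∫ t in (0 : ℝ)..T, Real.exp (2 * δ * t) * ∑' k, (σ k * x k t) ^ 2
      ≤ ∑' k, σ k * x k 0 ^ 2
        + A * ∫ t in (0 : ℝ)..T, Real.exp (2 * δ * t) * (u t ^ 2 + v t ^ 2) := by
  set J := ∫ t in (0 : ℝ)..T, Real.exp (2 * δ * t) * (u t ^ 2 + v t ^ 2) with hJ
  have hJ0 : 0 ≤ J := intervalIntegral.integral_nonneg hT fun t _ => by positivity
  set f : ℕ → ℝ → ℝ := fun k t => Real.exp (2 * δ * t) * (σ k * x k t) ^ 2 with hf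
  have hest : ∀ k, Real.exp (2 * δ * T) * (σ k * x k T ^ 2) + ∫ t in Icc 0 T, f k t
      ≤ σ k * x k 0 ^ 2 + (α k ^ 2 + β k ^ 2) * J := fun k =>
    scalar_mode_estimate (hx k) hu hv hT
  have hf0 : ∀ k, ∀ t ∈ Icc 0 T, 0 ≤ f k t := fun k t _ => by positivity
  have hfi : ∀ k, 0 ≤ ∫ t in Icc 0 T, f k t := fun k =>
    setIntegral_nonneg measurableSet_Icc (hf0 k)
  have hxT : ∀ k, 0 ≤ Real.exp (2 * δ * T) * (σ k * x k T ^ 2) := fun k => by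
    have := hσ k; positivity
  have hR := h0.add (hα.mul_right J)
  have s1 : Summable fun k => ∫ t in Icc 0 T, f k t :=
    Summable.of_nonneg_of_le hfi (fun k => by linarith [hest k, hxT k]) hR
  have s2 : Summable fun k => Real.exp (2 * δ * T) * (σ k * x k T ^ 2) :=
    Summable.of_nonneg_of_le hxT (fun k => by linarith [hest k, hfi k]) hR
  have hfint : ∀ k, IntegrableOn (f k) (Icc 0 T) := fun k => by
    refine ContinuousOn.integrableOn_Icc (ContinuousOn.mul (by fun_prop) ?_)
    have hxc : ContinuousOn (x k) (Icc 0 T) := fun t ht =>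
      ((hx k t ht.1).continuousWithinAt).mono Icc_subset_Ici_self
    exact (hxc.const_mul (σ k)).pow 2
  obtain ⟨g1, g2⟩ := integrableOn_tsum_of_nonneg measurableSet_Icc hfint hf0 s1
  have e : ∀ t, ∑' k, f k t = Real.exp (2 * δ * t) * ∑' k, (σ k * x k t) ^ 2 := fun t => by
    rw [← tsum_mul_left]
  simp only [e] at g1 g2
  refine ⟨g1, ?_, ?_⟩
  · exact (summable_mul_left_iff (Real.exp_pos _).ne').1 s2
  · rw [← tsum_mul_left, intervalIntegral.integral_of_le hT, ← integral_Icc_eq_integral_Ioc, g2,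
      ← s2.tsum_add s1]
    refine (Summable.tsum_le_tsum hest (s2.add s1) hR).trans ?_
    rw [h0.tsum_add (hα.mul_right J), tsum_mul_right]
    gcongr

/-! ## Small-gain estimate for the closed loop in modal coordinates -/

theorem sum_sq_smul {ι : Type} [Fintype ι] (c : ℝ) (L : ι → ℝ) :
    ∑ i, (c • L) i ^ 2 = (∑ i, L i ^ 2) * c ^ 2 := by
  rw [Finset.sum_mul]
  exact Finset.sum_congr rfl fun i _ => by rw [Pi.smul_apply, smul_eq_mul]; ring

theorem sq_dotProduct_le {ι : Type} [Fintype ι] (x y : ι → ℝ) :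
    (x ⬝ᵥ y) ^ 2 ≤ (∑ i, x i ^ 2) * ∑ i, y i ^ 2 :=
  Finset.sum_mul_sq_le_sq_mul_sq _ _ _

theorem add_sq_le_of_sq_le {x y X Y : ℝ} (hx : x ^ 2 ≤ X) (hy : y ^ 2 ≤ Y) :
    (x + y) ^ 2 ≤ 2 * X + 2 * Y := by
  linarith [add_sq_le (a := x) (b := y)]

/-- `IE` and `I` are the weighted time integrals of the error and of the augmented state, `D₁`, `D₂`
those of the high modes, and `Q` that of the majorant of (p + ζ)². Substituting one bound into the
next gives I ≤ data + H·Q, where Q contains I with factor 4·A·kk·ε₀; the smallness condition makes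
this at most I/2, which is absorbed because I is finite. -/
theorem small_gain_arith {A G₁ G₂ ℓ κ kk ε₀ ε NE NX T₁ T₂ P Q U₁ U₂ D₁ D₂ I IE eE eX : ℝ}
    (hA : 0 ≤ A) (hG₁ : 0 < G₁) (hG₂ : 0 < G₂) (hℓ : 0 ≤ ℓ) (hκ : 0 ≤ κ) (hkk : 0 < kk)
    (hε₀ : 0 < ε₀)
    (hsmall : 4 * (G₂ * (ℓ * (2 * κ * (G₁ * ℓ) + 2))) * A * kk * ε₀ ≤ 1 / 2)
    (hNE : 0 ≤ NE) (hNX : 0 ≤ NX) (hT₁ : 0 ≤ T₁) (hT₂ : 0 ≤ T₂) (hP : 0 ≤ P)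
    (hU₁ : 0 ≤ U₁) (hU₂ : 0 ≤ U₂) (hD₁ : 0 ≤ D₁) (hD₂ : 0 ≤ D₂) (hI0 : 0 ≤ I) (hεle : ε ≤ ε₀)
    (hQ : Q = 2 * P + 2 * ε * (D₁ + D₂))
    (e1 : eE ≤ G₁ * (NE + ℓ * Q)) (e2 : IE ≤ G₁ * (NE + ℓ * Q))
    (a1 : eX ≤ G₂ * (NX + ℓ * (2 * κ * IE + 2 * Q)))
    (a2 : I ≤ G₂ * (NX + ℓ * (2 * κ * IE + 2 * Q)))
    (d1 : U₁ + D₁ ≤ T₁ + A * (kk * I)) (d2 : U₂ + D₂ ≤ T₂ + A * (kk * I)) {H c q : ℝ}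
    (hH : H = G₂ * (ℓ * (2 * κ * (G₁ * ℓ) + 2)))
    (hc : c = 2 * (G₂ + G₂ * (ℓ * (2 * κ * G₁)) + 2 * H + 2 * H * ε₀))
    (hq : q = 2 + 2 * ε₀ * (1 + 2 * A * kk * c)) :
    eE + eX + (U₁ + U₂)
      ≤ (G₁ * (1 + ℓ * q) + c + (1 + 2 * A * kk * c)) * (NE + NX + T₁ + T₂ + P) := by
  have hH0 : 0 ≤ H := by rw [hH]; positivity
  rw [← hH] at hsmall
  set R := NE + NX + T₁ + T₂ + P with hR
  have hR0 : 0 ≤ R := by positivity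
  have hd : D₁ + D₂ ≤ T₁ + T₂ + 2 * A * kk * I := by linarith
  have hQle : Q ≤ 2 * P + 2 * ε₀ * (T₁ + T₂ + 2 * A * kk * I) := by
    rw [hQ]
    have h1 : ε * (D₁ + D₂) ≤ ε₀ * (T₁ + T₂ + 2 * A * kk * I) :=
      mul_le_mul hεle hd (by positivity) hε₀.le
    linarith
  have hbound : G₂ * (NX + ℓ * (2 * κ * IE + 2 * Q))
      ≤ G₂ * NX + G₂ * (ℓ * (2 * κ * G₁)) * NE + H * Q := by
    have h1 : ℓ * (2 * κ * IE) ≤ ℓ * (2 * κ * (G₁ * (NE + ℓ * Q))) := by gcongr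
    have h2 := mul_le_mul_of_nonneg_left h1 hG₂.le
    rw [hH]
    linarith
  have hHQ : H * Q ≤ 2 * H * P + 2 * H * ε₀ * (T₁ + T₂) + 1 / 2 * I := by
    have h1 := mul_le_mul_of_nonneg_left hQle hH0
    have h2 := mul_le_mul_of_nonneg_right hsmall hI0
    linarith
  have hcR : G₂ * NX + G₂ * (ℓ * (2 * κ * G₁)) * NE + (2 * H * P + 2 * H * ε₀ * (T₁ + T₂))
      ≤ 1 / 2 * c * R := by
    have m1 : 0 ≤ G₂ * (ℓ * (2 * κ * G₁)) := by positivity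
    have m2 : 0 ≤ H * ε₀ := by positivity
    have e : 1 / 2 * c * R = G₂ * R + G₂ * (ℓ * (2 * κ * G₁)) * R + 2 * (H * R)
        + 2 * (H * ε₀ * R) := by rw [hc]; ring
    have n1 : G₂ * NX ≤ G₂ * R := mul_le_mul_of_nonneg_left (by linarith) hG₂.le
    have n2 := mul_le_mul_of_nonneg_left (show NE ≤ R by linarith) m1
    have n3 := mul_le_mul_of_nonneg_left (show P ≤ R by linarith) hH0
    have n4 := mul_le_mul_of_nonneg_left (show T₁ + T₂ ≤ R by linarith) m2
    linarith
  have hI : I ≤ c * R := by linarith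
  have hAkk : 0 ≤ 2 * A * kk := by positivity
  have hAI := mul_le_mul_of_nonneg_left hI hAkk
  have hQR : Q ≤ q * R := by
    have h1 : T₁ + T₂ + 2 * A * kk * I ≤ (1 + 2 * A * kk * c) * R := by linarith
    have h2 := mul_le_mul_of_nonneg_left h1 hε₀.le
    have e : q * R = 2 * R + 2 * (ε₀ * ((1 + 2 * A * kk * c) * R)) := by rw [hq]; ring
    linarith
  have b1 : eE ≤ G₁ * (1 + ℓ * q) * R := by
    have h1 := mul_le_mul_of_nonneg_left hQR hℓ
    have h2 : NE + ℓ * Q ≤ (1 + ℓ * q) * R := by linarith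
    have h3 := mul_le_mul_of_nonneg_left h2 hG₁.le
    linarith
  have b2 : eX ≤ c * R := by linarith
  have b3 : U₁ + U₂ ≤ (1 + 2 * A * kk * c) * R := by linarith
  linarith

set_option maxHeartbeats 1000000 in
/-- A finite-dimensional observer/controller loop, coupled through the residual `ζ` to two infinite
families of stable modes, is stable when the gain `ε` of the residual is small. -/
theorem closed_loop_estimate {ι : Type} [Fintype ι] [DecidableEq ι] {δ A : ℝ} (hA : 0 ≤ A)
    {F₁ : Matrix ι ι ℝ} (hF₁ : HurwitzWithRate F₁ δ)
    {F₂ : Matrix (ι ⊕ Unit) (ι ⊕ Unit) ℝ} (hF₂ : HurwitzWithRate F₂ δ)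
    (L Cv : ι → ℝ) (K : ι ⊕ Unit → ℝ) :
    ∃ ε₀ C₀ : ℝ, 0 < ε₀ ∧ 0 < C₀ ∧
      ∀ (E : ℝ → ι → ℝ) (Xa : ℝ → ι ⊕ Unit → ℝ) (p ζ : ℝ → ℝ)
        (σ₁ α₁ β₁ σ₂ α₂ β₂ : ℕ → ℝ) (x₁ x₂ : ℕ → ℝ → ℝ) (ε : ℝ),
        0 ≤ ε → ε ≤ ε₀ →
        (∀ t, 0 ≤ t → HasDerivWithinAt E
          (F₁.mulVec (E t) + (-(p t + ζ t)) • L) (Ici 0) t) →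
        (∀ t, 0 ≤ t → HasDerivWithinAt Xa
          (F₂.mulVec (Xa t) + Sum.elim ((Cv ⬝ᵥ E t + p t + ζ t) • L) (fun _ => 0)) (Ici 0) t) →
        (∀ k, 0 < σ₁ k) → (∀ k, 0 < σ₂ k) →
        (Summable fun k => α₁ k ^ 2 + β₁ k ^ 2) → ∑' k, (α₁ k ^ 2 + β₁ k ^ 2) ≤ A →
        (Summable fun k => α₂ k ^ 2 + β₂ k ^ 2) → ∑' k, (α₂ k ^ 2 + β₂ k ^ 2) ≤ A →
        (∀ k, ∀ t, 0 ≤ t → HasDerivWithinAt (x₁ k)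
          ((-σ₁ k - δ) * x₁ k t + α₁ k * Xa t (Sum.inr ()) + β₁ k * (-(K ⬝ᵥ Xa t))) (Ici 0) t) →
        (∀ k, ∀ t, 0 ≤ t → HasDerivWithinAt (x₂ k)
          ((-σ₂ k - δ) * x₂ k t + α₂ k * Xa t (Sum.inr ()) + β₂ k * (-(K ⬝ᵥ Xa t))) (Ici 0) t) →
        (Summable fun k => σ₁ k * x₁ k 0 ^ 2) → (Summable fun k => σ₂ k * x₂ k 0 ^ 2) →
        (∀ t, 0 ≤ t → ζ t ^ 2 ≤ ε * (∑' k, (σ₁ k * x₁ k t) ^ 2 + ∑' k, (σ₂ k * x₂ k t) ^ 2)) →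
        ContinuousOn p (Ici 0) →
        ∀ T, 0 ≤ T →
          (Summable fun k => σ₁ k * x₁ k T ^ 2) ∧ (Summable fun k => σ₂ k * x₂ k T ^ 2) ∧
          Real.exp (2 * δ * T) * (∑ i, E T i ^ 2 + ∑ i, Xa T i ^ 2
            + ∑' k, σ₁ k * x₁ k T ^ 2 + ∑' k, σ₂ k * x₂ k T ^ 2)
          ≤ C₀ * (∑ i, E 0 i ^ 2 + ∑ i, Xa 0 i ^ 2
            + ∑' k, σ₁ k * x₁ k 0 ^ 2 + ∑' k, σ₂ k * x₂ k 0 ^ 2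
            + ∫ t in (0 : ℝ)..T, Real.exp (2 * δ * t) * p t ^ 2) := by
  obtain ⟨G₁, hG₁, hE⟩ := exists_L2_gain hF₁
  obtain ⟨G₂, hG₂, hXa⟩ := exists_L2_gain hF₂
  set ℓ := ∑ i, L i ^ 2 with hℓ
  set κ := ∑ i, Cv i ^ 2 with hκ
  -- The summand 1 accounts for u, itself a coordinate of `Xa`, so that u² + v² ≤ kk·|Xa|².
  set kk := ∑ i, K i ^ 2 + 1 with hkk
  have hℓ0 : 0 ≤ ℓ := Finset.sum_nonneg fun _ _ => sq_nonneg _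
  have hκ0 : 0 ≤ κ := Finset.sum_nonneg fun _ _ => sq_nonneg _
  have hK0 : 0 ≤ ∑ i, K i ^ 2 := Finset.sum_nonneg fun _ _ => sq_nonneg _
  have hkk0 : 0 < kk := by linarith
  set H := G₂ * (ℓ * (2 * κ * (G₁ * ℓ) + 2)) with hH
  have hH0 : 0 ≤ H := by positivity
  -- This makes the loop gain at most 1/2; the shifts by 1 keep the denominator positive when H or A
  -- vanishes. Only the finite-dimensional data and A enter.
  set ε₀ := 1 / (8 * (H + 1) * (A + 1) * kk) with hε₀
  have hε₀0 : 0 < ε₀ := by positivity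
  have hsmall : 4 * H * A * kk * ε₀ ≤ 1 / 2 := by
    rw [hε₀, mul_one_div, div_le_iff₀ (by positivity)]
    nlinarith [mul_nonneg hH0 hA, mul_nonneg hH0 hkk0.le, mul_nonneg hA hkk0.le,
      mul_nonneg (mul_nonneg hH0 hA) hkk0.le]
  set c := 2 * (G₂ + G₂ * (ℓ * (2 * κ * G₁)) + 2 * H + 2 * H * ε₀) with hc
  have hc0 : 0 < c := by positivity
  set q := 2 + 2 * ε₀ * (1 + 2 * A * kk * c) with hq
  have hq0 : 0 < q := by positivity
  refine ⟨ε₀, G₁ * (1 + ℓ * q) + c + (1 + 2 * A * kk * c), hε₀0, by positivity, ?_⟩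
  intro E Xa p ζ σ₁ α₁ β₁ σ₂ α₂ β₂ x₁ x₂ ε hε0 hεle hEd hXd hσ₁ hσ₂ hs₁ hA₁ hs₂ hA₂
    hx₁ hx₂ h01 h02 hζ hp T hT
  have hXc : ContinuousOn Xa (Ici 0) := fun t ht => (hXd t ht).continuousWithinAt
  have hEc : ContinuousOn E (Ici 0) := fun t ht => (hEd t ht).continuousWithinAt
  have huc : ContinuousOn (fun t => Xa t (Sum.inr ())) (Ici 0) := continuousOn_pi.1 hXc _
  have hvc : ContinuousOn (fun t => -(K ⬝ᵥ Xa t)) (Ici 0) := by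
    refine ContinuousOn.neg (continuousOn_finsetSum _ fun i _ => ?_)
    exact (continuousOn_pi.1 hXc i).const_mul _
  obtain ⟨d1i, d1s, d1⟩ := mode_family_estimate hσ₁ hs₁ hA₁ hx₁ huc hvc h01 hT
  obtain ⟨d2i, d2s, d2⟩ := mode_family_estimate hσ₂ hs₂ hA₂ hx₂ huc hvc h02 hT
  refine ⟨d1s, d2s, ?_⟩
  set T₁ := ∑' k, σ₁ k * x₁ k 0 ^ 2
  set T₂ := ∑' k, σ₂ k * x₂ k 0 ^ 2
  have hT₁ : 0 ≤ T₁ := tsum_nonneg fun k => by have := hσ₁ k; positivity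
  have hT₂ : 0 ≤ T₂ := tsum_nonneg fun k => by have := hσ₂ k; positivity
  set Y₁ := ∑' k, σ₁ k * x₁ k T ^ 2
  set Y₂ := ∑' k, σ₂ k * x₂ k T ^ 2
  have hY₁ : 0 ≤ Y₁ := tsum_nonneg fun k => by have := hσ₁ k; positivity
  have hY₂ : 0 ≤ Y₂ := tsum_nonneg fun k => by have := hσ₂ k; positivity
  set f₁ : ℝ → ℝ := fun t => Real.exp (2 * δ * t) * ∑' k, (σ₁ k * x₁ k t) ^ 2 with hf₁
  set f₂ : ℝ → ℝ := fun t => Real.exp (2 * δ * t) * ∑' k, (σ₂ k * x₂ k t) ^ 2 with hf₂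
  have i1 : IntervalIntegrable f₁ volume 0 T :=
    (intervalIntegrable_iff_integrableOn_Icc_of_le hT).2 d1i
  have i2 : IntervalIntegrable f₂ volume 0 T :=
    (intervalIntegrable_iff_integrableOn_Icc_of_le hT).2 d2i
  have hf₁0 : 0 ≤ ∫ t in (0 : ℝ)..T, f₁ t := intervalIntegral.integral_nonneg hT fun t _ =>
    mul_nonneg (Real.exp_pos _).le (tsum_nonneg fun _ => sq_nonneg _)
  have hf₂0 : 0 ≤ ∫ t in (0 : ℝ)..T, f₂ t := intervalIntegral.integral_nonneg hT fun t _ =>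
    mul_nonneg (Real.exp_pos _).le (tsum_nonneg fun _ => sq_nonneg _)
  set fp : ℝ → ℝ := fun t => Real.exp (2 * δ * t) * p t ^ 2 with hfp
  have hpc : ContinuousOn fp (Icc 0 T) :=
    ContinuousOn.mul (by fun_prop) ((hp.mono Icc_subset_Ici_self).pow 2)
  have ip : IntervalIntegrable fp volume 0 T :=
    (intervalIntegrable_iff_integrableOn_Icc_of_le hT).2 hpc.integrableOn_Icc
  set P := ∫ t in (0 : ℝ)..T, fp t
  have hP : 0 ≤ P := intervalIntegral.integral_nonneg hT fun t _ => by positivity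
  -- An integrable majorant of the weighted (p + ζ)²: about ζ only the pointwise bound by the high
  -- modes is known.
  set Dη : ℝ → ℝ := fun t => 2 * fp t + 2 * ε * (f₁ t + f₂ t) with hDη
  have iη : IntervalIntegrable Dη volume 0 T :=
    (ip.const_mul 2).add ((i1.add i2).const_mul (2 * ε))
  have hQ : ∫ t in (0 : ℝ)..T, Dη t
      = 2 * P + 2 * ε * ((∫ t in (0 : ℝ)..T, f₁ t) + ∫ t in (0 : ℝ)..T, f₂ t) := by
    rw [intervalIntegral.integral_add (ip.const_mul 2) ((i1.add i2).const_mul (2 * ε)),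
      intervalIntegral.integral_const_mul, intervalIntegral.integral_const_mul,
      intervalIntegral.integral_add i1 i2]
  set Q := ∫ t in (0 : ℝ)..T, Dη t
  have hη : ∀ t ∈ Icc 0 T, Real.exp (2 * δ * t) * (p t + ζ t) ^ 2 ≤ Dη t := by
    intro t ht
    have h1 : (p t + ζ t) ^ 2 ≤ 2 * p t ^ 2 + 2 * (ε * (∑' k, (σ₁ k * x₁ k t) ^ 2
        + ∑' k, (σ₂ k * x₂ k t) ^ 2)) := by
      exact add_sq_le_of_sq_le le_rfl (hζ t ht.1)
    refine (mul_le_mul_of_nonneg_left h1 (Real.exp_pos (2 * δ * t)).le).trans (le_of_eq ?_)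
    simp only [hDη, hfp, hf₁, hf₂]
    ring
  obtain ⟨e1, e2⟩ := hE E _ hEd T hT (fun t => ℓ * Dη t)
    ((intervalIntegrable_iff_integrableOn_Icc_of_le hT).1 (iη.const_mul ℓ)) (fun t ht => by
      rw [sum_sq_smul, neg_sq, ← hℓ, mul_left_comm]
      exact mul_le_mul_of_nonneg_left (hη t ht) hℓ0)
  rw [intervalIntegral.integral_const_mul] at e1 e2
  set fE : ℝ → ℝ := fun t => Real.exp (2 * δ * t) * ∑ i, E t i ^ 2 with hfE
  have hfEc : ContinuousOn fE (Icc 0 T) := by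
    refine ContinuousOn.mul (by fun_prop) (continuousOn_finsetSum _ fun i _ => ?_)
    exact ((continuousOn_pi.1 hEc i).mono Icc_subset_Ici_self).pow 2
  have iE : IntervalIntegrable fE volume 0 T :=
    (intervalIntegrable_iff_integrableOn_Icc_of_le hT).2 hfEc.integrableOn_Icc
  obtain ⟨a1, a2⟩ := hXa Xa _ hXd T hT (fun t => ℓ * (2 * κ * fE t + 2 * Dη t))
    ((intervalIntegrable_iff_integrableOn_Icc_of_le hT).1
      (((iE.const_mul (2 * κ)).add (iη.const_mul 2)).const_mul ℓ)) (fun t ht => by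
      have h0 : ∑ i, (Sum.elim ((Cv ⬝ᵥ E t + p t + ζ t) • L) (fun _ : Unit => (0 : ℝ))) i ^ 2
          = ℓ * (Cv ⬝ᵥ E t + p t + ζ t) ^ 2 := by
        rw [Fintype.sum_sum_type]
        simp only [Sum.elim_inl, Sum.elim_inr]
        rw [sum_sq_smul]
        simp [hℓ]
      rw [h0]
      have h1 : (Cv ⬝ᵥ E t + p t + ζ t) ^ 2
          ≤ 2 * (κ * ∑ i, E t i ^ 2) + 2 * (p t + ζ t) ^ 2 := by
        rw [add_assoc]
        exact add_sq_le_of_sq_le (sq_dotProduct_le Cv (E t)) le_rfl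
      have h2 := mul_le_mul_of_nonneg_left h1 (Real.exp_pos (2 * δ * t)).le
      have h3 : Real.exp (2 * δ * t) * (Cv ⬝ᵥ E t + p t + ζ t) ^ 2
          ≤ 2 * κ * fE t + 2 * Dη t := by
        have h4 := mul_le_mul_of_nonneg_left (hη t ht) zero_le_two
        refine h2.trans (le_trans (le_of_eq ?_) (add_le_add_right h4 (2 * κ * fE t)))
        simp only [hfE]
        ring
      rw [mul_left_comm]
      exact mul_le_mul_of_nonneg_left h3 hℓ0)
  rw [intervalIntegral.integral_const_mul, intervalIntegral.integral_add (iE.const_mul _)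
    (iη.const_mul _), intervalIntegral.integral_const_mul, intervalIntegral.integral_const_mul]
    at a1 a2
  set IE := ∫ t in (0 : ℝ)..T, fE t
  set fX : ℝ → ℝ := fun t => Real.exp (2 * δ * t) * ∑ i, Xa t i ^ 2 with hfX
  set I := ∫ t in (0 : ℝ)..T, fX t
  have hfXc : ContinuousOn fX (Icc 0 T) := by
    refine ContinuousOn.mul (by fun_prop) (continuousOn_finsetSum _ fun i _ => ?_)
    exact ((continuousOn_pi.1 hXc i).mono Icc_subset_Ici_self).pow 2
  have iX : IntervalIntegrable fX volume 0 T :=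
    (intervalIntegrable_iff_integrableOn_Icc_of_le hT).2 hfXc.integrableOn_Icc
  have hI0 : 0 ≤ I := intervalIntegral.integral_nonneg hT fun t _ => by positivity
  have hJ : ∫ t in (0 : ℝ)..T, Real.exp (2 * δ * t)
      * (Xa t (Sum.inr ()) ^ 2 + (-(K ⬝ᵥ Xa t)) ^ 2) ≤ kk * I := by
    rw [← intervalIntegral.integral_const_mul]
    refine intervalIntegral.integral_mono_on hT ?_ (iX.const_mul kk) fun t _ => ?_
    · refine (intervalIntegrable_iff_integrableOn_Icc_of_le hT).2
        (ContinuousOn.integrableOn_Icc (ContinuousOn.mul (by fun_prop) ?_))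
      exact ((huc.mono Icc_subset_Ici_self).pow 2).add ((hvc.mono Icc_subset_Ici_self).pow 2)
    · have h1 := sq_dotProduct_le K (Xa t)
      have h2 : Xa t (Sum.inr ()) ^ 2 ≤ ∑ i, Xa t i ^ 2 :=
        Finset.single_le_sum (f := fun i => Xa t i ^ 2) (fun i _ => sq_nonneg _)
          (Finset.mem_univ _)
      have h3 : Xa t (Sum.inr ()) ^ 2 + (-(K ⬝ᵥ Xa t)) ^ 2 ≤ kk * ∑ i, Xa t i ^ 2 := by
        rw [neg_sq, hkk]; linarith only [h1, h2]
      rw [mul_left_comm]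
      exact mul_le_mul_of_nonneg_left h3 (Real.exp_pos (2 * δ * t)).le
  have hAJ := mul_le_mul_of_nonneg_left hJ hA
  have hexp := Real.exp_pos (2 * δ * T)
  have e3 : Real.exp (2 * δ * T) * (∑ i, E T i ^ 2 + ∑ i, Xa T i ^ 2 + Y₁ + Y₂)
      = fE T + fX T + (Real.exp (2 * δ * T) * Y₁ + Real.exp (2 * δ * T) * Y₂) := by
    simp only [hfE, hfX]; ring
  rw [e3]
  exact small_gain_arith hA hG₁ hG₂ hℓ0 hκ0 hkk0 hε₀0 hsmall
    (Finset.sum_nonneg fun _ _ => sq_nonneg _) (Finset.sum_nonneg fun _ _ => sq_nonneg _)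
    hT₁ hT₂ hP (mul_nonneg hexp.le hY₁) (mul_nonneg hexp.le hY₂) hf₁0 hf₂0 hI0 hεle hQ e1 e2 a1 a2
    (d1.trans (add_le_add_right hAJ _)) (d2.trans (add_le_add_right hAJ _)) hH hc hq

/-! ## Modal dynamics of the plant -/

theorem hasDerivAt_lift (x : ℝ) : HasDerivAt lift (1 - x) x := by
  have h := (hasDerivAt_id x).sub (((hasDerivAt_id x).pow 2).div_const 2)
  convert! h using 1
  simp

theorem isH1_lift : IsH1 lift (fun x => 1 - x) :=
  IsH1.of_hasDerivAt hasDerivAt_lift (by fun_prop)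

theorem isH1_lift_deriv : IsH1 (fun x => 1 - x) (fun _ => -1) :=
  IsH1.of_hasDerivAt (fun x => by simpa using (hasDerivAt_id x).const_sub 1) continuous_const

variable {N₀ M₀ : ℕ}

/-- The profile `z` with the boundary control removed. -/
noncomputable def State.hom (S : State N₀ M₀) (x : ℝ) : ℝ := S.z x - S.u * lift x

theorem State.Admissible.inDomain {s : ℝ} {S : State N₀ M₀} (h : S.Admissible s) :
    InDomain s S.y S.yx S.yxx S.hom (fun x => S.zx x - S.u * (1 - x))
      (fun x => S.zxx x - S.u * (-1)) where
  y_h1 := h.y_h1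
  y_h2 := h.y_h2
  w_h1 := h.z_h1.sub (isH1_lift.const_mul S.u)
  w_h2 := h.z_h2.sub (isH1_lift_deriv.const_mul S.u)
  y_bc_zero := by simp [State.hom, lift, h.y_bc_zero]
  y_bc_one := h.y_bc_one
  w_bc_zero := by simp [h.z_bc_zero]
  w_bc_one := by simp [h.z_bc_one]

/-- Pairing with f is a continuous linear functional on L², so it commutes with the time derivative.
-/
theorem IsC1L2.hasDerivWithinAt_integral {w w' : ℝ → ℝ → ℝ} (h : IsC1L2 w w') {f : ℝ → ℝ}
    (hf : MemLp f 2 unitMeasure) {t : ℝ} (ht : 0 ≤ t) :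
    HasDerivWithinAt (fun τ => ∫ x in (0 : ℝ)..1, w τ x * f x)
      (∫ x in (0 : ℝ)..1, w' t x * f x) (Ici 0) t := by
  obtain ⟨W, W', -, hW⟩ := h
  have key : ∀ (V : Lp ℝ 2 unitMeasure) (v : ℝ → ℝ), (V : ℝ → ℝ) =ᵐ[unitMeasure] v →
      ∫ x in (0 : ℝ)..1, v x * f x = innerSL ℝ (hf.toLp f) V := by
    intro V v hV
    rw [← integral_unitMeasure, innerSL_apply_apply, L2.inner_def]
    refine integral_congr_ae ?_
    filter_upwards [hf.coeFn_toLp, hV] with x h1 h2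
    rw [h1, h2]; simp
  have h1 := (innerSL ℝ (hf.toLp f)).hasFDerivAt.comp_hasDerivWithinAt t (hW t ht).2.2
  rw [key _ _ (hW t ht).2.1]
  exact h1.congr (fun τ hτ => key _ _ (hW τ hτ).1) (key _ _ (hW t ht).1)

theorem continuous_alpha (b : ℝ) : Continuous (alpha b) := by unfold alpha lift; fun_prop

theorem continuous_beta : Continuous beta := by unfold beta lift; fun_prop

theorem memLp_alpha (b : ℝ) : MemLp (alpha b) 2 unitMeasure :=
  memLp_of_continuousOn (continuous_alpha b).continuousOn

theorem memLp_beta : MemLp beta 2 unitMeasure :=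
  memLp_of_continuousOn continuous_beta.continuousOn

section Dynamics

variable {a b s : ℝ} {ms : Measurement} {ξ : ℝ} {Kx : Idx N₀ M₀ → ℝ} {ku : ℝ} {L : Idx N₀ M₀ → ℝ}
  {N M : ℕ} {S : ℝ → State N₀ M₀}

/-- Rewriting z'' + bz through w produces u(lift'' + b·lift) = αu, and the time derivative of
-u·lift produces βv. -/
theorem IsSolution.hasDerivWithinAt_integral_hom (h : IsSolution a b s ms ξ Kx ku L N M S)
    {f : ℝ → ℝ} (hf : MemLp f 2 unitMeasure) {t : ℝ} (ht : 0 ≤ t) :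
    HasDerivWithinAt (fun τ => ∫ x in (0 : ℝ)..1, (S τ).hom x * f x)
      ((∫ x in (0 : ℝ)..1, ((S t).zxx x - (S t).u * (-1) + b * (S t).hom x) * f x)
        + (∫ x in (0 : ℝ)..1, alpha b x * f x) * (S t).u
        + (∫ x in (0 : ℝ)..1, beta x * f x) * (S t).feedback Kx ku) (Ici 0) t := by
  have hl : MemLp lift 2 unitMeasure := isH1_lift.memLp_self
  have hD := fun τ (hτ : 0 ≤ τ) => (h.admissible τ hτ).inDomain
  have h1 := h.heat_z.hasDerivWithinAt_integral hf ht
  have h2 := (h.ode_u t ht).mul_const (∫ x in (0 : ℝ)..1, lift x * f x)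
  have e : ∀ τ, 0 ≤ τ → ∫ x in (0 : ℝ)..1, (S τ).hom x * f x
      = (∫ x in (0 : ℝ)..1, (S τ).z x * f x) - (S τ).u * ∫ x in (0 : ℝ)..1, lift x * f x := by
    intro τ hτ
    have := integral_linear_mul (h.admissible τ hτ).z_h1.memLp_self hl hf (-(S τ).u)
    rw [neg_mul, ← sub_eq_add_neg] at this
    rw [← this]
    congr 1; ext x; rw [State.hom]; ring
  convert! (h1.sub h2).congr (fun τ hτ => e τ hτ) (e t ht) using 1
  have i1 : MemLp (fun x => (S t).zxx x - (S t).u * (-1) + b * (S t).hom x) 2 unitMeasure :=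
    (hD t ht).w_h2.memLp.add ((hD t ht).w_h1.memLp_self.const_mul b)
  have e1 := integral_linear_mul i1 (memLp_alpha b) hf (S t).u
  have e2 : ∀ x, ((S t).zxx x - (S t).u * (-1) + b * (S t).hom x + (S t).u * alpha b x) * f x
      = ((S t).zxx x + b * (S t).z x) * f x := by
    intro x; rw [State.hom, alpha]; ring
  simp only [e2] at e1
  have e3 : ∫ x in (0 : ℝ)..1, beta x * f x = -∫ x in (0 : ℝ)..1, lift x * f x := by
    rw [← intervalIntegral.integral_neg]
    congr 1; ext x; rw [beta]; ring
  rw [e1, e3]; ring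

/-- Coefficient of the state along `φ_{1,n}` after removal of the boundary control. -/
noncomputable def State.coeff1 (a b s : ℝ) (S : State N₀ M₀) (n : ℕ) : ℝ :=
  mode1 a b s S.y S.hom n

/-- Coefficient of the state along `φ_{2,m}` after removal of the boundary control. -/
noncomputable def State.coeff2 (S : State N₀ M₀) (m : ℕ) : ℝ := mode2 S.hom m

theorem IsSolution.hasDerivWithinAt_coeff2 (h : IsSolution a b s ms ξ Kx ku L N M S) (m : ℕ)
    {t : ℝ} (ht : 0 ≤ t) :
    HasDerivWithinAt (fun τ => (S τ).coeff2 m)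
      (lam2 b m * (S t).coeff2 m + alpha2 b m * (S t).u + beta2 m * (S t).feedback Kx ku)
      (Ici 0) t := by
  have h1 := h.hasDerivWithinAt_integral_hom (isONFamily_psi2.memLp m) ht
  have h2 := (h.admissible t ht).inDomain.mode2_generator b m
  rw [mode2] at h2
  rw [h2] at h1
  exact h1

theorem IsSolution.hasDerivWithinAt_coeff1_aux (h : IsSolution a b s ms ξ Kx ku L N M S) (n : ℕ)
    {t : ℝ} (ht : 0 ≤ t) :
    HasDerivWithinAt (fun τ => (S τ).coeff1 a b s n)
      (mode1 a b s (fun x => (S t).yxx x + a * (S t).y x)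
          (fun x => (S t).zxx x - (S t).u * (-1) + b * (S t).hom x) n
        + alpha1 a b s n * (S t).u + beta1 a b s n * (S t).feedback Kx ku) (Ici 0) t := by
  have h1 := h.hasDerivWithinAt_integral_hom (memLp_psi1 a b s n) ht
  have h2 := h.heat_y.hasDerivWithinAt_integral (isONFamily_phi1.memLp n) ht
  convert! h2.add h1 using 1
  rw [mode1, alpha1, beta1]; ring

theorem IsSolution.hasDerivWithinAt_coeff1 (h : IsSolution a b s ms ξ Kx ku L N M S) {n : ℕ}
    (hn : n ∉ Delta1 a b) {t : ℝ} (ht : 0 ≤ t) :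
    HasDerivWithinAt (fun τ => (S τ).coeff1 a b s n)
      (lam1 a n * (S t).coeff1 a b s n + alpha1 a b s n * (S t).u
        + beta1 a b s n * (S t).feedback Kx ku) (Ici 0) t := by
  have h1 := h.hasDerivWithinAt_coeff1_aux n ht
  rw [(h.admissible t ht).inDomain.mode1_generator hn] at h1
  exact h1

theorem IsSolution.hasDerivWithinAt_coeff1_of_mem (h : IsSolution a b s ms ξ Kx ku L N M S)
    {n k : ℕ} (hk : (n, k) ∈ Delta a b) {t : ℝ} (ht : 0 ≤ t) :
    HasDerivWithinAt (fun τ => (S τ).coeff1 a b s n)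
      (lam1 a n * (S t).coeff1 a b s n - √2 * s * muCoef k * (S t).coeff2 k
        + alpha1 a b s n * (S t).u + beta1 a b s n * (S t).feedback Kx ku) (Ici 0) t := by
  have h1 := h.hasDerivWithinAt_coeff1_aux n ht
  rw [(h.admissible t ht).inDomain.mode1_generator_of_mem hk] at h1
  exact h1

/-- The coefficients of the state kept in the truncated model. -/
noncomputable def State.low (a b s : ℝ) (S : State N₀ M₀) : Idx N₀ M₀ → ℝ :=
  Sum.elim (fun n => S.coeff1 a b s n) (fun m => S.coeff2 m)

open Classical in
theorem A1_mulVec_inl (X : Idx N₀ M₀ → ℝ) (n : Fin (N₀ + 1)) :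
    (A1 a b s N₀ M₀).mulVec X (Sum.inl n) = lam1 a n * X (Sum.inl n)
      + ∑ m : Fin (M₀ + 1), if ((n : ℕ), (m : ℕ)) ∈ Delta a b then
          -(√2 * s * muCoef m) * X (Sum.inr m) else 0 := by
  rw [A1, Matrix.fromBlocks_mulVec]
  simp only [Sum.elim_inl, Pi.add_apply, Matrix.mulVec_diagonal, Function.comp_apply]
  simp [Matrix.mulVec, dotProduct, ite_mul]

theorem A1_mulVec_inr (X : Idx N₀ M₀ → ℝ) (m : Fin (M₀ + 1)) :
    (A1 a b s N₀ M₀).mulVec X (Sum.inr m) = lam2 b m * X (Sum.inr m) := by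
  rw [A1, Matrix.fromBlocks_mulVec]
  simp [Matrix.mulVec_diagonal]

theorem IsSolution.hasDerivWithinAt_low (h : IsSolution a b s ms ξ Kx ku L N M S)
    (hΔ₂ : ∀ m ∈ Delta2 a b, m ≤ M₀) {t : ℝ} (ht : 0 ≤ t) :
    HasDerivWithinAt (fun τ => (S τ).low a b s)
      ((A1 a b s N₀ M₀).mulVec ((S t).low a b s) + (S t).u • B1u a b s N₀ M₀
        + (S t).feedback Kx ku • B1v a b s N₀ M₀) (Ici 0) t := by
  classical
  rw [hasDerivWithinAt_pi]
  rintro (n | m)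
  · have e : ((A1 a b s N₀ M₀).mulVec ((S t).low a b s) + (S t).u • B1u a b s N₀ M₀
        + (S t).feedback Kx ku • B1v a b s N₀ M₀) (Sum.inl n)
        = lam1 a n * (S t).coeff1 a b s n
          + (∑ m : Fin (M₀ + 1), if ((n : ℕ), (m : ℕ)) ∈ Delta a b then
            -(√2 * s * muCoef m) * (S t).coeff2 m else 0)
          + alpha1 a b s n * (S t).u + beta1 a b s n * (S t).feedback Kx ku := by
      simp only [Pi.add_apply, Pi.smul_apply, A1_mulVec_inl, B1u, B1v, State.low, Sum.elim_inl,
        Sum.elim_inr, smul_eq_mul]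
      ring
    rw [e]
    by_cases hn : (n : ℕ) ∈ Delta1 a b
    · obtain ⟨k, hk⟩ := hn
      -- The resonant partner of a kept mode is itself kept, so the truncated model is closed.
      have hkM : k < M₀ + 1 := Nat.lt_succ_of_le (hΔ₂ k ⟨n, hk⟩)
      rw [Finset.sum_eq_single (⟨k, hkM⟩ : Fin (M₀ + 1))]
      · rw [if_pos hk]
        convert! h.hasDerivWithinAt_coeff1_of_mem hk ht using 1
        ring
      · intro m _ hm
        refine if_neg fun hm' => hm (Fin.ext ?_)
        exact Delta_right_unique hm' hk
      · simp
    · rw [Finset.sum_eq_zero fun (m : Fin (M₀ + 1)) _ => if_neg fun hm => hn ⟨(m : ℕ), hm⟩,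
        add_zero]
      exact h.hasDerivWithinAt_coeff1 hn ht
  · have e : ((A1 a b s N₀ M₀).mulVec ((S t).low a b s) + (S t).u • B1u a b s N₀ M₀
        + (S t).feedback Kx ku • B1v a b s N₀ M₀) (Sum.inr m)
        = lam2 b m * (S t).coeff2 m + alpha2 b m * (S t).u
          + beta2 m * (S t).feedback Kx ku := by
      simp only [Pi.add_apply, Pi.smul_apply, A1_mulVec_inr, B1u, B1v, State.low,
        Sum.elim_inr, smul_eq_mul]
      ring
    rw [e]
    exact h.hasDerivWithinAt_coeff2 m ht

end Dynamics

/-! ## Weighted sequences and tails -/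

theorem sq_tsum_mul_le {f g : ℕ → ℝ} (hf : Summable fun k => f k ^ 2)
    (hg : Summable fun k => g k ^ 2) :
    Summable (fun k => f k * g k) ∧
      (∑' k, f k * g k) ^ 2 ≤ (∑' k, f k ^ 2) * ∑' k, g k ^ 2 := by
  have hs : Summable fun k => f k * g k := by
    refine Summable.of_norm_bounded (hf.add hg) fun k => ?_
    rw [Real.norm_eq_abs, abs_mul, ← sq_abs (f k), ← sq_abs (g k)]
    nlinarith [sq_nonneg (|f k| - |g k|), abs_nonneg (f k), abs_nonneg (g k)]
  refine ⟨hs, ?_⟩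
  refine le_of_tendsto (hs.hasSum.tendsto_sum_nat.pow 2) (Eventually.of_forall fun n => ?_)
  refine (Finset.sum_mul_sq_le_sq_mul_sq _ _ _).trans ?_
  exact mul_le_mul (hf.sum_le_tsum _ fun _ _ => sq_nonneg _)
    (hg.sum_le_tsum _ fun _ _ => sq_nonneg _) (Finset.sum_nonneg fun _ _ => sq_nonneg _)
    (tsum_nonneg fun _ => sq_nonneg _)

theorem tsum_nat_add_le {f : ℕ → ℝ} (hf : Summable f) (h0 : ∀ n, 0 ≤ f n) (j : ℕ) :
    ∑' k, f (k + j) ≤ ∑' k, f k := by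
  rw [← hf.sum_add_tsum_nat_add j]
  exact le_add_of_nonneg_left (Finset.sum_nonneg fun _ _ => h0 _)

theorem exists_tail_sq_le {g : ℕ → ℝ} (hg : Summable fun k => g k ^ 2) {ε : ℝ} (hε : 0 < ε) :
    ∃ J : ℕ, ∀ j, J ≤ j → ∀ f : ℕ → ℝ, (Summable fun k => f k ^ 2) →
      (∑' k, g (k + j) * f (k + j)) ^ 2 ≤ ε * ∑' k, f k ^ 2 := by
  have ht := tendsto_sum_nat_add fun k => g k ^ 2
  obtain ⟨J, hJ⟩ := eventually_atTop.1 (ht.eventually (gt_mem_nhds hε))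
  refine ⟨J, fun j hj f hf => ?_⟩
  have h1 := (sq_tsum_mul_le ((summable_nat_add_iff j).2 hg) ((summable_nat_add_iff j).2 hf)).2
  refine h1.trans (mul_le_mul (hJ j hj).le (tsum_nat_add_le hf (fun _ => sq_nonneg _) j)
    (tsum_nonneg fun _ => sq_nonneg _) hε.le)

/-- For positive D, the ratio D/τ² is largest at τ₀, where it is below 1. -/
theorem exists_quadratic_lower {D τ₀ : ℝ} (h : D < τ₀ ^ 2) :
    ∃ c : ℝ, 0 < c ∧ ∀ τ : ℝ, τ₀ ^ 2 ≤ τ ^ 2 → c * τ ^ 2 ≤ τ ^ 2 - D := by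
  rcases le_or_gt D 0 with hD | hD
  · exact ⟨1, one_pos, fun τ _ => by linarith⟩
  · have h0 : 0 < τ₀ ^ 2 := hD.trans h
    refine ⟨1 - D / τ₀ ^ 2, by rw [sub_pos, div_lt_one h0]; exact h, fun τ hτ => ?_⟩
    have h1 : D ≤ D / τ₀ ^ 2 * τ ^ 2 := by
      rw [div_mul_eq_mul_div, le_div_iff₀ h0]
      exact mul_le_mul_of_nonneg_left hτ hD.le
    linarith

/-- The sequence `σ n` is comparable with `(n + 1)²` for `n ≥ n₀`. -/
structure QuadGrowth (σ : ℕ → ℝ) (n₀ : ℕ) (c C : ℝ) : Prop where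
  c_pos : 0 < c
  C_pos : 0 < C
  lower : ∀ n, n₀ ≤ n → c * ((n : ℝ) + 1) ^ 2 ≤ σ n
  upper : ∀ n, n₀ ≤ n → σ n ≤ C * ((n : ℝ) + 1) ^ 2

theorem QuadGrowth.of_freq {τ : ℕ → ℝ} {D : ℝ} {n₀ : ℕ} (hτ : Monotone τ) (hτ0 : 0 ≤ τ n₀)
    (hlow : ∀ n, n₀ ≤ n → (n : ℝ) + 1 ≤ τ n) (hup : ∀ n, τ n ≤ 4 * ((n : ℝ) + 1))
    (hD : D < τ n₀ ^ 2) : ∃ c C, QuadGrowth (fun n => τ n ^ 2 - D) n₀ c C := by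
  obtain ⟨c, hc, h⟩ := exists_quadratic_lower hD
  refine ⟨c, 16 + |D|, hc, by positivity, fun n hn => ?_, fun n hn => ?_⟩
  · refine le_trans ?_ (h (τ n) (pow_le_pow_left₀ hτ0 (hτ hn) 2))
    have := hlow n hn
    gcongr
  · have h1 : (1 : ℝ) ≤ ((n : ℝ) + 1) ^ 2 := one_le_pow₀ (by
      linarith [(Nat.cast_nonneg n : (0 : ℝ) ≤ n)])
    have h2 : τ n ^ 2 ≤ (4 * ((n : ℝ) + 1)) ^ 2 :=
      pow_le_pow_left₀ (hτ0.trans (hτ hn)) (hup n) 2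
    have h3 : |D| * 1 ≤ |D| * ((n : ℝ) + 1) ^ 2 := mul_le_mul_of_nonneg_left h1 (abs_nonneg D)
    have h4 := neg_abs_le D
    linarith

theorem quadGrowth_lam1 {a δ : ℝ} {n₀ : ℕ} (h : lam1 a n₀ < -δ) :
    ∃ c C, QuadGrowth (fun n => -lam1 a n - δ) n₀ c C := by
  have e : (fun n => -lam1 a n - δ) = fun n : ℕ => (((n : ℝ) + 1 / 2) * Real.pi) ^ 2 - (a + δ) := by
    ext n; rw [lam1]; ring
  rw [e]
  refine QuadGrowth.of_freq (τ := fun n : ℕ => ((n : ℝ) + 1 / 2) * Real.pi) (fun n m hnm => ?_)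
    (by positivity) (fun n _ => (half_freq_bounds n).1) (fun n => (half_freq_bounds n).2) ?_
  · have : (n : ℝ) ≤ m := Nat.cast_le.2 hnm
    have := Real.pi_pos
    simp only
    gcongr
  · rw [lam1] at h
    simp only [mul_pow]
    linarith

/-- The index 0 is excluded because the comparison m + 1 ≤ mπ fails there. -/
theorem quadGrowth_lam2 {b δ : ℝ} {m₀ : ℕ} (hm₀ : 1 ≤ m₀) (h : lam2 b m₀ < -δ) :
    ∃ c C, QuadGrowth (fun m => -lam2 b m - δ) m₀ c C := by
  have e : (fun m => -lam2 b m - δ) = fun m : ℕ => ((m : ℝ) * Real.pi) ^ 2 - (b + δ) := by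
    ext m; rw [lam2]; ring
  rw [e]
  have h3 := Real.pi_gt_three
  have h4 := Real.pi_le_four
  refine QuadGrowth.of_freq (τ := fun m : ℕ => (m : ℝ) * Real.pi) (fun n m hnm => ?_)
    (by positivity) (fun n hn => ?_) (fun n => ?_) ?_
  · have : (n : ℝ) ≤ m := Nat.cast_le.2 hnm
    simp only
    gcongr
  · have : (1 : ℝ) ≤ n := by exact_mod_cast hm₀.trans hn
    nlinarith
  · nlinarith [(Nat.cast_nonneg n : (0 : ℝ) ≤ n)]
  · rw [lam2] at h
    simp only [mul_pow]
    linarith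

section QuadGrowth

variable {σ : ℕ → ℝ} {n₀ : ℕ} {c C : ℝ}

theorem one_le_succ_sq (n : ℕ) : (1 : ℝ) ≤ ((n : ℝ) + 1) ^ 2 :=
  one_le_pow₀ (by linarith [(Nat.cast_nonneg n : (0 : ℝ) ≤ n)])

theorem QuadGrowth.le (h : QuadGrowth σ n₀ c C) {n : ℕ} (hn : n₀ ≤ n) : c ≤ σ n :=
  (le_mul_of_one_le_right h.c_pos.le (one_le_succ_sq n)).trans (h.lower n hn)

theorem QuadGrowth.pos (h : QuadGrowth σ n₀ c C) {n : ℕ} (hn : n₀ ≤ n) : 0 < σ n :=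
  h.c_pos.trans_le (h.le hn)

/-- The terms are O(n⁻²). Linear growth of γ has to be allowed because of the Neumann coefficients
of the modes (1,n). -/
theorem QuadGrowth.summable_div_sq (h : QuadGrowth σ n₀ c C) {K : ℝ} {γ : ℕ → ℝ}
    (hγ : ∀ n, |γ n| ≤ K * ((n : ℝ) + 1)) :
    Summable fun k => (γ (k + n₀) / σ (k + n₀)) ^ 2 := by
  refine Summable.of_nonneg_of_le (fun _ => sq_nonneg _) (fun k => ?_)
    (((summable_nat_add_iff n₀).2 summable_one_div_succ_sq).mul_left (K ^ 2 / c ^ 2))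
  have hl := h.lower (k + n₀) (Nat.le_add_left _ _)
  have hp := h.pos (Nat.le_add_left n₀ k)
  have hc := h.c_pos
  set r : ℝ := ((k + n₀ : ℕ) : ℝ) + 1 with hr
  have hr0 : 0 < r := by positivity
  have h1 : |γ (k + n₀) / σ (k + n₀)| ≤ K * r / (c * r ^ 2) := by
    rw [abs_div, abs_of_pos hp]
    exact div_le_div₀ ((abs_nonneg _).trans (hγ _)) (hγ _) (by positivity) hl
  rw [← sq_abs]
  refine (pow_le_pow_left₀ (abs_nonneg _) h1 2).trans (le_of_eq ?_)
  field_simp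

variable {x : ℕ → ℝ}

theorem QuadGrowth.summable_mul_sq (h : QuadGrowth σ n₀ c C)
    (hx : Summable fun n : ℕ => (((n : ℝ) + 1) * x n) ^ 2) :
    Summable fun k => σ (k + n₀) * x (k + n₀) ^ 2 := by
  refine Summable.of_nonneg_of_le
    (fun k => mul_nonneg (h.pos (Nat.le_add_left n₀ k)).le (sq_nonneg _)) (fun k => ?_)
    (((summable_nat_add_iff n₀).2 hx).mul_left C)
  rw [mul_pow, ← mul_assoc]
  exact mul_le_mul_of_nonneg_right (h.upper _ (Nat.le_add_left n₀ k)) (sq_nonneg _)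

theorem QuadGrowth.summable_mul_sq_sq (h : QuadGrowth σ n₀ c C)
    (hx : Summable fun n : ℕ => (((n : ℝ) + 1) ^ 2 * x n) ^ 2) :
    Summable fun k => (σ (k + n₀) * x (k + n₀)) ^ 2 := by
  refine Summable.of_nonneg_of_le (fun _ => sq_nonneg _) (fun k => ?_)
    (((summable_nat_add_iff n₀).2 hx).mul_left (C ^ 2))
  rw [← mul_pow, ← mul_assoc, mul_pow, mul_pow _ (x _)]
  exact mul_le_mul_of_nonneg_right (pow_le_pow_left₀ (h.pos (Nat.le_add_left n₀ k)).le
    (h.upper _ (Nat.le_add_left n₀ k)) 2) (sq_nonneg _)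

theorem QuadGrowth.split_le (h : QuadGrowth σ n₀ c C)
    (hx : Summable fun n : ℕ => (((n : ℝ) + 1) * x n) ^ 2) :
    ∑ i ∈ Finset.range n₀, x i ^ 2 + ∑' k, σ (k + n₀) * x (k + n₀) ^ 2
      ≤ (1 + C) * ∑' n : ℕ, (((n : ℝ) + 1) * x n) ^ 2 := by
  have hC := h.C_pos
  rw [← hx.sum_add_tsum_nat_add n₀]
  have h1 : ∑ i ∈ Finset.range n₀, x i ^ 2
      ≤ ∑ i ∈ Finset.range n₀, (((i : ℝ) + 1) * x i) ^ 2 :=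
    Finset.sum_le_sum fun i _ => by
      rw [mul_pow]; exact le_mul_of_one_le_left (sq_nonneg _) (one_le_succ_sq i)
  have h2 : ∑' k, σ (k + n₀) * x (k + n₀) ^ 2
      ≤ C * ∑' k : ℕ, ((((k + n₀ : ℕ) : ℝ) + 1) * x (k + n₀)) ^ 2 := by
    rw [← tsum_mul_left]
    refine (h.summable_mul_sq hx).tsum_le_tsum (fun k => ?_)
      (((summable_nat_add_iff n₀).2 hx).mul_left C)
    rw [mul_pow, ← mul_assoc]
    exact mul_le_mul_of_nonneg_right (h.upper _ (Nat.le_add_left n₀ k)) (sq_nonneg _)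
  have h3 : 0 ≤ ∑ i ∈ Finset.range n₀, (((i : ℝ) + 1) * x i) ^ 2 :=
    Finset.sum_nonneg fun _ _ => sq_nonneg _
  have h4 : 0 ≤ ∑' k : ℕ, ((((k + n₀ : ℕ) : ℝ) + 1) * x (k + n₀)) ^ 2 :=
    tsum_nonneg fun _ => sq_nonneg _
  have h5 := mul_nonneg hC.le h3
  linarith

theorem QuadGrowth.le_split (h : QuadGrowth σ n₀ c C)
    (hx : Summable fun n : ℕ => (((n : ℝ) + 1) * x n) ^ 2) :
    ∑' n : ℕ, (((n : ℝ) + 1) * x n) ^ 2 ≤ ((n₀ : ℝ) ^ 2 + 1 / c)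
      * (∑ i ∈ Finset.range n₀, x i ^ 2 + ∑' k, σ (k + n₀) * x (k + n₀) ^ 2) := by
  have hc := h.c_pos
  rw [← hx.sum_add_tsum_nat_add n₀]
  have h1 : ∑ i ∈ Finset.range n₀, (((i : ℝ) + 1) * x i) ^ 2
      ≤ (n₀ : ℝ) ^ 2 * ∑ i ∈ Finset.range n₀, x i ^ 2 := by
    rw [Finset.mul_sum]
    refine Finset.sum_le_sum fun i hi => ?_
    have : (i : ℝ) + 1 ≤ n₀ := by exact_mod_cast Finset.mem_range.1 hi
    rw [mul_pow]
    gcongr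
  have h2 : ∑' k : ℕ, ((((k + n₀ : ℕ) : ℝ) + 1) * x (k + n₀)) ^ 2
      ≤ 1 / c * ∑' k, σ (k + n₀) * x (k + n₀) ^ 2 := by
    rw [← tsum_mul_left]
    refine ((summable_nat_add_iff n₀).2 hx).tsum_le_tsum (fun k => ?_)
      ((h.summable_mul_sq hx).mul_left _)
    rw [mul_pow, ← mul_assoc]
    refine mul_le_mul_of_nonneg_right ?_ (sq_nonneg _)
    rw [one_div, ← div_eq_inv_mul, le_div_iff₀ hc, mul_comm]
    exact h.lower _ (Nat.le_add_left n₀ k)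
  have h3 : 0 ≤ ∑ i ∈ Finset.range n₀, x i ^ 2 := Finset.sum_nonneg fun _ _ => sq_nonneg _
  have h4 : 0 ≤ ∑' k, σ (k + n₀) * x (k + n₀) ^ 2 :=
    tsum_nonneg fun k => mul_nonneg (h.pos (Nat.le_add_left n₀ k)).le (sq_nonneg _)
  have h5 := mul_nonneg (sq_nonneg (n₀ : ℝ)) h4
  have h6 := mul_nonneg (one_div_pos.2 hc).le h3
  linarith

theorem sum_Ioc_eq_sum_range {f : ℕ → ℝ} {n N : ℕ} :
    ∑ i ∈ Finset.Ioc n N, f i = ∑ k ∈ Finset.range (N - n), f (k + (n + 1)) := by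
  have e : Finset.Ioc n N = Finset.Ico (n + 1) (N + 1) := by
    ext i; simp only [Finset.mem_Ioc, Finset.mem_Ico]; omega
  rw [e, Finset.sum_Ico_eq_sum_range, Nat.add_sub_add_right]
  exact Finset.sum_congr rfl fun k _ => by rw [add_comm]

theorem QuadGrowth.sum_Ioc_sq_le {n : ℕ} (h : QuadGrowth σ (n + 1) c C)
    (hx : Summable fun n : ℕ => (((n : ℝ) + 1) * x n) ^ 2) (N : ℕ) :
    ∑ i ∈ Finset.Ioc n N, x i ^ 2 ≤ 1 / c * ∑' k, σ (k + (n + 1)) * x (k + (n + 1)) ^ 2 := by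
  have hc := h.c_pos
  rw [sum_Ioc_eq_sum_range]
  refine le_trans (Finset.sum_le_sum fun k _ => ?_)
    (le_of_eq_of_le (Finset.mul_sum _ _ _).symm (mul_le_mul_of_nonneg_left
      ((h.summable_mul_sq hx).sum_le_tsum (Finset.range (N - n)) fun k _ =>
        mul_nonneg (h.pos (Nat.le_add_left _ k)).le (sq_nonneg _)) (one_div_pos.2 hc).le))
  rw [← mul_assoc]
  refine le_mul_of_one_le_left (sq_nonneg _) ?_
  rw [one_div, ← div_eq_inv_mul, one_le_div hc]
  exact h.le (Nat.le_add_left _ k)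

/-- The residual of a modal series after truncation is small with respect to the weighted norm. -/
theorem QuadGrowth.exists_residual_le {n : ℕ} (h : QuadGrowth σ (n + 1) c C) {K : ℝ} {γ : ℕ → ℝ}
    (hγ : ∀ n, |γ n| ≤ K * ((n : ℝ) + 1)) {ε : ℝ} (hε : 0 < ε) :
    ∃ Nmin, n ≤ Nmin ∧ ∀ N, Nmin ≤ N → ∀ x : ℕ → ℝ,
      (Summable fun n : ℕ => (((n : ℝ) + 1) ^ 2 * x n) ^ 2) →
      ∃ ζ : ℝ, ∑' n, γ n * x n = ∑ i ∈ Finset.range (n + 1), γ i * x i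
          + ∑ i ∈ Finset.Ioc n N, γ i * x i + ζ ∧
        ζ ^ 2 ≤ ε * ∑' k, (σ (k + (n + 1)) * x (k + (n + 1))) ^ 2 := by
  have hg := h.summable_div_sq hγ
  obtain ⟨J, hJ⟩ := exists_tail_sq_le hg hε
  refine ⟨n + J, Nat.le_add_right _ _, fun N hN x hx => ?_⟩
  have hf := h.summable_mul_sq_sq hx
  have e : ∀ k, γ (k + (n + 1)) / σ (k + (n + 1)) * (σ (k + (n + 1)) * x (k + (n + 1)))
      = γ (k + (n + 1)) * x (k + (n + 1)) := fun k => by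
    have := (h.pos (Nat.le_add_left _ k)).ne'
    field_simp
  have hs := (sq_tsum_mul_le hg hf).1
  simp only [e] at hs
  have hs' : Summable fun k => γ k * x k := (summable_nat_add_iff (n + 1)).1 hs
  -- The shifted sequence starts at n + 1, so its tail from N - n starts at the mode N + 1.
  refine ⟨_, ?_, hJ (N - n) (by omega) _ hf⟩
  simp only [e]
  rw [sum_Ioc_eq_sum_range, add_assoc, ← hs'.sum_add_tsum_nat_add (n + 1),
    ← hs.sum_add_tsum_nat_add (N - n)]

end QuadGrowth

theorem finite_modes_estimate {σ : ℕ → ℝ} {δ : ℝ} {I : Finset ℕ} (hσ : ∀ n ∈ I, 0 < σ n)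
    {e : ℕ → ℝ → ℝ} (he : ∀ n ∈ I, ∀ t, 0 ≤ t →
      HasDerivWithinAt (e n) ((-σ n - δ) * e n t) (Ici 0) t) {T : ℝ} (hT : 0 ≤ T) :
    Real.exp (2 * δ * T) * ∑ n ∈ I, e n T ^ 2 ≤ ∑ n ∈ I, e n 0 ^ 2 ∧
    ∫ t in (0 : ℝ)..T, Real.exp (2 * δ * t) * ∑ n ∈ I, (σ n * e n t) ^ 2
      ≤ ∑ n ∈ I, σ n * e n 0 ^ 2 := by
  have hc : ∀ n ∈ I, ContinuousOn (fun t => Real.exp (2 * δ * t) * (σ n * e n t) ^ 2) (Icc 0 T) :=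
    fun n hn => ContinuousOn.mul (by fun_prop) (ContinuousOn.pow (ContinuousOn.const_mul
      (fun t ht => ((he n hn t ht.1).continuousWithinAt).mono Icc_subset_Ici_self) _) 2)
  have key : ∀ n ∈ I, Real.exp (2 * δ * T) * (σ n * e n T ^ 2)
      + ∫ t in (0 : ℝ)..T, Real.exp (2 * δ * t) * (σ n * e n t) ^ 2 ≤ σ n * e n 0 ^ 2 := by
    intro n hn
    have := scalar_mode_estimate (σ := σ n) (δ := δ) (α := 0) (β := 0) (x := e n)
      (u := fun _ => 0) (v := fun _ => 0) (fun t ht => by simpa using he n hn t ht)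
      continuousOn_const continuousOn_const hT
    rw [intervalIntegral.integral_of_le hT, ← integral_Icc_eq_integral_Ioc]
    simpa using this
  have hI : ∀ n ∈ I, 0 ≤ ∫ t in (0 : ℝ)..T, Real.exp (2 * δ * t) * (σ n * e n t) ^ 2 :=
    fun n _ => intervalIntegral.integral_nonneg hT fun t _ => by positivity
  constructor
  · rw [Finset.mul_sum]
    refine Finset.sum_le_sum fun n hn => ?_
    refine le_of_mul_le_mul_left ?_ (hσ n hn)
    linarith [key n hn, hI n hn]
  · simp only [Finset.mul_sum]
    rw [intervalIntegral.integral_finsetSum fun n hn =>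
      (intervalIntegrable_iff_integrableOn_Icc_of_le hT).2 (hc n hn).integrableOn_Icc]
    refine Finset.sum_le_sum fun n hn => ?_
    have : 0 ≤ Real.exp (2 * δ * T) * (σ n * e n T ^ 2) :=
      mul_nonneg (Real.exp_pos _).le (mul_nonneg (hσ n hn).le (sq_nonneg _))
    linarith [key n hn]

/-! ## Modal energy of a state -/

/-- Decay rate of the mode `(1, n)` beyond `δ`. -/
noncomputable def decay1 (a δ : ℝ) (n : ℕ) : ℝ := -lam1 a n - δ

/-- Decay rate of the mode `(2, m)` beyond `δ`. -/
noncomputable def decay2 (b δ : ℝ) (m : ℕ) : ℝ := -lam2 b m - δ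

/-- Weighted square norm of the modes `(1, n)`, `n > N₀`. -/
noncomputable def State.tail1 (a b s δ : ℝ) (S : State N₀ M₀) : ℝ :=
  ∑' k, decay1 a δ (k + (N₀ + 1)) * S.coeff1 a b s (k + (N₀ + 1)) ^ 2

/-- Weighted square norm of the modes `(2, m)`, `m > M₀`. -/
noncomputable def State.tail2 (b δ : ℝ) (S : State N₀ M₀) : ℝ :=
  ∑' k, decay2 b δ (k + (M₀ + 1)) * S.coeff2 (k + (M₀ + 1)) ^ 2

/-- Square norm of the profiles `(y, z)`. -/
noncomputable def State.plantEnergy (S : State N₀ M₀) : ℝ :=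
  ∫ x in (0 : ℝ)..1, (S.yx x ^ 2 + S.z x ^ 2 + S.zx x ^ 2)

theorem State.sum_low_sq (a b s : ℝ) (S : State N₀ M₀) :
    ∑ i, S.low a b s i ^ 2 = ∑ n ∈ Finset.range (N₀ + 1), S.coeff1 a b s n ^ 2
      + ∑ m ∈ Finset.range (M₀ + 1), S.coeff2 m ^ 2 := by
  rw [Fintype.sum_sum_type, ← Fin.sum_univ_eq_sum_range, ← Fin.sum_univ_eq_sum_range]
  rfl

theorem State.C1_dotProduct_low (ms : Measurement) (a b s ξ : ℝ) (S : State N₀ M₀) :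
    C1 ms a b s ξ N₀ M₀ ⬝ᵥ S.low a b s
      = ∑ n ∈ Finset.range (N₀ + 1), c1 ms ξ n * S.coeff1 a b s n
        + ∑ m ∈ Finset.range (M₀ + 1), c2 ms a b s ξ m * S.coeff2 m := by
  rw [dotProduct, Fintype.sum_sum_type, ← Fin.sum_univ_eq_sum_range,
    ← Fin.sum_univ_eq_sum_range]
  rfl

theorem integral_sub_mul_sq_le {f h : ℝ → ℝ} (hf : MemLp f 2 unitMeasure)
    (hh : MemLp h 2 unitMeasure) (h1 : ∀ x ∈ Icc (0 : ℝ) 1, h x ^ 2 ≤ 1) (u : ℝ) :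
    ∫ x in (0 : ℝ)..1, (f x - u * h x) ^ 2 ≤ 2 * (∫ x in (0 : ℝ)..1, f x ^ 2) + 2 * u ^ 2 := by
  have e : 2 * (∫ x in (0 : ℝ)..1, f x ^ 2) + 2 * u ^ 2
      = ∫ x in (0 : ℝ)..1, (2 * f x ^ 2 + 2 * u ^ 2) := by
    rw [intervalIntegral.integral_add (hf.intervalIntegrable_sq.const_mul 2) (by simp),
      intervalIntegral.integral_const_mul]
    simp
  rw [e]
  refine intervalIntegral.integral_mono_on zero_le_one
    (hf.sub (hh.const_mul u)).intervalIntegrable_sq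
    ((hf.intervalIntegrable_sq.const_mul 2).add (by simp)) fun x hx => ?_
  have h2 := mul_le_mul_of_nonneg_left (h1 x hx) (sq_nonneg u)
  nlinarith [sq_nonneg (f x + u * h x)]

theorem lift_sq_le_one {x : ℝ} (hx : x ∈ Icc (0 : ℝ) 1) : lift x ^ 2 ≤ 1 := by
  have h0 : 0 ≤ lift x := by rw [lift]; nlinarith [hx.1, hx.2]
  have h1 : lift x ≤ 1 := by rw [lift]; nlinarith [hx.1, hx.2]
  nlinarith

theorem State.Admissible.plantEnergy_eq {s : ℝ} {S : State N₀ M₀} (h : S.Admissible s) :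
    S.plantEnergy = (∫ x in (0 : ℝ)..1, S.yx x ^ 2) + (∫ x in (0 : ℝ)..1, S.z x ^ 2)
      + ∫ x in (0 : ℝ)..1, S.zx x ^ 2 := by
  have i1 := h.y_h1.memLp.intervalIntegrable_sq
  have i2 := h.z_h1.memLp_self.intervalIntegrable_sq
  have i3 := h.z_h1.memLp.intervalIntegrable_sq
  rw [State.plantEnergy, intervalIntegral.integral_add (i1.add i2) i3,
    intervalIntegral.integral_add i1 i2]

/-- The lift and its derivative are bounded by 1 on [0,1], so z and w have comparable H¹ norms up to
u². The converse bound is the direct one with -u for u. -/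
theorem State.Admissible.hom_energy_bounds {s : ℝ} {S : State N₀ M₀} (h : S.Admissible s) :
    (∫ x in (0 : ℝ)..1, S.yx x ^ 2) + (∫ x in (0 : ℝ)..1, S.hom x ^ 2)
        + (∫ x in (0 : ℝ)..1, (S.zx x - S.u * (1 - x)) ^ 2) ≤ 4 * (S.plantEnergy + S.u ^ 2) ∧
    S.plantEnergy ≤ 4 * ((∫ x in (0 : ℝ)..1, S.yx x ^ 2) + (∫ x in (0 : ℝ)..1, S.hom x ^ 2)
        + (∫ x in (0 : ℝ)..1, (S.zx x - S.u * (1 - x)) ^ 2) + S.u ^ 2) := by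
  have hl : MemLp lift 2 unitMeasure := isH1_lift.memLp_self
  have hl' : MemLp (fun x : ℝ => 1 - x) 2 unitMeasure := isH1_lift.memLp
  have hl1 : ∀ x ∈ Icc (0 : ℝ) 1, (1 - x) ^ 2 ≤ 1 := fun x hx => by nlinarith [hx.1, hx.2]
  have hD := h.inDomain
  have p1 := integral_sub_mul_sq_le h.z_h1.memLp_self hl (fun x hx => lift_sq_le_one hx) S.u
  have p2 := integral_sub_mul_sq_le h.z_h1.memLp hl' hl1 S.u
  have p3 := integral_sub_mul_sq_le hD.w_h1.memLp_self hl (fun x hx => lift_sq_le_one hx) (-S.u)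
  have p4 := integral_sub_mul_sq_le hD.w_h1.memLp hl' hl1 (-S.u)
  have e3 : ∀ x, S.hom x - -S.u * lift x = S.z x := fun x => by rw [State.hom]; ring
  have e4 : ∀ x, S.zx x - S.u * (1 - x) - -S.u * (1 - x) = S.zx x := fun x => by ring
  simp only [e3, e4, neg_sq] at p3 p4
  have p1' : ∫ x in (0 : ℝ)..1, S.hom x ^ 2 ≤ 2 * (∫ x in (0 : ℝ)..1, S.z x ^ 2) + 2 * S.u ^ 2 :=
    p1
  have n1 := integral_sq_nonneg S.yx
  have n2 := integral_sq_nonneg S.z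
  have n3 := integral_sq_nonneg S.zx
  have n4 := integral_sq_nonneg S.hom
  have n5 := integral_sq_nonneg (fun x => S.zx x - S.u * (1 - x))
  rw [h.plantEnergy_eq]
  constructor <;> linarith

/-- `S₁`, `S₂` are the sums weighted by (n+1)²; `Q₁`, `Q₂` add the unweighted low modes to the
σ-weighted tails; `y`, `w`, `w'` are the squared norms of ∂ₓy, w, ∂ₓw, and `P`, `u` are the plant
energy and the squared control. The two bounds compose these comparisons. -/
theorem plantEnergy_arith {G C C' k k' S₁ S₂ Q₁ Q₂ y w w' P u : ℝ} (hG : 0 ≤ G) (hC : 0 ≤ C)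
    (hC' : 0 ≤ C') (hk : 0 ≤ k) (hk' : 0 ≤ k') (hS₁ : 0 ≤ S₁) (hS₂ : 0 ≤ S₂) (hQ₁ : 0 ≤ Q₁)
    (hQ₂ : 0 ≤ Q₂) (hy : 0 ≤ y) (hP : 0 ≤ P) (hu : 0 ≤ u)
    (t1 : S₁ ≤ G * (y + w + w')) (t2 : y ≤ G * (S₁ + S₂)) (t3 : S₂ ≤ 2 * (w + w'))
    (t4 : w + w' ≤ 20 * S₂) (q1 : Q₁ ≤ (1 + C) * S₁) (q2 : Q₂ ≤ (1 + C') * S₂)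
    (r1 : S₁ ≤ k * Q₁) (r2 : S₂ ≤ k' * Q₂) (z1 : y + w + w' ≤ 4 * (P + u))
    (z2 : P ≤ 4 * (y + w + w' + u)) {Γ : ℝ}
    (hΓ : Γ = (2 + C + C') * ((G + 2) * 4) + 4 * ((G + 20) * (k + k')) + 4) :
    Q₁ + Q₂ ≤ Γ * (P + u) ∧ P ≤ Γ * (Q₁ + Q₂ + u) := by
  have a1 : Q₁ + Q₂ ≤ (2 + C + C') * (S₁ + S₂) := by
    linarith [mul_nonneg hC hS₂, mul_nonneg hC' hS₁]
  have a2 : S₁ + S₂ ≤ (G + 2) * (y + w + w') := by linarith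
  have a3 : y + w + w' ≤ (G + 20) * (S₁ + S₂) := by linarith
  have a4 : S₁ + S₂ ≤ (k + k') * (Q₁ + Q₂) := by linarith [mul_nonneg hk hQ₂, mul_nonneg hk' hQ₁]
  constructor
  · have b1 : Q₁ + Q₂ ≤ (2 + C + C') * ((G + 2) * 4) * (P + u) := by
      calc Q₁ + Q₂ ≤ (2 + C + C') * ((G + 2) * (4 * (P + u))) :=
            a1.trans (mul_le_mul_of_nonneg_left (a2.trans (mul_le_mul_of_nonneg_left z1
              (by positivity))) (by positivity))
        _ = _ := by ring
    refine b1.trans (mul_le_mul_of_nonneg_right ?_ (by positivity))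
    have b2 : 0 ≤ (G + 20) * (k + k') := by positivity
    linarith
  · have b1 : y + w + w' ≤ (G + 20) * (k + k') * (Q₁ + Q₂) := by
      rw [mul_assoc]
      exact a3.trans (mul_le_mul_of_nonneg_left a4 (by positivity))
    have b2 : 0 ≤ (2 + C + C') * ((G + 2) * 4) * (Q₁ + Q₂ + u) := by positivity
    have b3 : 0 ≤ (G + 20) * (k + k') * u := by positivity
    rw [hΓ]
    linarith

theorem exists_plantEnergy_bounds {a b : ℝ} (s : ℝ) {δ c C c' C' : ℝ}
    (hΔ₁ : ∀ n ∈ Delta1 a b, n ≤ N₀) (hg₁ : QuadGrowth (decay1 a δ) (N₀ + 1) c C)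
    (hg₂ : QuadGrowth (decay2 b δ) (M₀ + 1) c' C') :
    ∃ Γ : ℝ, 0 < Γ ∧ ∀ S : State N₀ M₀, S.Admissible s →
      (Summable fun n : ℕ => (((n : ℝ) + 1) * S.coeff1 a b s n) ^ 2) ∧
      (Summable fun m : ℕ => (((m : ℝ) + 1) * S.coeff2 m) ^ 2) ∧
      ∑ i, S.low a b s i ^ 2 + S.tail1 a b s δ + S.tail2 b δ ≤ Γ * (S.plantEnergy + S.u ^ 2) ∧
      S.plantEnergy
        ≤ Γ * (∑ i, S.low a b s i ^ 2 + S.tail1 a b s δ + S.tail2 b δ + S.u ^ 2) := by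
  obtain ⟨G, hG, hb⟩ := exists_energy_bounds s hΔ₁
  have hc := hg₁.c_pos
  have hc' := hg₂.c_pos
  have hC := hg₁.C_pos
  have hC' := hg₂.C_pos
  refine ⟨(2 + C + C') * ((G + 2) * 4) + 4 * ((G + 20) * ((((N₀ + 1 : ℕ) : ℝ) ^ 2 + 1 / c)
    + (((M₀ + 1 : ℕ) : ℝ) ^ 2 + 1 / c'))) + 4, by positivity, fun S h => ?_⟩
  have hD := h.inDomain
  obtain ⟨s1, t1, t2⟩ := hb _ _ _ _ _ _ hD
  obtain ⟨s2, t3⟩ := hD.tsum_mode2_le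
  have t4 := hD.integral_w_le
  refine ⟨s1, s2, ?_⟩
  have q1 := hg₁.split_le s1
  have q2 := hg₂.split_le s2
  have r1 := hg₁.le_split s1
  have r2 := hg₂.le_split s2
  obtain ⟨z1, z2⟩ := h.hom_energy_bounds
  have hsum : ∑ i, S.low a b s i ^ 2 + S.tail1 a b s δ + S.tail2 b δ
      = (∑ n ∈ Finset.range (N₀ + 1), S.coeff1 a b s n ^ 2 + S.tail1 a b s δ)
        + (∑ m ∈ Finset.range (M₀ + 1), S.coeff2 m ^ 2 + S.tail2 b δ) := by
    rw [S.sum_low_sq]; ring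
  rw [hsum]
  change ∑ n ∈ Finset.range (N₀ + 1), S.coeff1 a b s n ^ 2 + S.tail1 a b s δ ≤ _ at q1
  change ∑ m ∈ Finset.range (M₀ + 1), S.coeff2 m ^ 2 + S.tail2 b δ ≤ _ at q2
  change _ ≤ _ * (∑ n ∈ Finset.range (N₀ + 1), S.coeff1 a b s n ^ 2 + S.tail1 a b s δ) at r1
  change _ ≤ _ * (∑ m ∈ Finset.range (M₀ + 1), S.coeff2 m ^ 2 + S.tail2 b δ) at r2
  have hτ1 : 0 ≤ S.tail1 a b s δ :=
    tsum_nonneg fun k => mul_nonneg (hg₁.pos (Nat.le_add_left _ k)).le (sq_nonneg _)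
  have hτ2 : 0 ≤ S.tail2 b δ :=
    tsum_nonneg fun k => mul_nonneg (hg₂.pos (Nat.le_add_left _ k)).le (sq_nonneg _)
  exact plantEnergy_arith hG.le hC.le hC'.le (by positivity) (by positivity)
    (tsum_nonneg fun _ => sq_nonneg _) (tsum_nonneg fun _ => sq_nonneg _)
    (add_nonneg (Finset.sum_nonneg fun _ _ => sq_nonneg _) hτ1)
    (add_nonneg (Finset.sum_nonneg fun _ _ => sq_nonneg _) hτ2)
    (integral_sq_nonneg _)
    (intervalIntegral.integral_nonneg zero_le_one fun x _ => by positivity) (sq_nonneg _)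
    t1 t2 t3 t4 q1 q2 r1 r2 z1 z2 rfl

theorem exists_output_residual {a b : ℝ} (s : ℝ) {δ c C c' C' : ℝ} (ms : Measurement) {ξ : ℝ}
    (hξ : ξ ∈ Icc (0 : ℝ) 1) (hΔ₁ : ∀ n ∈ Delta1 a b, n ≤ N₀) (hΔ₂ : ∀ m ∈ Delta2 a b, m ≤ M₀)
    (hg₁ : QuadGrowth (decay1 a δ) (N₀ + 1) c C) (hg₂ : QuadGrowth (decay2 b δ) (M₀ + 1) c' C')
    {ε : ℝ} (hε : 0 < ε) :
    ∃ Nmin Mmin, N₀ ≤ Nmin ∧ M₀ ≤ Mmin ∧ ∀ N M, Nmin ≤ N → Mmin ≤ M →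
      ∀ S : State N₀ M₀, S.Admissible s → ∃ ζ : ℝ,
        S.output ms ξ = C1 ms a b s ξ N₀ M₀ ⬝ᵥ S.low a b s
          + ∑ n ∈ Finset.Ioc N₀ N, c1 ms ξ n * S.coeff1 a b s n
          + ∑ m ∈ Finset.Ioc M₀ M, c2 ms a b s ξ m * S.coeff2 m + ζ ∧
        ζ ^ 2 ≤ ε * (∑' k, (decay1 a δ (k + (N₀ + 1)) * S.coeff1 a b s (k + (N₀ + 1))) ^ 2
          + ∑' k, (decay2 b δ (k + (M₀ + 1)) * S.coeff2 (k + (M₀ + 1))) ^ 2) := by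
  obtain ⟨K, hK, hc2⟩ := exists_c2_bound ms s hξ hΔ₂
  have hc2' : ∀ m : ℕ, |c2 ms a b s ξ m| ≤ K * ((m : ℝ) + 1) := fun m =>
    (hc2 m).trans (le_mul_of_one_le_right hK.le (by linarith [(Nat.cast_nonneg m : (0 : ℝ) ≤ m)]))
  -- Each family receives ε/2, since squaring the sum of the two residuals costs a factor 2.
  obtain ⟨Nmin, hN, h1⟩ := hg₁.exists_residual_le (exists_c1_bound ms ξ) (half_pos hε)
  obtain ⟨Mmin, hM, h2⟩ := hg₂.exists_residual_le hc2' (half_pos hε)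
  refine ⟨Nmin, Mmin, hN, hM, fun N M hN' hM' S h => ?_⟩
  have hD := h.inDomain
  obtain ⟨ζ₁, e1, b1⟩ := h1 N hN' _ (hD.summable_mode1 hΔ₁)
  obtain ⟨ζ₂, e2, b2⟩ := h2 M hM' _ hD.summable_mode2
  refine ⟨ζ₁ + ζ₂, ?_, ?_⟩
  · have h3 := hD.output_expansion hΔ₁ hΔ₂ ms hξ
    rw [e1, e2] at h3
    rw [S.C1_dotProduct_low]
    refine Eq.trans ?_ (h3.trans ?_)
    · cases ms <;> rfl
    · simp only [State.coeff1, State.coeff2]; ring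
  · refine (add_sq_le_of_sq_le b1 b2).trans (le_of_eq ?_)
    simp only [State.coeff1, State.coeff2]; ring

/-! ## Closed-loop dynamics -/

/-- Estimation error of the truncated model. -/
noncomputable def State.error (a b s : ℝ) (S : State N₀ M₀) : Idx N₀ M₀ → ℝ :=
  S.low a b s - S.X1

/-- State of the observer of the truncated model, augmented with the control. -/
noncomputable def State.aug (S : State N₀ M₀) : Idx N₀ M₀ ⊕ Unit → ℝ :=
  Sum.elim S.X1 (fun _ => S.u)

/-- Output of the estimation errors of the modes `(1, n)`, `N₀ < n ≤ N`, and `(2, m)`,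
`M₀ < m ≤ M`. -/
noncomputable def State.residual (ms : Measurement) (a b s ξ : ℝ) (N M : ℕ) (S : State N₀ M₀) :
    ℝ :=
  (∑ n ∈ Finset.Ioc N₀ N, c1 ms ξ n * (S.coeff1 a b s n - S.x1 n))
    + ∑ m ∈ Finset.Ioc M₀ M, c2 ms a b s ξ m * (S.coeff2 m - S.x2 m)

/-- Square norm of the error, of the augmented observer state and of the tail modes. -/
noncomputable def State.loopEnergy (a b s δ : ℝ) (S : State N₀ M₀) : ℝ :=
  ∑ i, S.error a b s i ^ 2 + ∑ i, S.aug i ^ 2 + S.tail1 a b s δ + S.tail2 b δ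

/-- Square norm of the estimation errors of the modes `(1, n)`, `N₀ < n ≤ N`, and `(2, m)`,
`M₀ < m ≤ M`. -/
noncomputable def State.midEnergy (a b s : ℝ) (N M : ℕ) (S : State N₀ M₀) : ℝ :=
  (∑ n ∈ Finset.Ioc N₀ N, (S.coeff1 a b s n - S.x1 n) ^ 2)
    + ∑ m ∈ Finset.Ioc M₀ M, (S.coeff2 m - S.x2 m) ^ 2

theorem State.feedback_eq (Kx : Idx N₀ M₀ → ℝ) (ku : ℝ) (S : State N₀ M₀) :
    S.feedback Kx ku = -((Sum.elim Kx fun _ => ku) ⬝ᵥ S.aug) := by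
  have e : (Sum.elim Kx fun _ => ku) ⬝ᵥ S.aug = Kx ⬝ᵥ S.X1 + ku * S.u := by
    rw [dotProduct, Fintype.sum_sum_type]
    simp [State.aug, dotProduct]
  rw [State.feedback, e]
  ring

theorem sum_sub_sq_le {ι : Type} (I : Finset ι) (f g : ι → ℝ) :
    ∑ i ∈ I, (f i - g i) ^ 2 ≤ 2 * ∑ i ∈ I, f i ^ 2 + 2 * ∑ i ∈ I, g i ^ 2 := by
  rw [Finset.mul_sum, Finset.mul_sum, ← Finset.sum_add_distrib]
  exact Finset.sum_le_sum fun i _ => by nlinarith [sq_nonneg (f i + g i)]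

theorem sum_sq_le_of_sub {ι : Type} (I : Finset ι) (f g : ι → ℝ) :
    ∑ i ∈ I, f i ^ 2 ≤ 2 * ∑ i ∈ I, (f i - g i) ^ 2 + 2 * ∑ i ∈ I, g i ^ 2 := by
  rw [Finset.mul_sum, Finset.mul_sum, ← Finset.sum_add_distrib]
  exact Finset.sum_le_sum fun i _ => by nlinarith [sq_nonneg (f i - g i - g i)]

theorem sum_sq_right_le {ι : Type} (I : Finset ι) (f g : ι → ℝ) :
    ∑ i ∈ I, g i ^ 2 ≤ 2 * ∑ i ∈ I, f i ^ 2 + 2 * ∑ i ∈ I, (f i - g i) ^ 2 := by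
  simpa only [sub_sub_cancel] using sum_sub_sq_le I f fun i => f i - g i

/-- For the intermediate modes, `g`, `h`, `w` are the squared norms of the plant coefficients,
observer states and errors; `ℓ`, `X`, `e` play these roles for the low modes, and `τ` are the
weighted tails. Any two of each triple control the third, and `g` is controlled by `τ`. -/
theorem energy_arith {Γ k k' P u X ℓ e τ₁ τ₂ g₁ g₂ h₁ h₂ w₁ w₂ : ℝ} (hΓ : 0 < Γ) (hk : 0 ≤ k)
    (hk' : 0 ≤ k') (hP : 0 ≤ P) (hu : 0 ≤ u) (hX : 0 ≤ X) (hℓ : 0 ≤ ℓ) (he : 0 ≤ e) (hτ₁ : 0 ≤ τ₁)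
    (hτ₂ : 0 ≤ τ₂) (hh₁ : 0 ≤ h₁) (hh₂ : 0 ≤ h₂) (hw₁ : 0 ≤ w₁) (hw₂ : 0 ≤ w₂)
    (l1 : ℓ ≤ 2 * e + 2 * X) (l2 : e ≤ 2 * ℓ + 2 * X)
    (m1 : h₁ ≤ 2 * g₁ + 2 * w₁) (m2 : h₂ ≤ 2 * g₂ + 2 * w₂)
    (m3 : w₁ ≤ 2 * g₁ + 2 * h₁) (m4 : w₂ ≤ 2 * g₂ + 2 * h₂)
    (g1 : g₁ ≤ k * τ₁) (g2 : g₂ ≤ k' * τ₂)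
    (p1 : ℓ + τ₁ + τ₂ ≤ Γ * (P + u)) (p2 : P ≤ Γ * (ℓ + τ₁ + τ₂ + u)) {Λ : ℝ}
    (hΛ : Λ = (2 + 2 * k + 2 * k') * (Γ + 2) + 3) :
    P + u + X + h₁ + h₂ ≤ Λ * (e + (X + u) + τ₁ + τ₂ + (w₁ + w₂)) ∧
      e + (X + u) + τ₁ + τ₂ + (w₁ + w₂) ≤ Λ * (P + u + X + h₁ + h₂) := by
  have kΓ : 0 ≤ k * Γ := mul_nonneg hk hΓ.le
  have kΓ' : 0 ≤ k' * Γ := mul_nonneg hk' hΓ.le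
  constructor
  · set V := e + (X + u) + τ₁ + τ₂ + (w₁ + w₂)
    have a1 : P ≤ 2 * Γ * V := by
      refine p2.trans ?_
      rw [mul_comm 2 Γ, mul_assoc]
      exact mul_le_mul_of_nonneg_left (by simp only [V]; linarith) hΓ.le
    have a2 : k * τ₁ ≤ k * V := mul_le_mul_of_nonneg_left (by simp only [V]; linarith) hk
    have a3 : k' * τ₂ ≤ k' * V := mul_le_mul_of_nonneg_left (by simp only [V]; linarith) hk'
    have hV : 0 ≤ V := by positivity
    have a4 : u + X + 2 * w₁ + 2 * w₂ ≤ 2 * V := by simp only [V]; linarith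
    have a5 := mul_nonneg hk hV
    have a6 := mul_nonneg hk' hV
    have a7 := mul_nonneg kΓ hV
    have a8 := mul_nonneg kΓ' hV
    rw [hΛ]
    linarith
  · set U := P + u + X + h₁ + h₂
    have hU : 0 ≤ U := by positivity
    have a1 : ℓ + τ₁ + τ₂ ≤ Γ * U :=
      p1.trans (mul_le_mul_of_nonneg_left (by simp only [U]; linarith) hΓ.le)
    have a2 : k * τ₁ ≤ k * (Γ * U) := mul_le_mul_of_nonneg_left (by linarith) hk
    have a3 : k' * τ₂ ≤ k' * (Γ * U) := mul_le_mul_of_nonneg_left (by linarith) hk'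
    have a4 : 3 * X + u + 2 * h₁ + 2 * h₂ ≤ 3 * U := by simp only [U]; linarith
    have a5 := mul_nonneg hk hU
    have a6 := mul_nonneg hk' hU
    rw [hΛ]
    linarith

theorem exists_energy_equiv {a b : ℝ} (s : ℝ) {δ c C c' C' : ℝ}
    (hΔ₁ : ∀ n ∈ Delta1 a b, n ≤ N₀) (hg₁ : QuadGrowth (decay1 a δ) (N₀ + 1) c C)
    (hg₂ : QuadGrowth (decay2 b δ) (M₀ + 1) c' C') (N M : ℕ) :
    ∃ Γ : ℝ, 0 < Γ ∧ ∀ S : State N₀ M₀, S.Admissible s →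
      S.energy N M ≤ Γ * (S.loopEnergy a b s δ + S.midEnergy a b s N M) ∧
      S.loopEnergy a b s δ + S.midEnergy a b s N M ≤ Γ * S.energy N M := by
  obtain ⟨Γ, hΓ, hb⟩ := exists_plantEnergy_bounds s hΔ₁ hg₁ hg₂
  have hc := hg₁.c_pos
  have hc' := hg₂.c_pos
  refine ⟨(2 + 2 * (1 / c) + 2 * (1 / c')) * (Γ + 2) + 3, by positivity, fun S h => ?_⟩
  obtain ⟨s1, s2, p1, p2⟩ := hb S h
  have haug : ∑ i, S.aug i ^ 2 = ∑ i, S.X1 i ^ 2 + S.u ^ 2 := by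
    rw [Fintype.sum_sum_type]; simp [State.aug]
  rw [State.loopEnergy, State.midEnergy, haug, State.energy]
  exact energy_arith hΓ (one_div_pos.2 hc).le (one_div_pos.2 hc').le
    (intervalIntegral.integral_nonneg zero_le_one fun x _ => by positivity) (sq_nonneg _)
    (Finset.sum_nonneg fun _ _ => sq_nonneg _) (Finset.sum_nonneg fun _ _ => sq_nonneg _)
    (Finset.sum_nonneg fun _ _ => sq_nonneg _)
    (tsum_nonneg fun k => mul_nonneg (hg₁.pos (Nat.le_add_left _ k)).le (sq_nonneg _))
    (tsum_nonneg fun k => mul_nonneg (hg₂.pos (Nat.le_add_left _ k)).le (sq_nonneg _))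
    (Finset.sum_nonneg fun _ _ => sq_nonneg _) (Finset.sum_nonneg fun _ _ => sq_nonneg _)
    (Finset.sum_nonneg fun _ _ => sq_nonneg _) (Finset.sum_nonneg fun _ _ => sq_nonneg _)
    (sum_sq_le_of_sub _ _ _) (sum_sub_sq_le _ _ _)
    (sum_sq_right_le _ _ _) (sum_sq_right_le _ _ _)
    (sum_sub_sq_le _ _ _) (sum_sub_sq_le _ _ _)
    (hg₁.sum_Ioc_sq_le s1 N) (hg₂.sum_Ioc_sq_le s2 M) p1 p2 rfl

/-- Cauchy–Schwarz for γe = (γ/σ)(σe), followed by the dissipation estimate for σe. -/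
theorem finite_output_estimate {σ : ℕ → ℝ} {δ : ℝ} {I : Finset ℕ} (hσ : ∀ n ∈ I, 0 < σ n)
    {e : ℕ → ℝ → ℝ} (he : ∀ n ∈ I, ∀ t, 0 ≤ t →
      HasDerivWithinAt (e n) ((-σ n - δ) * e n t) (Ici 0) t) (γ : ℕ → ℝ) {T : ℝ} (hT : 0 ≤ T) :
    ∫ t in (0 : ℝ)..T, Real.exp (2 * δ * t) * (∑ n ∈ I, γ n * e n t) ^ 2
      ≤ (∑ n ∈ I, (γ n / σ n) ^ 2) * (∑ n ∈ I, σ n) * ∑ n ∈ I, e n 0 ^ 2 := by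
  have hc : ∀ n ∈ I, ContinuousOn (e n) (Icc 0 T) := fun n hn t ht =>
    ((he n hn t ht.1).continuousWithinAt).mono Icc_subset_Ici_self
  set κ := ∑ n ∈ I, (γ n / σ n) ^ 2 with hκ
  have hκ0 : 0 ≤ κ := Finset.sum_nonneg fun _ _ => sq_nonneg _
  have h1 : ∫ t in (0 : ℝ)..T, Real.exp (2 * δ * t) * (∑ n ∈ I, γ n * e n t) ^ 2
      ≤ κ * ∫ t in (0 : ℝ)..T, Real.exp (2 * δ * t) * ∑ n ∈ I, (σ n * e n t) ^ 2 := by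
    rw [← intervalIntegral.integral_const_mul]
    refine intervalIntegral.integral_mono_on hT ?_ ?_ fun t _ => ?_
    · refine (intervalIntegrable_iff_integrableOn_Icc_of_le hT).2 (ContinuousOn.integrableOn_Icc ?_)
      exact ContinuousOn.mul (by fun_prop)
        ((continuousOn_finsetSum _ fun n hn => (hc n hn).const_mul _).pow 2)
    · refine (intervalIntegrable_iff_integrableOn_Icc_of_le hT).2 (ContinuousOn.integrableOn_Icc ?_)
      exact (ContinuousOn.mul (by fun_prop)
        (continuousOn_finsetSum _ fun n hn => ((hc n hn).const_mul _).pow 2)).const_mul _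
    · rw [mul_left_comm]
      refine mul_le_mul_of_nonneg_left ?_ (Real.exp_pos _).le
      refine le_trans (le_of_eq ?_) (Finset.sum_mul_sq_le_sq_mul_sq I (fun n => γ n / σ n)
        (fun n => σ n * e n t))
      congr 1
      refine Finset.sum_congr rfl fun n hn => ?_
      have := (hσ n hn).ne'
      field_simp
  refine h1.trans ?_
  rw [mul_assoc]
  refine mul_le_mul_of_nonneg_left ((finite_modes_estimate hσ he hT).2.trans ?_) hκ0
  rw [Finset.mul_sum]
  exact Finset.sum_le_sum fun n hn => mul_le_mul_of_nonneg_right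
    (Finset.single_le_sum (fun i hi => (hσ i hi).le) hn) (sq_nonneg _)

section Dynamics

variable {a b s : ℝ} {ms : Measurement} {ξ : ℝ} {Kx : Idx N₀ M₀ → ℝ} {ku : ℝ} {L : Idx N₀ M₀ → ℝ}
  {N M : ℕ} {S : ℝ → State N₀ M₀}

/-- The same scalar, up to sign, forces both the error and the observer through L; this is how the
two finite-dimensional systems are coupled. -/
theorem State.innovation_eq {S : State N₀ M₀} {ζ : ℝ}
    (hζ : S.output ms ξ = C1 ms a b s ξ N₀ M₀ ⬝ᵥ S.low a b s
      + ∑ n ∈ Finset.Ioc N₀ N, c1 ms ξ n * S.coeff1 a b s n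
      + ∑ m ∈ Finset.Ioc M₀ M, c2 ms a b s ξ m * S.coeff2 m + ζ) :
    C1 ms a b s ξ N₀ M₀ ⬝ᵥ S.X1 + ∑ n ∈ Finset.Ioc N₀ N, c1 ms ξ n * S.x1 n
      + ∑ m ∈ Finset.Ioc M₀ M, c2 ms a b s ξ m * S.x2 m - S.output ms ξ
      = -(C1 ms a b s ξ N₀ M₀ ⬝ᵥ S.error a b s + S.residual ms a b s ξ N M + ζ) := by
  rw [hζ, State.error, dotProduct_sub, State.residual]
  simp only [mul_sub, Finset.sum_sub_distrib]
  ring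

theorem IsSolution.hasDerivWithinAt_error (h : IsSolution a b s ms ξ Kx ku L N M S)
    (hΔ₂ : ∀ m ∈ Delta2 a b, m ≤ M₀) {t ζ : ℝ} (ht : 0 ≤ t)
    (hζ : (S t).output ms ξ = C1 ms a b s ξ N₀ M₀ ⬝ᵥ (S t).low a b s
      + ∑ n ∈ Finset.Ioc N₀ N, c1 ms ξ n * (S t).coeff1 a b s n
      + ∑ m ∈ Finset.Ioc M₀ M, c2 ms a b s ξ m * (S t).coeff2 m + ζ) :
    HasDerivWithinAt (fun τ => (S τ).error a b s)
      ((A1 a b s N₀ M₀ - Matrix.vecMulVec L (C1 ms a b s ξ N₀ M₀)).mulVec ((S t).error a b s)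
        + (-((S t).residual ms a b s ξ N M + ζ)) • L) (Ici 0) t := by
  convert! (h.hasDerivWithinAt_low hΔ₂ ht).sub (h.ode_X1 t ht) using 1
  rw [State.innovation_eq hζ, Matrix.sub_mulVec, Matrix.vecMulVec_mulVec]
  have e : (A1 a b s N₀ M₀).mulVec ((S t).error a b s)
      = (A1 a b s N₀ M₀).mulVec ((S t).low a b s) - (A1 a b s N₀ M₀).mulVec (S t).X1 := by
    rw [State.error, Matrix.mulVec_sub]
  rw [e]
  ext i
  simp only [Pi.add_apply, Pi.sub_apply, Pi.smul_apply, smul_eq_mul, MulOpposite.smul_eq_mul_unop,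
    MulOpposite.unop_op]
  ring

/-- The feedback uses the observer state itself, so in the variables (X̂₁, u) it is exact and the
innovation is the only remaining input. -/
theorem IsSolution.hasDerivWithinAt_aug (h : IsSolution a b s ms ξ Kx ku L N M S)
    {t ζ : ℝ} (ht : 0 ≤ t)
    (hζ : (S t).output ms ξ = C1 ms a b s ξ N₀ M₀ ⬝ᵥ (S t).low a b s
      + ∑ n ∈ Finset.Ioc N₀ N, c1 ms ξ n * (S t).coeff1 a b s n
      + ∑ m ∈ Finset.Ioc M₀ M, c2 ms a b s ξ m * (S t).coeff2 m + ζ) :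
    HasDerivWithinAt (fun τ => (S τ).aug)
      ((A1a a b s N₀ M₀ - Matrix.vecMulVec (B1a a b s N₀ M₀)
          (Sum.elim Kx fun _ => ku)).mulVec (S t).aug
        + Sum.elim ((C1 ms a b s ξ N₀ M₀ ⬝ᵥ (S t).error a b s
            + (S t).residual ms a b s ξ N M + ζ) • L) (fun _ => 0)) (Ici 0) t := by
  have e : (A1a a b s N₀ M₀ - Matrix.vecMulVec (B1a a b s N₀ M₀)
        (Sum.elim Kx fun _ => ku)).mulVec (S t).aug
      = Sum.elim ((A1 a b s N₀ M₀).mulVec (S t).X1 + (S t).u • B1u a b s N₀ M₀) (fun _ => 0)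
        + (S t).feedback Kx ku • B1a a b s N₀ M₀ := by
    rw [Matrix.sub_mulVec, Matrix.vecMulVec_mulVec, State.feedback_eq]
    ext i
    rcases i with i | i
    · simp [A1a, State.aug, Matrix.fromBlocks_mulVec, Matrix.mulVec, dotProduct]
      ring
    · simp [A1a, State.aug, Matrix.fromBlocks_mulVec]
      ring
  rw [e, hasDerivWithinAt_pi]
  rintro (i | i)
  · have h1 := hasDerivWithinAt_pi.1 (h.ode_X1 t ht) i
    rw [State.innovation_eq hζ] at h1
    convert! h1 using 1
    simp only [Pi.add_apply, Pi.sub_apply, Pi.smul_apply, smul_eq_mul, Sum.elim_inl, B1a]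
    ring
  · convert! h.ode_u t ht using 1
    simp [B1a]

/-- The intermediate observer modes copy the plant with the same inputs and no output injection, so
their errors evolve autonomously. -/
theorem IsSolution.hasDerivWithinAt_mid1 (h : IsSolution a b s ms ξ Kx ku L N M S) (δ : ℝ)
    (hΔ₁ : ∀ n ∈ Delta1 a b, n ≤ N₀) {n : ℕ} (hn : n ∈ Finset.Ioc N₀ N) {t : ℝ} (ht : 0 ≤ t) :
    HasDerivWithinAt (fun τ => (S τ).coeff1 a b s n - (S τ).x1 n)
      ((-decay1 a δ n - δ) * ((S t).coeff1 a b s n - (S t).x1 n)) (Ici 0) t := by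
  have hn' : n ∉ Delta1 a b := fun h' => (hΔ₁ n h').not_gt (Finset.mem_Ioc.1 hn).1
  convert! (h.hasDerivWithinAt_coeff1 hn' ht).sub (h.ode_x1 t ht n hn) using 1
  rw [decay1]; ring

theorem IsSolution.hasDerivWithinAt_mid2 (h : IsSolution a b s ms ξ Kx ku L N M S) (δ : ℝ)
    {m : ℕ} (hm : m ∈ Finset.Ioc M₀ M) {t : ℝ} (ht : 0 ≤ t) :
    HasDerivWithinAt (fun τ => (S τ).coeff2 m - (S τ).x2 m)
      ((-decay2 b δ m - δ) * ((S t).coeff2 m - (S t).x2 m)) (Ici 0) t := by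
  convert! (h.hasDerivWithinAt_coeff2 m ht).sub (h.ode_x2 t ht m hm) using 1
  rw [decay2]; ring

theorem exists_mid_estimate (ms : Measurement) (a b s ξ : ℝ) {δ c C c' C' : ℝ}
    (hΔ₁ : ∀ n ∈ Delta1 a b, n ≤ N₀) (hg₁ : QuadGrowth (decay1 a δ) (N₀ + 1) c C)
    (hg₂ : QuadGrowth (decay2 b δ) (M₀ + 1) c' C') (Kx : Idx N₀ M₀ → ℝ) (ku : ℝ)
    (L : Idx N₀ M₀ → ℝ) (N M : ℕ) :
    ∃ Γ : ℝ, 0 < Γ ∧ ∀ S : ℝ → State N₀ M₀, IsSolution a b s ms ξ Kx ku L N M S →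
      ContinuousOn (fun t => (S t).residual ms a b s ξ N M) (Ici 0) ∧ ∀ T, 0 ≤ T →
      Real.exp (2 * δ * T) * (S T).midEnergy a b s N M ≤ (S 0).midEnergy a b s N M ∧
      ∫ t in (0 : ℝ)..T, Real.exp (2 * δ * t) * (S t).residual ms a b s ξ N M ^ 2
        ≤ Γ * (S 0).midEnergy a b s N M := by
  have hσ₁ : ∀ n ∈ Finset.Ioc N₀ N, 0 < decay1 a δ n := fun n hn =>
    hg₁.pos (Finset.mem_Ioc.1 hn).1
  have hσ₂ : ∀ m ∈ Finset.Ioc M₀ M, 0 < decay2 b δ m := fun m hm =>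
    hg₂.pos (Finset.mem_Ioc.1 hm).1
  set κ₁ := (∑ n ∈ Finset.Ioc N₀ N, (c1 ms ξ n / decay1 a δ n) ^ 2)
    * ∑ n ∈ Finset.Ioc N₀ N, decay1 a δ n with hκ₁
  set κ₂ := (∑ m ∈ Finset.Ioc M₀ M, (c2 ms a b s ξ m / decay2 b δ m) ^ 2)
    * ∑ m ∈ Finset.Ioc M₀ M, decay2 b δ m with hκ₂
  have hκ₁0 : 0 ≤ κ₁ := mul_nonneg (Finset.sum_nonneg fun _ _ => sq_nonneg _)
    (Finset.sum_nonneg fun n hn => (hσ₁ n hn).le)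
  have hκ₂0 : 0 ≤ κ₂ := mul_nonneg (Finset.sum_nonneg fun _ _ => sq_nonneg _)
    (Finset.sum_nonneg fun m hm => (hσ₂ m hm).le)
  refine ⟨2 * κ₁ + 2 * κ₂ + 1, by positivity, fun S h => ?_⟩
  have d1 := fun n hn t ht => h.hasDerivWithinAt_mid1 δ hΔ₁ (n := n) hn (t := t) ht
  have d2 := fun m hm t ht => h.hasDerivWithinAt_mid2 δ (m := m) hm (t := t) ht
  have p1 : ContinuousOn (fun t => ∑ n ∈ Finset.Ioc N₀ N,
      c1 ms ξ n * ((S t).coeff1 a b s n - (S t).x1 n)) (Ici 0) :=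
    continuousOn_finsetSum _ fun n hn =>
      ContinuousOn.const_mul (fun t ht => (d1 n hn t ht).continuousWithinAt) _
  have p2 : ContinuousOn (fun t => ∑ m ∈ Finset.Ioc M₀ M,
      c2 ms a b s ξ m * ((S t).coeff2 m - (S t).x2 m)) (Ici 0) :=
    continuousOn_finsetSum _ fun m hm =>
      ContinuousOn.const_mul (fun t ht => (d2 m hm t ht).continuousWithinAt) _
  refine ⟨p1.add p2, fun T hT => ?_⟩
  have e1 := finite_modes_estimate (e := fun n t => (S t).coeff1 a b s n - (S t).x1 n) hσ₁ d1 hT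
  have e2 := finite_modes_estimate (e := fun m t => (S t).coeff2 m - (S t).x2 m) hσ₂ d2 hT
  have o1 := finite_output_estimate (e := fun n t => (S t).coeff1 a b s n - (S t).x1 n)
    hσ₁ d1 (c1 ms ξ) hT
  have o2 := finite_output_estimate (e := fun m t => (S t).coeff2 m - (S t).x2 m)
    hσ₂ d2 (c2 ms a b s ξ) hT
  refine ⟨?_, ?_⟩
  · rw [State.midEnergy, State.midEnergy, mul_add]
    exact add_le_add e1.1 e2.1
  · have ii : ∀ {p : ℝ → ℝ}, ContinuousOn p (Ici 0) →
        IntervalIntegrable (fun t => Real.exp (2 * δ * t) * p t ^ 2) volume 0 T := fun hp =>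
      (intervalIntegrable_iff_integrableOn_Icc_of_le hT).2 (ContinuousOn.integrableOn_Icc
        (ContinuousOn.mul (by fun_prop) ((hp.mono Icc_subset_Ici_self).pow 2)))
    have h1 := intervalIntegral.integral_mono_on hT (ii (p1.add p2))
      (((ii p1).const_mul 2).add ((ii p2).const_mul 2)) fun t _ => by
        refine (mul_le_mul_of_nonneg_left (add_sq_le_of_sq_le le_rfl le_rfl)
          (Real.exp_pos (2 * δ * t)).le).trans (le_of_eq ?_)
        rw [mul_add, mul_left_comm _ 2, mul_left_comm _ 2]
    rw [intervalIntegral.integral_add ((ii p1).const_mul 2) ((ii p2).const_mul 2),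
      intervalIntegral.integral_const_mul, intervalIntegral.integral_const_mul] at h1
    refine h1.trans ?_
    rw [State.midEnergy]
    set W₁ := ∑ n ∈ Finset.Ioc N₀ N, ((S 0).coeff1 a b s n - (S 0).x1 n) ^ 2
    set W₂ := ∑ m ∈ Finset.Ioc M₀ M, ((S 0).coeff2 m - (S 0).x2 m) ^ 2
    have hW₁ : 0 ≤ W₁ := Finset.sum_nonneg fun _ _ => sq_nonneg _
    have hW₂ : 0 ≤ W₂ := Finset.sum_nonneg fun _ _ => sq_nonneg _
    have m1 := mul_nonneg hκ₁0 hW₂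
    have m2 := mul_nonneg hκ₂0 hW₁
    linarith only [o1, o2, m1, m2, hW₁, hW₂]

end Dynamics

set_option maxHeartbeats 1000000 in
-- The constants must precede N and M, since the admissible size of ζ decides how large these have
-- to be. This is possible because the input gain A is taken over all modes.
theorem exists_loopEnergy_estimate {a b s : ℝ} {δ c C c' C' : ℝ} (ms : Measurement) (ξ : ℝ)
    (hΔ₁ : ∀ n ∈ Delta1 a b, n ≤ N₀) (hΔ₂ : ∀ m ∈ Delta2 a b, m ≤ M₀)
    (hg₁ : QuadGrowth (decay1 a δ) (N₀ + 1) c C) (hg₂ : QuadGrowth (decay2 b δ) (M₀ + 1) c' C')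
    (Kx : Idx N₀ M₀ → ℝ) (ku : ℝ) (L : Idx N₀ M₀ → ℝ)
    (hK : HurwitzWithRate
      (A1a a b s N₀ M₀ - Matrix.vecMulVec (B1a a b s N₀ M₀) (Sum.elim Kx fun _ => ku)) δ)
    (hL : HurwitzWithRate
      (A1 a b s N₀ M₀ - Matrix.vecMulVec L (C1 ms a b s ξ N₀ M₀)) δ) :
    ∃ ε₀ C₀ : ℝ, 0 < ε₀ ∧ 0 < C₀ ∧ ∀ (N M : ℕ) (S : ℝ → State N₀ M₀) (ζ : ℝ → ℝ),
      IsSolution a b s ms ξ Kx ku L N M S →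
      (∀ t, 0 ≤ t → (S t).output ms ξ = C1 ms a b s ξ N₀ M₀ ⬝ᵥ (S t).low a b s
          + ∑ n ∈ Finset.Ioc N₀ N, c1 ms ξ n * (S t).coeff1 a b s n
          + ∑ m ∈ Finset.Ioc M₀ M, c2 ms a b s ξ m * (S t).coeff2 m + ζ t) →
      (∀ t, 0 ≤ t → ζ t ^ 2
        ≤ ε₀ * (∑' k, (decay1 a δ (k + (N₀ + 1)) * (S t).coeff1 a b s (k + (N₀ + 1))) ^ 2
          + ∑' k, (decay2 b δ (k + (M₀ + 1)) * (S t).coeff2 (k + (M₀ + 1))) ^ 2)) →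
      ContinuousOn (fun t => (S t).residual ms a b s ξ N M) (Ici 0) →
      ∀ T, 0 ≤ T → Real.exp (2 * δ * T) * (S T).loopEnergy a b s δ
        ≤ C₀ * ((S 0).loopEnergy a b s δ
          + ∫ t in (0 : ℝ)..T, Real.exp (2 * δ * t) * (S t).residual ms a b s ξ N M ^ 2) := by
  have hA₁ : Summable fun n => alpha1 a b s n ^ 2 + beta1 a b s n ^ 2 :=
    (summable_sq_mul_integral_psi1 hΔ₁ (memLp_alpha b)).add
      (summable_sq_mul_integral_psi1 hΔ₁ memLp_beta)
  have hA₂ : Summable fun m => alpha2 b m ^ 2 + beta2 m ^ 2 :=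
    (isONFamily_psi2.summable_sq (memLp_alpha b)).add (isONFamily_psi2.summable_sq memLp_beta)
  have hn₁ : ∀ n, 0 ≤ alpha1 a b s n ^ 2 + beta1 a b s n ^ 2 := fun n => by positivity
  have hn₂ : ∀ m, 0 ≤ alpha2 b m ^ 2 + beta2 m ^ 2 := fun m => by positivity
  have ha₁ : 0 ≤ ∑' n, (alpha1 a b s n ^ 2 + beta1 a b s n ^ 2) := tsum_nonneg hn₁
  have ha₂ : 0 ≤ ∑' m, (alpha2 b m ^ 2 + beta2 m ^ 2) := tsum_nonneg hn₂
  obtain ⟨ε₀, C₀, hε₀, hC₀, key⟩ := closed_loop_estimate (add_nonneg ha₁ ha₂) hL hK L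
    (C1 ms a b s ξ N₀ M₀) (Sum.elim Kx fun _ => ku)
  obtain ⟨Λ, -, hΛ⟩ := exists_plantEnergy_bounds s hΔ₁ hg₁ hg₂
  refine ⟨ε₀, C₀, hε₀, hC₀, fun N M S ζ h hζ hζle hpc T hT => ?_⟩
  obtain ⟨s1, s2, -⟩ := hΛ _ (h.admissible 0 le_rfl)
  exact (key (fun t => (S t).error a b s) (fun t => (S t).aug)
    (fun t => (S t).residual ms a b s ξ N M) ζ
    (fun k => decay1 a δ (k + (N₀ + 1))) (fun k => alpha1 a b s (k + (N₀ + 1)))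
    (fun k => beta1 a b s (k + (N₀ + 1))) (fun k => decay2 b δ (k + (M₀ + 1)))
    (fun k => alpha2 b (k + (M₀ + 1))) (fun k => beta2 (k + (M₀ + 1)))
    (fun k t => (S t).coeff1 a b s (k + (N₀ + 1))) (fun k t => (S t).coeff2 (k + (M₀ + 1)))
    ε₀ hε₀.le le_rfl
    (fun t ht => h.hasDerivWithinAt_error hΔ₂ ht (hζ t ht))
    (fun t ht => h.hasDerivWithinAt_aug ht (hζ t ht))
    (fun k => hg₁.pos (Nat.le_add_left _ k)) (fun k => hg₂.pos (Nat.le_add_left _ k))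
    ((summable_nat_add_iff (N₀ + 1)).2 hA₁)
    ((tsum_nat_add_le hA₁ hn₁ _).trans (le_add_of_nonneg_right ha₂))
    ((summable_nat_add_iff (M₀ + 1)).2 hA₂)
    ((tsum_nat_add_le hA₂ hn₂ _).trans (le_add_of_nonneg_left ha₁))
    (fun k t ht => by
      have hk : k + (N₀ + 1) ∉ Delta1 a b := fun h' => by have := hΔ₁ _ h'; omega
      convert! h.hasDerivWithinAt_coeff1 hk ht using 1
      rw [State.feedback_eq, decay1, State.aug, Sum.elim_inr]
      ring)
    (fun k t ht => by
      convert! h.hasDerivWithinAt_coeff2 (k + (M₀ + 1)) ht using 1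
      rw [State.feedback_eq, decay2, State.aug, Sum.elim_inr]
      ring)
    (hg₁.summable_mul_sq s1) (hg₂.summable_mul_sq s2) hζle hpc T hT).2.2

end HeatCascade

/-! ### Assembly of the exponential decay estimate -/

open HeatCascade

theorem theorem3 (a b s : ℝ) (hs : s ≠ 0)
    -- the measurement `y(t, ξ)` or `∂ₓ y(t, ξ)`
    (ms : Measurement) (ξ : ℝ) (hξ : ξ ∈ Set.Icc (0 : ℝ) 1)
    -- the decay rate and the truncation orders
    (δ : ℝ) (hδ : 0 < δ) (N₀ M₀ : ℕ)
    (hN₀ : lam1 a (N₀ + 1) < -δ) (hM₀ : lam2 b (M₀ + 1) < -δ)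
    (hΔ₁ : ∀ n ∈ Delta1 a b, n ≤ N₀) (hΔ₂ : ∀ m ∈ Delta2 a b, m ≤ M₀)
    -- controllability and observability of the modes
    (hctrl : ∀ n ≤ N₀, n ∉ Theta a b)
    (hobs : Observable ms a b ξ N₀ M₀)
    -- the feedback gain `K = [K_x, k_u]` and the observer gain `L`
    (Kx : Idx N₀ M₀ → ℝ) (ku : ℝ) (L : Idx N₀ M₀ → ℝ)
    (hK : HurwitzWithRate
      (A1a a b s N₀ M₀ - Matrix.vecMulVec (B1a a b s N₀ M₀) (Sum.elim Kx fun _ => ku)) δ)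
    (hL : HurwitzWithRate
      (A1 a b s N₀ M₀ - Matrix.vecMulVec L (C1 ms a b s ξ N₀ M₀)) δ) :
    ∃ Nmin Mmin : ℕ, N₀ ≤ Nmin ∧ M₀ ≤ Mmin ∧
      ∀ N M : ℕ, Nmin ≤ N → Mmin ≤ M →
        ∃ C : ℝ, 0 < C ∧
          ∀ S₀ : State N₀ M₀, S₀.Admissible s →
            ∀ S : ℝ → State N₀ M₀, IsSolution a b s ms ξ Kx ku L N M S → S 0 = S₀ →
              ∀ t : ℝ, 0 ≤ t →
                (S t).energy N M ≤ C * Real.exp (-2 * δ * t) * S₀.energy N M := by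
  have hg₁' := quadGrowth_lam1 (a := a) (δ := δ) (n₀ := N₀ + 1) (by exact_mod_cast hN₀)
  have hg₂' := quadGrowth_lam2 (b := b) (δ := δ) (m₀ := M₀ + 1) (Nat.le_add_left _ _)
    (by exact_mod_cast hM₀)
  obtain ⟨c, C, hg₁⟩ := hg₁'
  obtain ⟨c', C', hg₂⟩ := hg₂'
  change QuadGrowth (decay1 a δ) (N₀ + 1) c C at hg₁
  change QuadGrowth (decay2 b δ) (M₀ + 1) c' C' at hg₂
  obtain ⟨ε₀, C₀, hε₀, hC₀, key⟩ := exists_loopEnergy_estimate ms ξ hΔ₁ hΔ₂ hg₁ hg₂ Kx ku L hK hL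
  -- The observer orders are chosen here, from the small-gain threshold `ε₀`; the constants found
  -- afterwards may depend on N and M.
  obtain ⟨Nmin, Mmin, hNmin, hMmin, hres⟩ :=
    exists_output_residual s ms hξ hΔ₁ hΔ₂ hg₁ hg₂ hε₀
  refine ⟨Nmin, Mmin, hNmin, hMmin, fun N M hN hM => ?_⟩
  obtain ⟨Γ, hΓ, hE⟩ := exists_energy_equiv s hΔ₁ hg₁ hg₂ N M
  obtain ⟨G, hG, hmid⟩ := exists_mid_estimate ms a b s ξ hΔ₁ hg₁ hg₂ Kx ku L N M
  -- The two factors Γ convert the energy to modal form and back; `C₀ * (1 + G)` bounds the loop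
  -- energy, with G the gain from intermediate errors to their output, and 1 covers the intermediate
  -- errors themselves.
  refine ⟨Γ * (C₀ * (1 + G) + 1) * Γ, by positivity, fun S₀ hS₀ S h hS0 T hT => ?_⟩
  subst hS0
  choose! ζ hζ hζle using fun t (ht : 0 ≤ t) => hres N M hN hM (S t) (h.admissible t ht)
  obtain ⟨hpc, hmidT⟩ := hmid S h
  obtain ⟨w1, w2⟩ := hmidT T hT
  have v1 := key N M S ζ h hζ hζle hpc T hT
  have hadm := h.admissible T hT
  have hV : 0 ≤ (S 0).loopEnergy a b s δ := by
    refine add_nonneg (add_nonneg (add_nonneg ?_ ?_) ?_) ?_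
    · exact Finset.sum_nonneg fun _ _ => sq_nonneg _
    · exact Finset.sum_nonneg fun _ _ => sq_nonneg _
    · exact tsum_nonneg fun k => mul_nonneg (hg₁.pos (Nat.le_add_left _ k)).le (sq_nonneg _)
    · exact tsum_nonneg fun k => mul_nonneg (hg₂.pos (Nat.le_add_left _ k)).le (sq_nonneg _)
  have hW : 0 ≤ (S 0).midEnergy a b s N M :=
    add_nonneg (Finset.sum_nonneg fun _ _ => sq_nonneg _) (Finset.sum_nonneg fun _ _ => sq_nonneg _)
  have v2 := v1.trans (mul_le_mul_of_nonneg_left (add_le_add_right w2 _) hC₀.le)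
  have v3 : Real.exp (2 * δ * T) * ((S T).loopEnergy a b s δ + (S T).midEnergy a b s N M)
      ≤ (C₀ * (1 + G) + 1) * ((S 0).loopEnergy a b s δ + (S 0).midEnergy a b s N M) := by
    have m1 := mul_nonneg (mul_nonneg hC₀.le hG.le) hV
    have m2 := mul_nonneg hC₀.le hW
    linarith only [v2, w1, m1, m2, hV]
  have hexp : Real.exp (-2 * δ * T) * Real.exp (2 * δ * T) = 1 := by
    rw [← Real.exp_add]; simp
  calc (S T).energy N M
      ≤ Γ * ((S T).loopEnergy a b s δ + (S T).midEnergy a b s N M) := (hE _ hadm).1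
    _ = Γ * (Real.exp (-2 * δ * T)
          * (Real.exp (2 * δ * T) * ((S T).loopEnergy a b s δ + (S T).midEnergy a b s N M))) := by
        rw [← mul_assoc (Real.exp _), hexp, one_mul]
    _ ≤ Γ * (Real.exp (-2 * δ * T) * ((C₀ * (1 + G) + 1) * (Γ * (S 0).energy N M))) := by
        refine mul_le_mul_of_nonneg_left (mul_le_mul_of_nonneg_left ?_ (Real.exp_pos _).le) hΓ.le
        exact v3.trans (mul_le_mul_of_nonneg_left (hE _ hS₀).2 (by positivity))
    _ = Γ * (C₀ * (1 + G) + 1) * Γ * Real.exp (-2 * δ * T) * (S 0).energy N M := by ring
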